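/- **Setting.** Let $n\ge 2$, $\theta=t\,\frac{d}{dt}$. A *Calabi–Yau operator* of order $n$ is an irreducible Fuchsian operator $\mathcal L_n=\theta^n+\sum_{i=1}^{r}t^iP_i(\theta)$, $P_i\in\mathbb C[\theta]$ of degree at most $n$, that is self-adjoint, normalized so that $\mathcal L_n\,t=(-1)^n\,t\,\mathcal L_n^{\dagger}$ (with $\dagger$ the formal adjoint with respect to $\frac{d}{dt}$), and satisfies the integrality conditions below. At $t=0$ it has a unique canonical (Frobenius) basis of solutions $$\omega_k=\frac1{(2\pi i)^k}\sum_{j=0}^{k}\binom kj h_j(t)\log^{k-j}t,\qquad 0\le k\le n-1,$$ with $h_j$ holomorphic at $0$, $h_0(0)=1$ and $h_j(0)=0$ for $j\ge1$. The integrality conditions are: $h_0(Nt)\in\mathbb Z[[t]]$ for some integer $N>1$; $q(t)=t\exp(h_1/h_0)\in t\,\mathbb Z[[t]]$; and, if $n\ge3$, the Yukawa coupling $(q\frac{d}{dq})^2(\omega_2/\omega_0)$, scaled to have constant term $1$, equals $1+\sum_{k\ge1}k^3N_k\frac{q^k}{1-q^k}$ with $mN_k\in\mathbb Z$ for all $k$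 and some fixed integer $m\geq 1$. The operator $\mathcal D_{n+1}=\theta\cdot\mathcal L_n$ has one more canonical solution $\omega_n$, of the same form with $k=n$ and with the same $h_0,\dots,h_{n-1}$. Let $\Gamma\subset \mathrm{SL}(2,\mathbb R)$ be commensurable with $\mathrm{SL}(2,\mathbb Z)$ and of genus zero, and let $\chi:\Gamma\to\{\pm1\}$ be a character (for instance the trivial one). Write $M_k(\Gamma,\chi)$ for the holomorphic modular forms of weight $k$ for $\Gamma$ with character $\chi$, so $M_k(\Gamma,1)=M_k(\Gamma)$. Suppose that $\mathcal L_n$ is modular for $(\Gamma,\chi)$: the mirror map $t(\tau)$, i.e. the local inverse of $q(t)$ with $q=e^{2\pi i\tau}$ (equivalently $\tau=\omega_1/\omega_0$), is the expansion at $i\infty$ of a Hauptmodul of $\Gamma$, and $\omega_0(t(\tau))$ is the expansion at $i\infty$ of a modular form $F\in M_{n-1}(\Gamma,\chi)$. Put $t'=\frac1{2\pi i}\frac{dt}{d\tau}$. **Proposition.** The holomorphic prepotential $$\mathfrak F(\tau)=\frac{1}{(2\pi i)^n\,n!}\,\frac{\omega_n(t(\tau))}{\omega_0(t(\tau))}$$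 (defined for $\operatorname{Im}\tau$ large, with the branch of $\log t$ for which $\omega_1/\omega_0=\tau$) extends to a holomorphic function on the upper half plane $\mathbb H$, and the virtual Yukawa coupling $\mathscr Y=d^n\mathfrak F/d\tau^n$ is a modular form in $M_{n+1}(\Gamma,\chi)$; that is, $\mathfrak F$ is a rank-$n$ Eichler integral of $\mathscr Y\in M_{n+1}(\Gamma,\chi)$. In particular, for trivial $\chi$, $\mathscr Y\in M_{n+1}(\Gamma)$. Explicitly, $$\mathscr Y=\frac1{(2\pi i)^n}\,F\,\frac{t'}{t}.$$ Moreover $\mathcal L_n\omega_n$ is the nonzero constant $n!/(2\pi i)^n$, and if $\omega_n$ is replaced by its multiple $c\,\omega_n$ with $\mathcal L_n(c\,\omega_n)=1$, then the corresponding coupling $d^n(c\,\mathfrak F)/d\tau^n$ equals $\frac1{n!}\,F\,\frac{t'}{t}$. -/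

import Mathlib

open Filter Topology UpperHalfPlane Polynomial
open scoped MatrixGroups ModularForm Manifold

noncomputable section

namespace VirtualYukawa

/-! ### Differential operators in `t` and `θ = t d/dt` -/

/-- The operator `∑ᵢ tⁱ Pᵢ(θ)`, `θ = t d/dt`, is encoded by its coefficients `Pᵢ ∈ ℂ[θ]`:
the outer variable is `t`, written to the left, and the inner one is `θ`. Addition and scalars are
those of polynomials; composition of operators is `thetaMul` (not the commutative product). -/
abbrev ThetaOp : Type := ℂ[X][X]

/-- Composition of operators, from `(tⁱ P(θ)) (tʲ Q(θ)) = tⁱ⁺ʲ P(θ + j) Q(θ)`. -/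
def thetaMul (A B : ThetaOp) : ThetaOp :=
  A.sum fun i P => B.sum fun j Q => monomial (i + j) (P.comp (X + C (j : ℂ)) * Q)

/-- The operator `θ`. -/
def theta : ThetaOp := C X

/-- Multiplication by a polynomial function `a(t)`, as an operator. -/
def ofFun (a : ℂ[X]) : ThetaOp := a.map C

/-- The formal adjoint with respect to `d/dt` (an anti-automorphism with `t† = t` and
`(d/dt)† = -d/dt`, so `θ† = -θ - 1` and `(tⁱ P(θ))† = P(-θ - 1) tⁱ = tⁱ P(-θ - 1 - i)`). -/
def adjoint (L : ThetaOp) : ThetaOp :=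
  L.sum fun i P => monomial i (P.comp (-X - C ((i : ℂ) + 1)))

/-- The coefficient `cⱼ(t)` of `θʲ` in `L = ∑ⱼ cⱼ(t) θʲ`. -/
def thetaCoeff (L : ThetaOp) (j : ℕ) : ℂ[X] :=
  L.sum fun i P => monomial i (P.coeff j)

/-- The order of the operator (the largest power of `θ` that occurs). -/
def order (L : ThetaOp) : ℕ := L.support.sup fun i => (L.coeff i).natDegree

/-- The quantum differential operator `θ · L`. -/
def quantumOp (L : ThetaOp) : ThetaOp := thetaMul theta L

/-- The action of an operator on (multivalued) functions near `t = 0`. Such a function is given in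
the coordinate `s = log t` of the universal cover of the punctured disc; there `t = exp s` and
`θ = d/ds`. -/
def applyOp (L : ThetaOp) (f : ℂ → ℂ) (s : ℂ) : ℂ :=
  L.sum fun i P => Complex.exp s ^ i * P.sum fun j a => a * iteratedDeriv j f s

/-- The neighbourhoods of `t = 0` in the coordinate `s = log t`: the half planes `Re s < c`. -/
def nearZero : Filter ℂ := comap Complex.re atBot

/-- All singular points of `L`, an operator of order `n`, are regular (Fuchs' criterion at `t = 0`,
at `t = t₁ ≠ 0` and at `t = ∞`, in terms of the coefficients of the powers of `θ`). -/
structure IsFuchsian (n : ℕ) (L : ThetaOp) : Prop where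
  zero : ∀ j ≤ n, X ^ (thetaCoeff L n).rootMultiplicity 0 ∣ thetaCoeff L j
  finite : ∀ t₁ : ℂ, t₁ ≠ 0 → ∀ j ≤ n,
    (X - C t₁) ^ ((thetaCoeff L n).rootMultiplicity t₁ - j) ∣ thetaCoeff L (n - j)
  infinity : ∀ j ≤ n, (thetaCoeff L j).natDegree ≤ (thetaCoeff L n).natDegree

/-- `L` is irreducible over `ℂ(t)`: it is not a product of two operators of positive order with
coefficients in `ℂ(t)`. (Denominators are cleared to the left.) -/
def IsIrreducibleOp (L : ThetaOp) : Prop :=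
  0 < order L ∧ ∀ (a : ℂ[X]) (A B : ThetaOp), a ≠ 0 → thetaMul (ofFun a) L = thetaMul A B →
    order A = 0 ∨ order B = 0

/-- `L h = (-1)ⁿ h L†`, for an operator `L` of order `n` and a multiplier `h(t)`. -/
def IsSelfAdjointVia (n : ℕ) (L : ThetaOp) (h : ℂ[X]) : Prop :=
  thetaMul L (ofFun h) = (-1 : ℂ) ^ n • thetaMul (ofFun h) (adjoint L)

/-! ### Frobenius bases -/

/-- `ω_k = (2πi)⁻ᵏ ∑_{j ≤ k} binom(k,j) h_j(t) log(t)^{k-j}`, as a function of `s = log t`. -/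
def omega (h : ℕ → ℂ → ℂ) (k : ℕ) (s : ℂ) : ℂ :=
  (2 * Real.pi * Complex.I : ℂ)⁻¹ ^ k *
    ∑ j ∈ Finset.range (k + 1), (k.choose j : ℂ) * h j (Complex.exp s) * s ^ (k - j)

/-- `ω_0, …, ω_{n-1}` is the canonical (Frobenius) basis of solutions of `L ω = 0` at `t = 0`, for
an operator `L` of order `n`; only `h 0, …, h (n-1)` matter, and only near `0`. -/
structure IsFrobeniusBasis (n : ℕ) (L : ThetaOp) (h : ℕ → ℂ → ℂ) : Prop where
  analytic : ∀ k < n, AnalyticAt ℂ (h k) 0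
  h_zero : h 0 0 = 1
  h_pos : ∀ k < n, 0 < k → h k 0 = 0
  solution : ∀ k < n, ∀ᶠ s in nearZero, applyOp L (omega h k) s = 0

/-- `log q = 2πi ω_1/ω_0`, as a function of `s = log t`. -/
def logQ (h : ℕ → ℂ → ℂ) (s : ℂ) : ℂ :=
  2 * Real.pi * Complex.I * (omega h 1 s / omega h 0 s)

/-- The derivation `q d/dq`, on functions of `s = log t`. -/
def qDeriv (h : ℕ → ℂ → ℂ) (f : ℂ → ℂ) (s : ℂ) : ℂ := deriv f s / deriv (logQ h) s

/-- The (classical) Yukawa coupling `(q d/dq)² (ω_2/ω_0)`, scaled to have constant term `1`. -/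
def classicalYukawa (h : ℕ → ℂ → ℂ) (s : ℂ) : ℂ :=
  (2 * Real.pi * Complex.I) ^ 2 / 2 *
    qDeriv h (qDeriv h fun z => omega h 2 z / omega h 0 z) s

/-- `L` is a Calabi–Yau operator of order `n` with Frobenius basis given by `h`.

The operator is normalized as follows (multiplying `L` on the left by a function of `t` changes
neither its solutions nor its self-adjointness in the wide sense): the `t`-constant part is `θⁿ`,
and the self-adjointness relation `L h = (-1)ⁿ h L†` holds with `h(t) = t`; equivalently, `L` is
`(-1)ⁿ` times its adjoint with respect to `dt/t`. -/
structure IsCalabiYauOp (n : ℕ) (L : ThetaOp) (h : ℕ → ℂ → ℂ) : Prop where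
  order_le : ∀ i, (L.coeff i).natDegree ≤ n
  mum : L.coeff 0 = X ^ n
  frobenius : IsFrobeniusBasis n L h
  fuchsian : IsFuchsian n L
  irreducible : IsIrreducibleOp L
  selfAdjoint : IsSelfAdjointVia n L X
  /-- The holomorphic solution is `N`-integral for some `N > 1`. -/
  integral_period : ∃ N : ℕ, 1 < N ∧ ∃ c : ℕ → ℤ,
    ∀ᶠ t : ℂ in 𝓝 0, HasSum (fun k => (c k : ℂ) * t ^ k) (h 0 (N * t))
  /-- The `q`-coordinate `t exp(h_1/h_0)` has integral Taylor coefficients. -/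
  integral_q : ∃ c : ℕ → ℤ,
    ∀ᶠ t : ℂ in 𝓝 0, HasSum (fun k => (c k : ℂ) * t ^ k) (t * Complex.exp (h 1 t / h 0 t))
  /-- The instanton numbers `N_k` of the Lambert expansion `1 + ∑_{k ≥ 1} k³ N_k qᵏ/(1 - qᵏ)` of the
  Yukawa coupling have a common denominator `m`. (For `n = 2` there is no `ω_2`.) -/
  integral_instanton : 3 ≤ n → ∃ m : ℕ, 0 < m ∧ ∃ c : ℕ → ℤ, ∀ᶠ s in nearZero,
    HasSum (fun k : ℕ => ((k : ℂ) + 1) ^ 3 * ((c (k + 1) : ℂ) / m) *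
      (Complex.exp (logQ h s) ^ (k + 1) / (1 - Complex.exp (logQ h s) ^ (k + 1))))
      (classicalYukawa h s - 1)

/-! ### Modular forms, modular functions, Hauptmoduln -/

/-- A subgroup of `SL(2, ℝ)`, viewed in `GL(2, ℝ)`. -/
abbrev toGL (Γ : Subgroup SL(2, ℝ)) : Subgroup (GL (Fin 2) ℝ) :=
  Γ.map (Matrix.SpecialLinearGroup.mapGL ℝ)

/-- `f` is a (holomorphic) modular form of weight `k` for `Γ` with the sign character `χ`. -/
structure IsModularForm (Γ : Subgroup SL(2, ℝ)) (χ : Γ →* ℤˣ) (k : ℤ) (f : ℍ → ℂ) : Prop where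
  slash : ∀ γ : Γ, f ∣[k] (Matrix.SpecialLinearGroup.mapGL ℝ (γ : SL(2, ℝ))) =
    (((χ γ : ℤˣ) : ℤ) : ℂ) • f
  holo : MDiff f
  bdd_at_cusps : ∀ c : OnePoint ℝ, IsCusp c (toGL Γ) → c.IsBoundedAt f k

/-- For the trivial character this is Mathlib's notion. -/
theorem isModularForm_one_iff (Γ : Subgroup SL(2, ℝ)) (k : ℤ) (f : ℍ → ℂ) :
    IsModularForm Γ 1 k f ↔ ∃ g : ModularForm (toGL Γ) k, ⇑g = f := by
  constructor
  · intro hf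
    refine ⟨⟨⟨f, ?_⟩, hf.holo, fun {c} hc => hf.bdd_at_cusps c hc⟩, rfl⟩
    rintro _ ⟨γ, hγ, rfl⟩
    simpa using hf.slash ⟨γ, hγ⟩
  · rintro ⟨g, rfl⟩
    refine ⟨fun γ => ?_, g.holo', fun c hc => g.bdd_at_cusps' hc⟩
    simpa using g.slash_action_eq' _ (Subgroup.mem_map_of_mem _ γ.2)

/-- `f` is a modular function for `Γ`: meromorphic on the upper half plane, `Γ`-invariant and
meromorphic at the cusps (at most exponential growth there). Values at poles are immaterial. -/
structure IsModularFunction (Γ : Subgroup SL(2, ℝ)) (f : ℍ → ℂ) : Prop where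
  mero : MeromorphicOn (f ∘ ofComplex) {z | 0 < z.im}
  invariant : ∀ γ ∈ Γ, ∀ τ : ℍ, f (γ • τ) = f τ
  mero_at_cusps : ∀ g : SL(2, ℝ),
    IsCusp (Matrix.SpecialLinearGroup.mapGL ℝ g • (OnePoint.infty : OnePoint ℝ)) (toGL Γ) →
    ∃ c : ℝ, (fun τ : ℍ => f (g • τ)) =O[atImInfty] fun τ : ℍ => Real.exp (c * τ.im)

/-- `t` is a Hauptmodul: every modular function is a rational function of the modular function
`t`, that is `ℂ(X) = ℂ(t)` for the modular curve `X` of `Γ`. The existence of a (nonconstant) such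
`t` says that `X` has genus zero. -/
structure IsHauptmodul (Γ : Subgroup SL(2, ℝ)) (t : ℍ → ℂ) : Prop where
  modular : IsModularFunction Γ t
  generates : ∀ f : ℍ → ℂ, IsModularFunction Γ f → ∃ P Q : ℂ[X],
    f =ᶠ[codiscrete ℍ] fun τ => P.eval (t τ) / Q.eval (t τ)

/-- The operator with Frobenius basis given by `h` is modular for `Γ` (with sign character `χ`): its
mirror map, the local inverse `t(τ)` of `q(t) = t exp(h_1/h_0)` with `q = exp(2πiτ)`, is (the
expansion at `i∞` of) a Hauptmodul `t` of `Γ`, and `ω_0(t(τ))` is (the expansion of) a modular form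
`F` of weight `n - 1`. -/
structure IsModularParametrization (Γ : Subgroup SL(2, ℝ)) (χ : Γ →* ℤˣ) (n : ℕ)
    (h : ℕ → ℂ → ℂ) (t F : ℍ → ℂ) : Prop where
  hauptmodul : IsHauptmodul Γ t
  tendsto : Tendsto t atImInfty (𝓝 0)
  mirror : ∀ᶠ τ : ℍ in atImInfty,
    t τ * Complex.exp (h 1 (t τ) / h 0 (t τ)) = Complex.exp (2 * Real.pi * Complex.I * τ)
  modular : IsModularForm Γ χ ((n : ℤ) - 1) F
  period : ∀ᶠ τ : ℍ in atImInfty, F τ = h 0 (t τ)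

/-! ### Prepotential, Eichler integrals -/

/-- The branch of `log t` along the mirror map `t(τ)` for which `ω_1/ω_0 = τ`. -/
def logMirror (h : ℕ → ℂ → ℂ) (t : ℍ → ℂ) (τ : ℍ) : ℂ :=
  2 * Real.pi * Complex.I * τ - h 1 (t τ) / h 0 (t τ)

/-- The holomorphic prepotential `ω_n / ((2πi)ⁿ n! ω_0)`, as a function of `s = log t`. -/
def prepotential (n : ℕ) (h : ℕ → ℂ → ℂ) (s : ℂ) : ℂ :=
  1 / ((2 * Real.pi * Complex.I) ^ n * n.factorial) * (omega h n s / omega h 0 s)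

/-- `E` is a rank-`k` Eichler integral of `G`: it is holomorphic on the upper half plane and its
`k`-th derivative is `G`. -/
def IsEichlerIntegral (k : ℕ) (E : ℂ → ℂ) (G : ℍ → ℂ) : Prop :=
  DifferentiableOn ℂ E {z | 0 < z.im} ∧ ∀ τ : ℍ, iteratedDeriv k E (τ : ℂ) = G τ

/-- The logarithmic derivative `t'/t`, where `t' = (2πi)⁻¹ dt/dτ`. -/
def logDerivative (t : ℍ → ℂ) (τ : ℍ) : ℂ :=
  1 / (2 * Real.pi * Complex.I) * deriv (t ∘ ofComplex) (τ : ℂ) / t τ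

end VirtualYukawa

end

/-!
# The virtual Yukawa coupling is modular

Write `T(z)` and `Φ(z)` for `t` and `F` as functions on the upper half plane, `N = 2πi`,
`w = T / T'` (so that `θ` becomes `f ↦ w f'`) and `c_j(t)` for the coefficient of `θ ^ j` in `L`.

By the identity theorem `L` annihilates `Φ` wherever `T` is a local coordinate. Since `T` is
invariant under `Γ` and `Φ` has weight `n - 1`, `L` also annihilates `(c z + d) ^ (n - 1) Φ` for all
rows `(c, d)` of `Γ`, hence all of `Φ, z Φ, …, z ^ (n - 1) Φ` (`annihilatesTwists_of_modular`). So
`L (Φ f) = c_n(T) Φ w ^ n f⁽ⁿ⁾` for every `f` (`AnnihilatesTwists.opAlong_mul`). Comparing the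
subleading coefficients with the self-adjointness of `L` gives the Wronskian identity
`Φ² c_n(T) w ^ (n - 1) = N ^ (1 - n)` (`AnnihilatesTwists.deriv_eq_zero`). Both relations are
preserved by translation by `SL(2, ℝ)` (`SymmetricPair.translate`).

Near `i∞` the prepotential `𝔉` satisfies `Φ 𝔉 = ω_n / (N ^ n n!)`. The function `L ω_n` is killed by
`θ`, and its constant value `n! / N ^ n` is read off from the leading term `(log t / N) ^ n` of
`ω_n` (`IsFrobeniusBasis.applyOp_omega`). Solving for the `n`-th derivative and inserting the
Wronskian identity gives `𝔉⁽ⁿ⁾ = N⁻ⁿ Φ · N⁻¹ T' / T`. This expression makes sense on the whole upper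
half plane and has weight `n + 1` for `Γ`; what remains is its behaviour at the zeros and poles of
`T` and at the cusps. At a cusp `T' / T` is bounded because `T` is meromorphic in the local
parameter (`SymmetricPair.exists_bound`). The Wronskian identity excludes zeros of `T`
(`SymmetricPair.order_nonpos`).

The delicate point is that the simple poles of `T' / T` at the poles of `T` have to be cancelled by
zeros of `Φ` (`IsModularParametrization.eq_zero_of_pole`). Suppose that `Φ` does not vanish at some
pole of `T`. The identity `L 1 = c_0`, that is `c_0(T) = c_n(T) Φ w ^ n (1 / Φ)⁽ⁿ⁾`, shows that
`c_0 / c_n` vanishes at `t = ∞`. By the same identity a zero of `Φ`, in the upper half plane or at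
a cusp, would force a pole of `c_0` or prevent `c_0 / c_n` from vanishing at infinity
(`false_of_tendsto_zero`). So `Φ` has no zeros at all, and `1 / F²` is a nonzero modular form of
negative weight, which does not exist.

Finally the holomorphic function so obtained has an `n`-fold primitive on the upper half plane,
with integration constants chosen to match the prepotential near `i∞` (`exists_iteratedDeriv_eq`).
-/

noncomputable section

namespace VirtualYukawa

/-! ### Operators along a parametrization -/

/-- The derivation `θ = t d/dt` on functions of a parameter `z`, for a parametrization `t = T(z)`:
`θ f = (T / T') f'`. -/
def thetaAlong (T f : ℂ → ℂ) : ℂ → ℂ := fun z => T z / deriv T z * deriv f z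

/-- The action of the operator `L` on functions of a parameter `z`, for a parametrization
`t = T(z)`. -/
def opAlong (L : ThetaOp) (T f : ℂ → ℂ) (z : ℂ) : ℂ :=
  L.sum fun i P => T z ^ i * P.sum fun j a => a * (thetaAlong T)^[j] f z

/-- A point at which `T` is holomorphic and a local coordinate for `log T`: there `T / T'` is
holomorphic and does not vanish. -/
structure IsRegularPoint (T : ℂ → ℂ) (z : ℂ) : Prop where
  analyticAt : AnalyticAt ℂ T z
  ne_zero : T z ≠ 0
  deriv_ne_zero : deriv T z ≠ 0

lemma sum_sum_eq_sum_thetaCoeff {n : ℕ} {L : ThetaOp} (hL : ∀ i, (L.coeff i).natDegree ≤ n)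
    (x : ℂ) (c : ℕ → ℂ) :
    (L.sum fun i P => x ^ i * P.sum fun j a => a * c j) =
      ∑ j ∈ Finset.range (n + 1), (thetaCoeff L j).eval x * c j := by
  have h1 : ∀ j, (thetaCoeff L j).eval x = ∑ i ∈ L.support, x ^ i * (L.coeff i).coeff j := by
    intro j
    simp [thetaCoeff, Polynomial.sum, eval_finsetSum, mul_comm]
  have h2 : ∀ i, ((L.coeff i).sum fun j a => a * c j) =
      ∑ j ∈ Finset.range (n + 1), (L.coeff i).coeff j * c j := fun i =>
    Polynomial.sum_over_range' _ (by simp) _ (Nat.lt_succ_of_le (hL i))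
  rw [Polynomial.sum_def]
  simp only [h1, h2, Finset.mul_sum, Finset.sum_mul]
  rw [Finset.sum_comm]
  simp [mul_assoc]

/-- The operator in the form `∑ⱼ cⱼ(t) θʲ`. -/
lemma opAlong_eq_sum {n : ℕ} {L : ThetaOp} (hL : ∀ i, (L.coeff i).natDegree ≤ n) (T f : ℂ → ℂ)
    (z : ℂ) : opAlong L T f z =
      ∑ j ∈ Finset.range (n + 1), (thetaCoeff L j).eval (T z) * (thetaAlong T)^[j] f z :=
  sum_sum_eq_sum_thetaCoeff hL _ _

lemma IsRegularPoint.eventually {T : ℂ → ℂ} {z : ℂ} (h : IsRegularPoint T z) :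
    ∀ᶠ y in 𝓝 z, IsRegularPoint T y := by
  filter_upwards [h.analyticAt.eventually_analyticAt,
    h.analyticAt.continuousAt.eventually_ne h.ne_zero,
    h.analyticAt.deriv.continuousAt.eventually_ne h.deriv_ne_zero] with y h1 h2 h3
  exact ⟨h1, h2, h3⟩

lemma IsRegularPoint.analyticAt_div {T : ℂ → ℂ} {z : ℂ} (h : IsRegularPoint T z) :
    AnalyticAt ℂ (fun y => T y / deriv T y) z :=
  h.analyticAt.div h.analyticAt.deriv h.deriv_ne_zero

lemma IsRegularPoint.div_ne_zero {T : ℂ → ℂ} {z : ℂ} (h : IsRegularPoint T z) :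
    T z / deriv T z ≠ 0 := _root_.div_ne_zero h.ne_zero h.deriv_ne_zero

lemma IsRegularPoint.analyticAt_iterate {T f : ℂ → ℂ} {z : ℂ} (h : IsRegularPoint T z)
    (hf : AnalyticAt ℂ f z) (j : ℕ) : AnalyticAt ℂ ((thetaAlong T)^[j] f) z := by
  induction j generalizing f with
  | zero => exact hf
  | succ j ih => exact ih (h.analyticAt_div.mul hf.deriv)

lemma thetaAlong_congr {T S f g : ℂ → ℂ} {z : ℂ} (hT : T =ᶠ[𝓝 z] S) (h : f =ᶠ[𝓝 z] g) :
    thetaAlong T f =ᶠ[𝓝 z] thetaAlong S g :=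
  (hT.div hT.deriv).mul h.deriv

lemma iterate_thetaAlong_congr {T S f g : ℂ → ℂ} {z : ℂ} (hT : T =ᶠ[𝓝 z] S) (h : f =ᶠ[𝓝 z] g)
    (j : ℕ) : (thetaAlong T)^[j] f =ᶠ[𝓝 z] (thetaAlong S)^[j] g := by
  induction j generalizing f g with
  | zero => exact h
  | succ j ih => exact ih (thetaAlong_congr hT h)

lemma opAlong_congr {L : ThetaOp} {T S f g : ℂ → ℂ} {z : ℂ} (hT : T =ᶠ[𝓝 z] S)
    (h : f =ᶠ[𝓝 z] g) : opAlong L T f z = opAlong L S g z := by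
  simp only [opAlong, hT.eq_of_nhds, (iterate_thetaAlong_congr hT h _).eq_of_nhds]

/-- `θ` commutes with reparametrization. -/
lemma thetaAlong_comp {T f M : ℂ → ℂ} {z : ℂ} (hM : AnalyticAt ℂ M z) (hM' : deriv M z ≠ 0)
    (hT : IsRegularPoint T (M z)) (hf : AnalyticAt ℂ f (M z)) :
    thetaAlong (T ∘ M) (f ∘ M) =ᶠ[𝓝 z] thetaAlong T f ∘ M := by
  have hc := hM.continuousAt
  filter_upwards [hM.eventually_analyticAt, hM.deriv.continuousAt.eventually_ne hM',
    hc.eventually hT.eventually, hc.eventually hf.eventually_analyticAt] with y h1 h2 h3 h4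
  have e1 : deriv (T ∘ M) y = deriv T (M y) * deriv M y :=
    deriv_comp y h3.analyticAt.differentiableAt h1.differentiableAt
  have e2 : deriv (f ∘ M) y = deriv f (M y) * deriv M y :=
    deriv_comp y h4.differentiableAt h1.differentiableAt
  have := h3.deriv_ne_zero
  simp only [thetaAlong, e1, e2, Function.comp]
  field_simp

lemma iterate_thetaAlong_comp {T f M : ℂ → ℂ} {z : ℂ} (hM : AnalyticAt ℂ M z)
    (hM' : deriv M z ≠ 0) (hT : IsRegularPoint T (M z)) (hf : AnalyticAt ℂ f (M z)) (j : ℕ) :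
    (thetaAlong (T ∘ M))^[j] (f ∘ M) =ᶠ[𝓝 z] (thetaAlong T)^[j] f ∘ M := by
  induction j generalizing f with
  | zero => rfl
  | succ j ih =>
    exact (iterate_thetaAlong_congr .rfl (thetaAlong_comp hM hM' hT hf) j).trans
      (ih (hT.analyticAt_iterate hf 1))

lemma opAlong_comp {L : ThetaOp} {T f M : ℂ → ℂ} {z : ℂ} (hM : AnalyticAt ℂ M z)
    (hM' : deriv M z ≠ 0) (hT : IsRegularPoint T (M z)) (hf : AnalyticAt ℂ f (M z)) :
    opAlong L (T ∘ M) (f ∘ M) z = opAlong L T f (M z) := by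
  simp only [opAlong, (iterate_thetaAlong_comp hM hM' hT hf _).eq_of_nhds, Function.comp]

lemma thetaAlong_exp : thetaAlong Complex.exp = deriv := by
  ext f z
  simp [thetaAlong, Complex.exp_ne_zero]

/-- The action on functions of `s = log t` is the one along `T = exp`. -/
lemma applyOp_eq_opAlong_exp (L : ThetaOp) (f : ℂ → ℂ) (s : ℂ) :
    applyOp L f s = opAlong L Complex.exp f s := by
  simp only [applyOp, opAlong, thetaAlong_exp, iteratedDeriv_eq_iterate]

lemma isRegularPoint_exp (s : ℂ) : IsRegularPoint Complex.exp s :=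
  ⟨by fun_prop, Complex.exp_ne_zero s, by simp [Complex.exp_ne_zero]⟩

lemma iterate_thetaAlong_add {T f g : ℂ → ℂ} {z : ℂ} (h : IsRegularPoint T z)
    (hf : AnalyticAt ℂ f z) (hg : AnalyticAt ℂ g z) (j : ℕ) :
    (thetaAlong T)^[j] (f + g) =ᶠ[𝓝 z] (thetaAlong T)^[j] f + (thetaAlong T)^[j] g := by
  induction j generalizing f g with
  | zero => rfl
  | succ j ih =>
    refine (iterate_thetaAlong_congr .rfl ?_ j).trans
      (ih (h.analyticAt_iterate hf 1) (h.analyticAt_iterate hg 1))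
    filter_upwards [hf.eventually_analyticAt, hg.eventually_analyticAt] with y h1 h2
    simp [thetaAlong, deriv_add h1.differentiableAt h2.differentiableAt, mul_add]

lemma iterate_thetaAlong_const_mul (T f : ℂ → ℂ) (c : ℂ) (j : ℕ) :
    (thetaAlong T)^[j] (fun y => c * f y) = fun y => c * (thetaAlong T)^[j] f y := by
  induction j generalizing f with
  | zero => rfl
  | succ j ih =>
    have : thetaAlong T (fun y => c * f y) = fun y => c * thetaAlong T f y := by
      ext y
      simp only [thetaAlong, deriv_const_mul_field]
      ring
    rw [Function.iterate_succ_apply, this, ih]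
    rfl

lemma opAlong_add {L : ThetaOp} {T f g : ℂ → ℂ} {z : ℂ} (h : IsRegularPoint T z)
    (hf : AnalyticAt ℂ f z) (hg : AnalyticAt ℂ g z) :
    opAlong L T (f + g) z = opAlong L T f z + opAlong L T g z := by
  simp only [opAlong, (iterate_thetaAlong_add h hf hg _).eq_of_nhds, Pi.add_apply, Polynomial.sum,
    mul_add, Finset.sum_add_distrib]

lemma opAlong_const_mul (L : ThetaOp) (T f : ℂ → ℂ) (c z : ℂ) :
    opAlong L T (fun y => c * f y) z = c * opAlong L T f z := by
  simp only [opAlong, iterate_thetaAlong_const_mul, Polynomial.sum, Finset.mul_sum]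
  exact Finset.sum_congr rfl fun i _ => Finset.sum_congr rfl fun j _ => by ring

lemma opAlong_sum {ι : Type*} {L : ThetaOp} {T : ℂ → ℂ} {z : ℂ} (h : IsRegularPoint T z)
    (s : Finset ι) (f : ι → ℂ → ℂ) (hf : ∀ i ∈ s, AnalyticAt ℂ (f i) z) :
    opAlong L T (fun y => ∑ i ∈ s, f i y) z = ∑ i ∈ s, opAlong L T (f i) z := by
  classical
  induction s using Finset.induction_on with
  | empty => simpa using opAlong_const_mul L T 0 0 z
  | insert i s hi ih =>
    have hs : AnalyticAt ℂ (fun y => ∑ i ∈ s, f i y) z :=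
      Finset.analyticAt_fun_sum s fun k hk => hf k (Finset.mem_insert_of_mem hk)
    rw [Finset.sum_insert hi, ← ih fun k hk => hf k (Finset.mem_insert_of_mem hk),
      ← opAlong_add h (hf i (Finset.mem_insert_self i s)) hs]
    congr 1
    ext y
    simp [Finset.sum_insert hi]

/-! ### Leading terms -/

/-- The effect of `θ` on a function with a zero of order `k` at `z₀`: the values and first
derivatives of the successive cofactors, with denominators cleared. -/
lemma iterate_thetaAlong_pow_mul {T G : ℂ → ℂ} {z₀ : ℂ} (h : IsRegularPoint T z₀)
    (hG : AnalyticAt ℂ G z₀) (k : ℕ) {j : ℕ} (hj : j ≤ k) :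
    ∃ H : ℂ → ℂ, AnalyticAt ℂ H z₀ ∧
      (thetaAlong T)^[j] (fun z => (z - z₀) ^ k * G z) =ᶠ[𝓝 z₀]
        (fun z => (z - z₀) ^ (k - j) * H z) ∧
      (k - j).factorial * H z₀ = k.factorial * (T z₀ / deriv T z₀) ^ j * G z₀ ∧
      (k + 1 - j).factorial * deriv H z₀ * (T z₀ / deriv T z₀) =
        (k + 1).factorial * (T z₀ / deriv T z₀) ^ (j + 1) * deriv G z₀ +
        k.factorial * (∑ i ∈ Finset.range j, ((k : ℂ) - i)) * (T z₀ / deriv T z₀) ^ j *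
          deriv (fun y => T y / deriv T y) z₀ * G z₀ := by
  induction j with
  | zero => exact ⟨G, hG, by simp, by simp, by simp; ring⟩
  | succ j ih =>
    obtain ⟨H, hH, h1, h2, h3⟩ := ih (by omega)
    obtain ⟨m, rfl⟩ : ∃ m, k = j + 1 + m := ⟨k - (j + 1), by omega⟩
    have hw := h.analyticAt_div
    set w : ℂ → ℂ := fun y => T y / deriv T y with hwdef
    have e1 : j + 1 + m - j = m + 1 := by omega
    have e2 : j + 1 + m - (j + 1) = m := by omega
    have e3 : j + 1 + m + 1 - j = m + 2 := by omega
    have e4 : j + 1 + m + 1 - (j + 1) = m + 1 := by omega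
    rw [e1] at h1 h2
    rw [e3] at h3
    rw [e2, e4]
    have hH' := hH.deriv
    have hu : AnalyticAt ℂ (fun z : ℂ => z - z₀) z₀ := by fun_prop
    have hin : AnalyticAt ℂ (fun z => ((m : ℂ) + 1) * H z + (z - z₀) * deriv H z) z₀ := by
      fun_prop
    refine ⟨fun z => w z * (((m : ℂ) + 1) * H z + (z - z₀) * deriv H z), hw.mul hin, ?_, ?_, ?_⟩
    · rw [Function.iterate_succ_apply']
      refine (thetaAlong_congr .rfl h1).trans ?_
      filter_upwards [hH.eventually_analyticAt] with y hy
      have hd : deriv (fun z => (z - z₀) ^ (m + 1) * H z) y =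
          ((m : ℂ) + 1) * (y - z₀) ^ m * H y + (y - z₀) ^ (m + 1) * deriv H y := by
        have a1 : HasDerivAt (fun z : ℂ => (z - z₀) ^ (m + 1))
            (((m : ℂ) + 1) * (y - z₀) ^ m) y := by
          simpa using ((hasDerivAt_id y).sub_const z₀).fun_pow (m + 1)
        exact (a1.mul hy.differentiableAt.hasDerivAt).deriv
      simp only [thetaAlong, hd, hwdef]
      ring
    · have : (m + 1).factorial = (m + 1) * m.factorial := rfl
      rw [this] at h2
      push_cast at h2 ⊢
      simp only [sub_self, zero_mul, add_zero]
      calc (m.factorial : ℂ) * (w z₀ * ((m + 1) * H z₀))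
          = w z₀ * ((m + 1) * m.factorial * H z₀) := by ring
        _ = _ := by rw [h2]; simp only [hwdef]; ring
    · have hd : deriv (fun z => w z * (((m : ℂ) + 1) * H z + (z - z₀) * deriv H z)) z₀ =
          deriv w z₀ * (((m : ℂ) + 1) * H z₀) + w z₀ * (((m : ℂ) + 2) * deriv H z₀) := by
        have a1 : HasDerivAt (fun z => ((m : ℂ) + 1) * H z + (z - z₀) * deriv H z)
            (((m : ℂ) + 1) * deriv H z₀ + (1 * deriv H z₀ + (z₀ - z₀) * deriv (deriv H) z₀)) z₀ :=
          (hH.differentiableAt.hasDerivAt.const_mul _).add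
            (((hasDerivAt_id z₀).sub_const z₀).mul hH'.differentiableAt.hasDerivAt)
        have a2 := (hw.differentiableAt.hasDerivAt.mul a1).deriv
        refine a2.trans ?_
        simp only [sub_self, zero_mul, add_zero]
        ring
      rw [hd, Finset.sum_range_succ]
      have f1 : (m + 1).factorial = (m + 1) * m.factorial := rfl
      have f2 : (m + 2).factorial = (m + 2) * (m + 1).factorial := rfl
      rw [f2] at h3
      push_cast at h3 h2 ⊢
      change _ = _ * w z₀ ^ j * _ at h2
      change _ * w z₀ = _ * w z₀ ^ (j + 1) * _ + _ * w z₀ ^ j * _ * _ at h3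
      change _ * w z₀ = _ * w z₀ ^ (j + 1 + 1) * _ + _ * w z₀ ^ (j + 1) * _ * _
      linear_combination w z₀ * h3 + deriv w z₀ * w z₀ * (m + 1) * h2

lemma iterate_thetaAlong_pow_mul_of_lt {T G : ℂ → ℂ} {z₀ : ℂ} (h : IsRegularPoint T z₀)
    (hG : AnalyticAt ℂ G z₀) {j k : ℕ} (hj : j < k) :
    (thetaAlong T)^[j] (fun z => (z - z₀) ^ k * G z) z₀ = 0 := by
  obtain ⟨H, -, h1, -, -⟩ := iterate_thetaAlong_pow_mul h hG k hj.le
  rw [h1.eq_of_nhds]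
  simp [(Nat.sub_pos_of_lt hj).ne']

lemma iterate_thetaAlong_pow_mul_self {T G : ℂ → ℂ} {z₀ : ℂ} (h : IsRegularPoint T z₀)
    (hG : AnalyticAt ℂ G z₀) (k : ℕ) :
    (thetaAlong T)^[k] (fun z => (z - z₀) ^ k * G z) z₀ =
      k.factorial * (T z₀ / deriv T z₀) ^ k * G z₀ := by
  obtain ⟨H, -, h1, h2, -⟩ := iterate_thetaAlong_pow_mul h hG k le_rfl
  rw [h1.eq_of_nhds, ← h2]
  simp

/-- The term next to the leading one; it is where the derivative of `T / T'` enters the Wronskian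
identity. -/
lemma iterate_thetaAlong_pow_mul_succ {T G : ℂ → ℂ} {z₀ : ℂ} (h : IsRegularPoint T z₀)
    (hG : AnalyticAt ℂ G z₀) (k : ℕ) :
    (thetaAlong T)^[k + 1] (fun z => (z - z₀) ^ k * G z) z₀ =
      (k + 1).factorial * (T z₀ / deriv T z₀) ^ (k + 1) * deriv G z₀ +
        k.factorial * (k * (k + 1) / 2) * (T z₀ / deriv T z₀) ^ k *
          deriv (fun y => T y / deriv T y) z₀ * G z₀ := by
  obtain ⟨H, hH, h1, -, h3⟩ := iterate_thetaAlong_pow_mul h hG k le_rfl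
  have hs : ∀ k : ℕ, ∑ i ∈ Finset.range k, ((k : ℂ) - i) = k * (k + 1) / 2 := by
    intro k
    induction k with
    | zero => simp
    | succ k ih =>
      have : ∑ i ∈ Finset.range k, (((k + 1 : ℕ) : ℂ) - i) =
          ∑ i ∈ Finset.range k, ((k : ℂ) - i) + k := by
        simp only [Nat.cast_succ, add_sub_right_comm _ (1 : ℂ), Finset.sum_add_distrib]
        simp
      rw [Finset.sum_range_succ, this, ih]
      push_cast
      ring
  rw [Function.iterate_succ_apply', (thetaAlong_congr .rfl h1).eq_of_nhds, ← hs, ← h3]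
  simp [thetaAlong]
  ring

lemma analyticAt_eval (p : ℂ[X]) (z : ℂ) : AnalyticAt ℂ (fun y => p.eval y) z :=
  AnalyticOnNhd.eval_polynomial p z (Set.mem_univ z)

lemma iterate_deriv_eval (p : ℂ[X]) (n : ℕ) :
    deriv^[n] (fun z => p.eval z) = fun z => (derivative^[n] p).eval z := by
  induction n generalizing p with
  | zero => rfl
  | succ n ih =>
    have : deriv (fun z => p.eval z) = fun z => (derivative p).eval z := by
      ext z
      exact p.deriv
    rw [Function.iterate_succ_apply, this, ih, Function.iterate_succ_apply]

/-- Taylor's formula, with a holomorphic remainder. -/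
lemma exists_taylor {f : ℂ → ℂ} {z₀ : ℂ} (hf : AnalyticAt ℂ f z₀) (n : ℕ) :
    ∃ p : ℂ[X], p.degree < n ∧ ∃ g : ℂ → ℂ, AnalyticAt ℂ g z₀ ∧
      (f =ᶠ[𝓝 z₀] fun z => p.eval z + (z - z₀) ^ n * g z) ∧
      n.factorial * g z₀ = iteratedDeriv n f z₀ := by
  have key : ∃ p : ℂ[X], p.degree < n ∧ ∃ g : ℂ → ℂ, AnalyticAt ℂ g z₀ ∧
      (f =ᶠ[𝓝 z₀] fun z => p.eval z + (z - z₀) ^ n * g z) := by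
    induction n with
    | zero => exact ⟨0, by simp, f, hf, by simp⟩
    | succ n ih =>
      obtain ⟨p, hp, g, hg, h⟩ := ih
      refine ⟨p + g z₀ • (X - C z₀) ^ n, ?_, dslope g z₀, ?_, ?_⟩
      · refine (degree_add_le _ _).trans_lt
          (max_lt (hp.trans (by exact_mod_cast n.lt_succ_self)) ?_)
        refine (degree_smul_le (g z₀) ((X - C z₀) ^ n)).trans_lt ?_
        rw [degree_pow, degree_X_sub_C, nsmul_one]
        exact_mod_cast n.lt_succ_self
      · obtain ⟨q, hq⟩ := hg
        exact ⟨_, hq.has_fpower_series_dslope_fslope⟩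
      · filter_upwards [h] with z hz
        have := sub_smul_dslope g z₀ z
        rw [smul_eq_mul] at this
        simp only [hz, eval_add, eval_smul, smul_eq_mul, eval_C, eval_pow, eval_sub, eval_X]
        linear_combination -(z - z₀) ^ n * this
  obtain ⟨p, hp, g, hg, h⟩ := key
  refine ⟨p, hp, g, hg, h, ?_⟩
  have hp' : AnalyticAt ℂ (fun z => p.eval z) z₀ := analyticAt_eval p z₀
  have hu : AnalyticAt ℂ (fun z => (z - z₀) ^ n * g z) z₀ :=
    ((analyticAt_id.sub analyticAt_const).pow n).mul hg
  have e1 := (iterate_thetaAlong_congr (T := Complex.exp) .rfl h n).trans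
    (iterate_thetaAlong_add (isRegularPoint_exp z₀) hp' hu n)
  have e2 := iterate_thetaAlong_pow_mul_self (isRegularPoint_exp z₀) hg n
  rw [iteratedDeriv_eq_iterate, ← thetaAlong_exp, e1.eq_of_nhds, Pi.add_apply, e2, thetaAlong_exp]
  rw [iterate_deriv_eval]
  have e4 : derivative^[n] p = 0 := by
    by_cases hp0 : p = 0
    · simp [hp0]
    · exact iterate_derivative_eq_zero ((natDegree_lt_iff_degree_lt hp0).2 hp)
  simp [e4, Complex.exp_ne_zero]

/-- All products `Φ · p`, with `p` a polynomial of degree less than `n` in the parameter, are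
solutions at `z`: the solution space of `L` is the `(n-1)`-st symmetric power of a
two-dimensional one. -/
def AnnihilatesTwists (n : ℕ) (L : ThetaOp) (T Φ : ℂ → ℂ) (z : ℂ) : Prop :=
  ∀ p : ℂ[X], p.degree < n → opAlong L T (fun y => Φ y * p.eval y) z = 0

/-- If `L` annihilates `Φ, zΦ, …, zⁿ⁻¹Φ`, then `L (Φ f) = c_n(T) Φ (T / T')ⁿ f⁽ⁿ⁾`. -/
lemma AnnihilatesTwists.opAlong_mul {n : ℕ} {L : ThetaOp} {T Φ f : ℂ → ℂ} {z₀ : ℂ}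
    (hL : ∀ i, (L.coeff i).natDegree ≤ n) (h : AnnihilatesTwists n L T Φ z₀)
    (hT : IsRegularPoint T z₀) (hΦ : AnalyticAt ℂ Φ z₀) (hf : AnalyticAt ℂ f z₀) :
    opAlong L T (fun y => Φ y * f y) z₀ = (thetaCoeff L n).eval (T z₀) * Φ z₀ *
      (T z₀ / deriv T z₀) ^ n * iteratedDeriv n f z₀ := by
  -- only the Taylor coefficient of order `n` matters: lower ones give solutions, and the remainder
  -- vanishes to an order that only `θ ^ n` can detect
  obtain ⟨p, hp, g, hg, h1, h2⟩ := exists_taylor hf n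
  have e : (fun y => Φ y * f y) =ᶠ[𝓝 z₀]
      (fun y => Φ y * p.eval y) + fun y => (y - z₀) ^ n * (Φ y * g y) := by
    filter_upwards [h1] with y hy
    rw [hy, Pi.add_apply]
    ring
  have hp' : AnalyticAt ℂ (fun z => p.eval z) z₀ := analyticAt_eval p z₀
  have hu : AnalyticAt ℂ (fun y => (y - z₀) ^ n * (Φ y * g y)) z₀ :=
    ((analyticAt_id.sub analyticAt_const).pow n).mul (hΦ.mul hg)
  have hp'' : AnalyticAt ℂ (fun y => Φ y * p.eval y) z₀ := hΦ.mul hp'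
  have hΦg : AnalyticAt ℂ (fun y => Φ y * g y) z₀ := hΦ.mul hg
  rw [opAlong_congr .rfl e, opAlong_add hT hp'' hu, h p hp, zero_add,
    opAlong_eq_sum hL, Finset.sum_range_succ, Finset.sum_eq_zero, zero_add,
    iterate_thetaAlong_pow_mul_self hT hΦg, ← h2]
  · ring
  · intro j hj
    rw [iterate_thetaAlong_pow_mul_of_lt hT hΦg (Finset.mem_range.1 hj), mul_zero]

/-! ### Self-adjointness -/

lemma coeff_sum_monomial_add {R : Type*} [Semiring R] (L : R[X]) (k m : ℕ) (φ : ℕ → R → R)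
    (hφ : ∀ i, φ i 0 = 0) :
    (L.sum fun i P => monomial (i + k) (φ i P)).coeff (m + k) = φ m (L.coeff m) := by
  rw [Polynomial.sum_def, finsetSum_coeff]
  simp only [coeff_monomial, add_left_inj, Finset.sum_ite_eq', mem_support_iff]
  split_ifs with h
  · rfl
  · rw [notMem_support_iff.1 h, hφ]

/-- Self-adjointness in terms of the coefficients: `Pᵢ(θ + 1) = (-1)ⁿ Pᵢ(-θ - i - 1)`. -/
lemma IsSelfAdjointVia.coeff_comp {n : ℕ} {L : ThetaOp} (h : IsSelfAdjointVia n L X) (i : ℕ) :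
    (L.coeff i).comp (X + C 1) =
      (-1 : ℂ) ^ n • (L.coeff i).comp (-X - C ((i : ℂ) + 1)) := by
  have hX : ofFun X = monomial 1 1 := by simp [ofFun, X]
  have e1 : (thetaMul L (ofFun X)).coeff (i + 1) = (L.coeff i).comp (X + C 1) := by
    rw [← coeff_sum_monomial_add L 1 i (fun _ P => P.comp (X + C 1)) (by simp), thetaMul, hX]
    simp [Polynomial.sum_monomial_index]
  have e2 : (thetaMul (ofFun X) (adjoint L)).coeff (i + 1) =
      (L.coeff i).comp (-X - C ((i : ℂ) + 1)) := by
    have e3 : (adjoint L).coeff i = (L.coeff i).comp (-X - C ((i : ℂ) + 1)) :=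
      coeff_sum_monomial_add L 0 i (fun i P => P.comp (-X - C ((i : ℂ) + 1))) (by simp)
    rw [← e3, ← coeff_sum_monomial_add (adjoint L) 1 i (fun _ P => P) (by simp), thetaMul, hX,
      Polynomial.sum_monomial_index 1 _ (by simp [Polynomial.sum])]
    simp [add_comm]
  rw [← e1, ← e2, h, coeff_smul]

lemma coeff_comp_X_add_C {n : ℕ} {P : ℂ[X]} (hP : P.natDegree ≤ n + 1) (r : ℂ) :
    (P.comp (X + C r)).coeff n = P.coeff n + (n + 1) * r * P.coeff (n + 1) := by
  rw [← taylor_apply, taylor_coeff, hasseDeriv_apply,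
    Polynomial.sum_over_range' _ (by simp) (n + 2) (by omega), Finset.sum_range_succ,
    Finset.sum_range_succ, Finset.sum_eq_zero]
  · simp
    ring
  · intro i hi
    simp [Nat.choose_eq_zero_of_lt (Finset.mem_range.1 hi)]

/-- Self-adjointness determines the subleading coefficient: `2 c_{n-1} = n θ(c_n)`. -/
lemma IsSelfAdjointVia.thetaCoeff_eval {n : ℕ} {L : ThetaOp}
    (hL : ∀ i, (L.coeff i).natDegree ≤ n + 1) (h : IsSelfAdjointVia (n + 1) L X) (x : ℂ) :
    2 * (thetaCoeff L n).eval x =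
      (n + 1) * x * (derivative (thetaCoeff L (n + 1))).eval x := by
  have key : ∀ i, 2 * (L.coeff i).coeff n = (n + 1) * i * (L.coeff i).coeff (n + 1) := by
    intro i
    have h1 := congrArg (fun p => Polynomial.coeff p n) (h.coeff_comp i)
    have e : (L.coeff i).comp (-X - C ((i : ℂ) + 1)) =
        ((L.coeff i).comp (X + C (-((i : ℂ) + 1)))).comp (C (-1) * X) := by
      rw [comp_assoc]
      simp [sub_eq_add_neg]
    simp only [e, coeff_smul, comp_C_mul_X_coeff, coeff_comp_X_add_C (hL i), smul_eq_mul] at h1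
    have h2 : (-1 : ℂ) ^ (n + 1) * (-1) ^ n = -1 := by
      rw [← pow_add, show n + 1 + n = 2 * n + 1 by ring, pow_succ, pow_mul]
      simp
    linear_combination h1 + h2 * ((L.coeff i).coeff n +
      (n + 1) * (-((i : ℂ) + 1)) * (L.coeff i).coeff (n + 1))
  have h1 : ∀ j, thetaCoeff L j = ∑ i ∈ L.support, monomial i ((L.coeff i).coeff j) := fun _ => rfl
  rw [h1, h1, derivative_sum, eval_finsetSum, eval_finsetSum, Finset.mul_sum, Finset.mul_sum]
  refine Finset.sum_congr rfl fun i _ => ?_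
  rw [derivative_monomial, eval_monomial, eval_monomial]
  rcases i with _ | i
  · have := key 0
    simp at this
    simp [this]
  · rw [Nat.add_sub_cancel, pow_succ]
    linear_combination x ^ i * x * key (i + 1)

/-- The Wronskian identity in infinitesimal form: if `L` is self-adjoint and annihilates
`Φ, zΦ, …, zⁿ⁻¹Φ`, then `Φ² c_n(T) (T / T')ⁿ⁻¹` has derivative zero. -/
lemma AnnihilatesTwists.deriv_eq_zero {n : ℕ} {L : ThetaOp} {T Φ : ℂ → ℂ} {z₀ : ℂ} (hn : 2 ≤ n)
    (hL : ∀ i, (L.coeff i).natDegree ≤ n) (hs : IsSelfAdjointVia n L X)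
    (h : AnnihilatesTwists n L T Φ z₀) (hT : IsRegularPoint T z₀) (hΦ : AnalyticAt ℂ Φ z₀) :
    deriv (fun z => Φ z ^ 2 * (thetaCoeff L n).eval (T z) * (T z / deriv T z) ^ (n - 1)) z₀ =
      0 := by
  obtain ⟨n, rfl⟩ : ∃ m, n = m + 2 := ⟨n - 2, by omega⟩
  have hw := hT.analyticAt_div
  have hw0 := hT.div_ne_zero
  -- the equation `L ((z - z₀)ⁿ⁻¹ Φ) = 0` at `z₀`: only the two highest powers of `θ` contribute
  have h1 := h ((X - C z₀) ^ (n + 1)) (by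
    rw [degree_pow, degree_X_sub_C]
    simpa using (by exact_mod_cast (n + 1).lt_succ_self : ((n + 1 : ℕ) : WithBot ℕ) < (n + 2 : ℕ)))
  have e : (fun y => Φ y * ((X - C z₀) ^ (n + 1)).eval y) = fun y => (y - z₀) ^ (n + 1) * Φ y := by
    ext y
    simp [mul_comm]
  rw [e, opAlong_eq_sum hL, Finset.sum_range_succ, Finset.sum_range_succ, Finset.sum_eq_zero,
    zero_add, iterate_thetaAlong_pow_mul_self hT hΦ, iterate_thetaAlong_pow_mul_succ hT hΦ] at h1
  swap
  · intro j hj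
    rw [iterate_thetaAlong_pow_mul_of_lt hT hΦ (Finset.mem_range.1 hj), mul_zero]
  have h2 := hs.thetaCoeff_eval hL (T z₀)
  have ha : HasDerivAt (fun z => (thetaCoeff L (n + 2)).eval (T z))
      ((derivative (thetaCoeff L (n + 2))).eval (T z₀) * deriv T z₀) z₀ :=
    ((thetaCoeff L (n + 2)).hasDerivAt (T z₀)).comp z₀ hT.analyticAt.differentiableAt.hasDerivAt
  have hd := ((hΦ.differentiableAt.hasDerivAt.fun_pow 2).mul ha).mul
    (hw.differentiableAt.hasDerivAt.fun_pow (n + 2 - 1))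
  refine hd.deriv.trans ?_
  have hTw : T z₀ = T z₀ / deriv T z₀ * deriv T z₀ := by
    have := hT.deriv_ne_zero
    field_simp
  generalize hwe : deriv (fun y => T y / deriv T y) z₀ = w' at *
  have f1 : (n + 2).factorial = (n + 2) * (n + 1).factorial := rfl
  have f0 : ((n + 1).factorial : ℂ) ≠ 0 := by exact_mod_cast (n + 1).factorial_ne_zero
  rw [show n + 1 + 1 = n + 2 from rfl, f1] at h1
  push_cast at h1 h2 ⊢
  set w := T z₀ / deriv T z₀
  set A := eval (T z₀) (thetaCoeff L (n + 2))
  set B := eval (T z₀) (thetaCoeff L (n + 1))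
  set A' := eval (T z₀) (derivative (thetaCoeff L (n + 2)))
  simp only [Pi.mul_apply]
  have h3 : w * (((n : ℂ) + 2) * (n + 1).factorial) *
      (2 * Φ z₀ ^ (2 - 1) * deriv Φ z₀ * A * w ^ (n + 1)
      + Φ z₀ ^ 2 * (A' * deriv T z₀) * w ^ (n + 1)
      + Φ z₀ ^ 2 * A * ((n + 1) * w ^ n * w')) = 0 := by
    simp only [show 2 - 1 = 1 from rfl, pow_one]
    rw [hTw] at h2
    linear_combination 2 * Φ z₀ * h1 - (n + 1).factorial * w ^ (n + 1) * Φ z₀ ^ 2 * h2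
  have h4 : w * (((n : ℂ) + 2) * (n + 1).factorial) ≠ 0 :=
    mul_ne_zero hw0 (mul_ne_zero (by exact_mod_cast (by omega : n + 2 ≠ 0)) f0)
  have h5 := (mul_eq_zero.1 h3).resolve_left h4
  linear_combination h5

/-! ### Meromorphic functions on the upper half plane -/

lemma isPreconnected_im_pos : IsPreconnected {z : ℂ | 0 < z.im} :=
  (convex_halfSpace_im_gt 0).isPreconnected

lemma isOpen_im_gt (A : ℝ) : IsOpen {z : ℂ | A < z.im} :=
  isOpen_lt continuous_const Complex.continuous_im

lemma eventually_im_gt {A : ℝ} {z : ℂ} (hz : A < z.im) : ∀ᶠ y in 𝓝 z, A < y.im :=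
  (isOpen_im_gt A).mem_nhds hz

/-- The identity theorem for meromorphic functions on the upper half plane. -/
lemma eventually_eq_zero_of_meromorphicOn {f : ℂ → ℂ} (hf : MeromorphicOn f {z | 0 < z.im})
    {z₁ : ℂ} (hz₁ : 0 < z₁.im) (h : ∀ᶠ z in 𝓝 z₁, f z = 0) {z : ℂ} (hz : 0 < z.im) :
    ∀ᶠ y in 𝓝[≠] z, f y = 0 := by
  rw [← meromorphicOrderAt_eq_top_iff]
  by_contra hne
  exact hf.meromorphicOrderAt_ne_top_of_isPreconnected isPreconnected_im_pos hz hz₁ hne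
    (meromorphicOrderAt_eq_top_iff.2 (h.filter_mono nhdsWithin_le_nhds))

lemma eventually_ne_zero_of_meromorphicOn {f : ℂ → ℂ} (hf : MeromorphicOn f {z | 0 < z.im})
    {z₁ : ℂ} (hz₁ : 0 < z₁.im) (h : ∀ᶠ z in 𝓝 z₁, f z ≠ 0) {z : ℂ} (hz : 0 < z.im) :
    ∀ᶠ y in 𝓝[≠] z, f y ≠ 0 := by
  rw [← meromorphicOrderAt_ne_top_iff_eventually_ne_zero (hf z hz)]
  refine hf.meromorphicOrderAt_ne_top_of_isPreconnected isPreconnected_im_pos hz₁ hz ?_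
  rw [meromorphicOrderAt_ne_top_iff_eventually_ne_zero (hf z₁ hz₁)]
  exact h.filter_mono nhdsWithin_le_nhds

lemma meromorphicAt_iterate_thetaAlong {T f : ℂ → ℂ} {z : ℂ} (hT : MeromorphicAt T z)
    (hf : MeromorphicAt f z) (j : ℕ) : MeromorphicAt ((thetaAlong T)^[j] f) z := by
  induction j generalizing f with
  | zero => exact hf
  | succ j ih => exact ih ((hT.div hT.deriv).mul hf.deriv)

lemma meromorphicAt_eval {T : ℂ → ℂ} {z : ℂ} (hT : MeromorphicAt T z) (p : ℂ[X]) :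
    MeromorphicAt (fun y => p.eval (T y)) z := by
  simp only [eval_eq_sum_range]
  exact MeromorphicAt.fun_sum fun i _ => (MeromorphicAt.const _ _).mul (hT.pow i)

lemma meromorphicAt_opAlong {L : ThetaOp} {T f : ℂ → ℂ} {z : ℂ} (hT : MeromorphicAt T z)
    (hf : MeromorphicAt f z) : MeromorphicAt (opAlong L T f) z :=
  MeromorphicAt.fun_sum fun i _ => (hT.pow i).mul
    (MeromorphicAt.fun_sum fun _ _ => (MeromorphicAt.const _ _).mul
      (meromorphicAt_iterate_thetaAlong hT hf _))

/-! ### Möbius transformations -/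

/-- The Möbius transformation of `g`, as a function of a complex variable. -/
def moebius (g : SL(2, ℝ)) (z : ℂ) : ℂ := ((g • ofComplex z : ℍ) : ℂ)

/-- The automorphy factor `cz + d` of `g`. -/
def autFactor (g : SL(2, ℝ)) (z : ℂ) : ℂ := g 1 0 * z + g 1 1

/-- The translate `t(g z)`, as a function of a complex variable. -/
def translate (t : ℍ → ℂ) (g : SL(2, ℝ)) (z : ℂ) : ℂ := t (g • ofComplex z)

/-- The slash translate `(cz + d)⁻ᵏ F(g z)`, as a function of a complex variable. -/
def slashAlong (k : ℕ) (F : ℍ → ℂ) (g : SL(2, ℝ)) (z : ℂ) : ℂ :=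
  (autFactor g z ^ k)⁻¹ * F (g • ofComplex z)

lemma autFactor_ne_zero (g : SL(2, ℝ)) {z : ℂ} (hz : 0 < z.im) : autFactor g z ≠ 0 :=
  denom_ne_zero_of_im (Matrix.SpecialLinearGroup.mapGL ℝ g) hz.ne'

lemma det_mapGL_pos (g : SL(2, ℝ)) :
    0 < (Matrix.SpecialLinearGroup.mapGL ℝ g : GL (Fin 2) ℝ).val.det := by simp

lemma slash_apply_eq (k : ℕ) (F : ℍ → ℂ) (g : SL(2, ℝ)) (τ : ℍ) :
    (F ∣[(k : ℤ)] (Matrix.SpecialLinearGroup.mapGL ℝ g)) τ = slashAlong k F g τ := by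
  rw [ModularForm.slash_apply, slashAlong, ofComplex_apply]
  simp [σ, denom, autFactor, mul_comm]
  exact mul_comm _ _

lemma moebius_im_pos (g : SL(2, ℝ)) (z : ℂ) : 0 < (moebius g z).im := (g • ofComplex z).im_pos

lemma moebius_eq (g : SL(2, ℝ)) {z : ℂ} (hz : 0 < z.im) :
    moebius g z = (g 0 0 * z + g 0 1) / autFactor g z := by
  have := coe_specialLinearGroup_apply g (ofComplex z)
  rw [moebius, this, ofComplex_apply_of_im_pos hz]
  rfl

lemma analyticAt_moebius (g : SL(2, ℝ)) {z : ℂ} (hz : 0 < z.im) : AnalyticAt ℂ (moebius g) z :=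
  analyticAt_smul (det_mapGL_pos g) ⟨z, hz⟩

lemma deriv_moebius (g : SL(2, ℝ)) {z : ℂ} (hz : 0 < z.im) :
    deriv (moebius g) z = 1 / autFactor g z ^ 2 := by
  refine (deriv_smul (det_mapGL_pos g) ⟨z, hz⟩).trans ?_
  simp [denom, autFactor]

lemma deriv_moebius_ne_zero (g : SL(2, ℝ)) {z : ℂ} (hz : 0 < z.im) : deriv (moebius g) z ≠ 0 := by
  rw [deriv_moebius g hz]
  exact one_div_ne_zero (pow_ne_zero _ (autFactor_ne_zero g hz))

lemma translate_eq_comp (t : ℍ → ℂ) (g : SL(2, ℝ)) :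
    translate t g = (t ∘ ofComplex) ∘ moebius g := by
  ext z
  simp [translate, moebius]

lemma moebius_inv_moebius (g : SL(2, ℝ)) {z : ℂ} (hz : 0 < z.im) :
    moebius g⁻¹ (moebius g z) = z := by
  simp [moebius, ofComplex_apply_of_im_pos hz]

lemma autFactor_mul (g k : SL(2, ℝ)) {z : ℂ} (hz : 0 < z.im) :
    autFactor (g * k) z = autFactor g (moebius k z) * autFactor k z := by
  have h := autFactor_ne_zero k hz
  rw [moebius_eq k hz]
  simp only [autFactor, Matrix.SpecialLinearGroup.coe_mul, Matrix.mul_apply, Fin.sum_univ_two,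
    Complex.ofReal_add, Complex.ofReal_mul] at h ⊢
  field_simp
  ring

lemma IsRegularPoint.comp_moebius {T : ℂ → ℂ} {g : SL(2, ℝ)} {z : ℂ} (hz : 0 < z.im)
    (h : IsRegularPoint T (moebius g z)) : IsRegularPoint (T ∘ moebius g) z := by
  have hM := analyticAt_moebius g hz
  refine ⟨h.analyticAt.comp hM, h.ne_zero, ?_⟩
  rw [deriv_comp z h.analyticAt.differentiableAt hM.differentiableAt]
  exact mul_ne_zero h.deriv_ne_zero (deriv_moebius_ne_zero g hz)

lemma IsRegularPoint.congr {T S : ℂ → ℂ} {z : ℂ} (h : IsRegularPoint T z) (hTS : T =ᶠ[𝓝 z] S) :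
    IsRegularPoint S z :=
  ⟨h.analyticAt.congr hTS, hTS.eq_of_nhds ▸ h.ne_zero, hTS.deriv_eq ▸ h.deriv_ne_zero⟩

lemma isRegularPoint_translate_iff {t : ℍ → ℂ} {g : SL(2, ℝ)} {z : ℂ} (hz : 0 < z.im) :
    IsRegularPoint (translate t g) z ↔ IsRegularPoint (t ∘ ofComplex) (moebius g z) := by
  rw [translate_eq_comp]
  refine ⟨fun h => ?_, fun h => h.comp_moebius hz⟩
  rw [← moebius_inv_moebius g hz] at h
  refine (h.comp_moebius (moebius_im_pos g z)).congr ?_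
  filter_upwards [eventually_im_gt (moebius_im_pos g z)] with y hy
  have := moebius_inv_moebius g⁻¹ hy
  rw [inv_inv] at this
  simp only [Function.comp, this]

lemma meromorphicAt_translate {t : ℍ → ℂ} (ht : MeromorphicOn (t ∘ ofComplex) {z | 0 < z.im})
    (g : SL(2, ℝ)) {z : ℂ} (hz : 0 < z.im) : MeromorphicAt (translate t g) z := by
  rw [translate_eq_comp]
  exact (ht _ (moebius_im_pos g z)).comp_analyticAt (analyticAt_moebius g hz)

lemma analyticAt_autFactor (g : SL(2, ℝ)) (z : ℂ) : AnalyticAt ℂ (autFactor g) z := by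
  unfold autFactor
  fun_prop

lemma analyticAt_comp_ofComplex {F : ℍ → ℂ} (hF : MDiff F) {z : ℂ} (hz : 0 < z.im) :
    AnalyticAt ℂ (F ∘ ofComplex) z :=
  (UpperHalfPlane.mdifferentiable_iff.1 hF).analyticAt ((isOpen_im_gt 0).mem_nhds hz)

lemma analyticAt_slashAlong {F : ℍ → ℂ} (hF : MDiff F) (k : ℕ) (g : SL(2, ℝ)) {z : ℂ}
    (hz : 0 < z.im) : AnalyticAt ℂ (slashAlong k F g) z := by
  have h1 : AnalyticAt ℂ ((F ∘ ofComplex) ∘ moebius g) z :=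
    (analyticAt_comp_ofComplex hF (moebius_im_pos g z)).comp (analyticAt_moebius g hz)
  refine ((((analyticAt_autFactor g z).pow k).inv
    (pow_ne_zero _ (autFactor_ne_zero g hz))).mul h1).congr ?_
  filter_upwards with y
  simp [slashAlong, moebius]

/-! ### From one solution to the symmetric power -/

/-- Every element of `SL(2, ℤ)` has a power in the arithmetic group `Γ`. -/
lemma exists_pow_mem_of_isArithmetic {Γ : Subgroup SL(2, ℝ)} (hΓ : (toGL Γ).IsArithmetic)
    (x : SL(2, ℤ)) :
    ∃ N : ℕ, 0 < N ∧ (Matrix.SpecialLinearGroup.map (Int.castRingHom ℝ) x) ^ N ∈ Γ := by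
  obtain ⟨N, hN, -, hmem⟩ := Subgroup.exists_pow_mem_of_relIndex_ne_zero
    hΓ.is_commensurable.1 (a := Matrix.SpecialLinearGroup.mapGL ℝ x) ⟨x, rfl⟩
  refine ⟨N, hN, ?_⟩
  obtain ⟨y, hy, hyx⟩ := hmem.1
  have : y = (Matrix.SpecialLinearGroup.map (Int.castRingHom ℝ) x) ^ N := by
    apply Matrix.SpecialLinearGroup.mapGL_injective (S := ℝ)
    rw [hyx, map_pow]
    congr 1
  exact this ▸ hy

/-- If `L` annihilates `(u + x)ᵐ Φ` for infinitely many `x`, then it annihilates all the products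
of `Φ` with polynomials of degree at most `m`. -/
lemma annihilatesTwists_of_infinite {m : ℕ} {L : ThetaOp} {T Φ : ℂ → ℂ} {z₀ : ℂ}
    (hT : IsRegularPoint T z₀) (hΦ : AnalyticAt ℂ Φ z₀) {x : ℕ → ℂ} (hx : Function.Injective x)
    (h : ∀ k, opAlong L T (fun y => Φ y * ((y - z₀) + x k) ^ m) z₀ = 0) :
    AnnihilatesTwists (m + 1) L T Φ z₀ := by
  have han : ∀ j, AnalyticAt ℂ (fun y => Φ y * (y - z₀) ^ j) z₀ := fun j =>
    hΦ.mul ((analyticAt_id.sub analyticAt_const).pow j)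
  set A : ℕ → ℂ := fun j => opAlong L T (fun y => Φ y * (y - z₀) ^ j) z₀ with hA
  set Q : ℂ[X] := ∑ j ∈ Finset.range (m + 1), C ((m.choose j : ℂ) * A j) * X ^ (m - j) with hQ
  have hQ0 : Q = 0 := by
    refine Polynomial.eq_zero_of_infinite_isRoot Q ((Set.infinite_range_of_injective hx).mono ?_)
    rintro _ ⟨k, rfl⟩
    have h1 : (fun y => Φ y * ((y - z₀) + x k) ^ m) = fun y => ∑ j ∈ Finset.range (m + 1),
        (x k ^ (m - j) * m.choose j) * (Φ y * (y - z₀) ^ j) := by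
      ext y
      rw [add_pow, Finset.mul_sum]
      exact Finset.sum_congr rfl fun j _ => by ring
    have h2 := h k
    rw [h1, opAlong_sum hT _ (fun j y => (x k ^ (m - j) * m.choose j) * (Φ y * (y - z₀) ^ j))
      fun j _ => analyticAt_const.mul (han j)] at h2
    simp only [opAlong_const_mul] at h2
    simp only [Set.mem_ofPred_eq, IsRoot.def, hQ, eval_finsetSum, eval_mul, eval_C, eval_pow,
      eval_X]
    rw [← h2]
    exact Finset.sum_congr rfl fun j _ => by simp only [hA]; ring
  have hA0 : ∀ j ≤ m, A j = 0 := by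
    intro j hj
    have h1 := congrArg (fun p => Polynomial.coeff p (m - j)) hQ0
    simp only [hQ, finsetSum_coeff, coeff_C_mul, coeff_X_pow, coeff_zero] at h1
    rw [Finset.sum_eq_single j] at h1
    · have : (m.choose j : ℂ) ≠ 0 := by exact_mod_cast (Nat.choose_pos hj).ne'
      simpa [this] using h1
    · intro i hi hij
      have := Finset.mem_range.1 hi
      rw [if_neg (by omega), mul_zero]
    · intro hj'
      exact absurd (Finset.mem_range.2 (by omega)) hj'
  intro p hp
  have hd : (taylor z₀ p).natDegree < m + 1 := by
    rw [natDegree_taylor]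
    by_cases hp0 : p = 0
    · simp [hp0]
    · exact (natDegree_lt_iff_degree_lt hp0).2 hp
  have h1 : (fun y => Φ y * p.eval y) = fun y => ∑ j ∈ Finset.range (m + 1),
      (taylor z₀ p).coeff j * (Φ y * (y - z₀) ^ j) := by
    ext y
    rw [← sub_add_cancel y z₀, ← taylor_eval, eval_eq_sum_range' hd, Finset.mul_sum,
      sub_add_cancel]
    exact Finset.sum_congr rfl fun j _ => by ring
  rw [h1, opAlong_sum hT _ (fun j y => (taylor z₀ p).coeff j * (Φ y * (y - z₀) ^ j))
    fun j _ => analyticAt_const.mul (han j)]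
  refine Finset.sum_eq_zero fun j hj => ?_
  rw [opAlong_const_mul]
  have := hA0 j (by have := Finset.mem_range.1 hj; omega)
  simp only [hA] at this
  rw [this, mul_zero]

/-- The transformed equation: if `L Φ = 0` for a modular form `Φ` and the modular function `T`, then
`L ((cz + d)ᵐ Φ) = 0` for all `γ ∈ Γ`. -/
lemma opAlong_autFactor_pow {m : ℕ} {Γ : Subgroup SL(2, ℝ)} {χ : Γ →* ℤˣ} {L : ThetaOp}
    {t F : ℍ → ℂ} (ht : ∀ γ ∈ Γ, ∀ τ : ℍ, t (γ • τ) = t τ) (hF : IsModularForm Γ χ m F)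
    (h : ∀ z : ℂ, 0 < z.im → IsRegularPoint (t ∘ ofComplex) z →
      opAlong L (t ∘ ofComplex) (F ∘ ofComplex) z = 0)
    (γ : Γ) {z : ℂ} (hz : 0 < z.im) (hr : IsRegularPoint (t ∘ ofComplex) z) :
    opAlong L (t ∘ ofComplex) (fun y => (F ∘ ofComplex) y * autFactor γ y ^ m) z = 0 := by
  have hTγ : translate t γ = t ∘ ofComplex := by
    ext y
    exact ht γ γ.2 _
  have hr' : IsRegularPoint (t ∘ ofComplex) (moebius γ z) := by
    rw [← isRegularPoint_translate_iff hz, hTγ]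
    exact hr
  have h1 := opAlong_comp (L := L) (analyticAt_moebius (γ : SL(2, ℝ)) hz)
    (deriv_moebius_ne_zero _ hz) hr'
    (analyticAt_comp_ofComplex hF.holo (moebius_im_pos γ z))
  rw [h _ (moebius_im_pos γ z) hr', ← translate_eq_comp, hTγ] at h1
  have hχ : ((((χ γ : ℤˣ) : ℤ) : ℂ)) * (((χ γ : ℤˣ) : ℤ) : ℂ) = 1 := by
    rcases Int.units_eq_one_or (χ γ) with h | h <;> simp [h]
  have h2 : (fun y => (F ∘ ofComplex) y * autFactor γ y ^ m) =ᶠ[𝓝 z]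
      fun y => (((χ γ : ℤˣ) : ℤ) : ℂ) * ((F ∘ ofComplex) ∘ moebius γ) y := by
    filter_upwards [eventually_im_gt hz] with y hy
    have e := congrFun (hF.slash γ) (ofComplex y)
    rw [slash_apply_eq, slashAlong, ofComplex_apply, ofComplex_apply_of_im_pos hy, Pi.smul_apply,
      smul_eq_mul] at e
    have hne := pow_ne_zero m (autFactor_ne_zero γ hy)
    simp only [Function.comp, moebius, ofComplex_apply, ofComplex_apply_of_im_pos hy] at e ⊢
    rw [inv_mul_eq_iff_eq_mul₀ hne] at e
    rw [e]
    linear_combination -F ⟨y, hy⟩ * autFactor γ y ^ m * hχ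
  rw [opAlong_congr .rfl h2, opAlong_const_mul, h1, mul_zero]

/-- If `L` annihilates the modular form `F`, it annihilates all products of `F` with polynomials of
degree at most `m`, because `Γ` contains elements with infinitely many ratios `d / c`. -/
lemma annihilatesTwists_of_modular {m : ℕ} {Γ : Subgroup SL(2, ℝ)}
    (hΓ : (toGL Γ).IsArithmetic) {χ : Γ →* ℤˣ} {L : ThetaOp}
    {t F : ℍ → ℂ} (ht : ∀ γ ∈ Γ, ∀ τ : ℍ, t (γ • τ) = t τ) (hF : IsModularForm Γ χ m F)
    (h : ∀ z : ℂ, 0 < z.im → IsRegularPoint (t ∘ ofComplex) z →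
      opAlong L (t ∘ ofComplex) (F ∘ ofComplex) z = 0)
    {z : ℂ} (hz : 0 < z.im) (hr : IsRegularPoint (t ∘ ofComplex) z) :
    AnnihilatesTwists (m + 1) L (t ∘ ofComplex) (F ∘ ofComplex) z := by
  obtain ⟨N, hN, hP⟩ := exists_pow_mem_of_isArithmetic hΓ ModularGroup.T
  obtain ⟨M, hM, hQ⟩ := exists_pow_mem_of_isArithmetic hΓ
    (ModularGroup.S * ModularGroup.T * ModularGroup.S⁻¹)
  set P := (Matrix.SpecialLinearGroup.map (Int.castRingHom ℝ) ModularGroup.T) ^ N with hPdef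
  set Q := (Matrix.SpecialLinearGroup.map (Int.castRingHom ℝ)
    (ModularGroup.S * ModularGroup.T * ModularGroup.S⁻¹)) ^ M with hQdef
  have hPk : ∀ k : ℕ, ((P ^ k : SL(2, ℝ)) : Matrix (Fin 2) (Fin 2) ℝ) =
      !![(1 : ℝ), (N * k : ℕ); 0, 1] := by
    intro k
    rw [hPdef, ← pow_mul, ← map_pow]
    ext i j
    have := congrFun (congrFun (ModularGroup.coe_T_zpow (N * k : ℕ)) i) j
    rw [zpow_natCast] at this
    rw [Matrix.SpecialLinearGroup.map_apply_coe, RingHom.mapMatrix_apply, Matrix.map_apply, this]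
    fin_cases i <;> fin_cases j <;> simp
  have hQ' : (Q : Matrix (Fin 2) (Fin 2) ℝ) = !![(1 : ℝ), 0; -(M : ℝ), 1] := by
    rw [hQdef, ← map_pow, ← MulAut.conj_apply, ← map_pow, MulAut.conj_apply]
    ext i j
    have := ModularGroup.coe_T_zpow (M : ℕ)
    rw [zpow_natCast] at this
    rw [Matrix.SpecialLinearGroup.map_apply_coe, RingHom.mapMatrix_apply, Matrix.map_apply,
      Matrix.SpecialLinearGroup.coe_mul, Matrix.SpecialLinearGroup.coe_mul, this,
      Matrix.SpecialLinearGroup.coe_inv, ModularGroup.coe_S]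
    fin_cases i <;> fin_cases j <;>
      simp [Matrix.mul_apply, Fin.sum_univ_two, Matrix.adjugate_fin_two]
  -- the automorphy factor of `Q P ^ k` is `1 - M z - M N k`
  have hM0 : (M : ℂ) ≠ 0 := by exact_mod_cast hM.ne'
  have hN0 : (N : ℂ) ≠ 0 := by exact_mod_cast hN.ne'
  refine annihilatesTwists_of_infinite hr (analyticAt_comp_ofComplex hF.holo hz)
    (x := fun k => z - 1 / M + N * k) ?_ ?_
  · intro k l hkl
    simpa [hN0] using hkl
  · intro k
    have h1 := opAlong_autFactor_pow ht hF h ⟨Q * P ^ k, mul_mem hQ (pow_mem hP k)⟩ hz hr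
    have h2 : (fun y => (F ∘ ofComplex) y * autFactor (Q * P ^ k) y ^ m) =
        fun y => (-M : ℂ) ^ m * ((F ∘ ofComplex) y * ((y - z) + (z - 1 / M + N * k)) ^ m) := by
      ext y
      have : autFactor (Q * P ^ k) y = -M * ((y - z) + (z - 1 / M + N * k)) := by
        simp only [autFactor, Matrix.SpecialLinearGroup.coe_mul, hPk, hQ']
        simp [Matrix.mul_apply, Fin.sum_univ_two]
        field_simp
        ring
      rw [this, mul_pow]
      ring
    rw [h2, opAlong_const_mul] at h1
    exact (mul_eq_zero.1 h1).resolve_left (pow_ne_zero _ (neg_ne_zero.2 hM0))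

/-- The space of products of `F` with polynomials of degree at most `m` is carried to the one of
the slash translate. -/
lemma annihilatesTwists_translate {m : ℕ} {L : ThetaOp} {t F : ℍ → ℂ} (hF : MDiff F)
    {g : SL(2, ℝ)} {z : ℂ} (hz : 0 < z.im) (hr : IsRegularPoint (translate t g) z)
    (h : AnnihilatesTwists (m + 1) L (t ∘ ofComplex) (F ∘ ofComplex) (moebius g z)) :
    AnnihilatesTwists (m + 1) L (translate t g) (slashAlong m F g) z := by
  intro p hp
  have hp' : p.natDegree < m + 1 := by
    by_cases hp0 : p = 0
    · simp [hp0]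
    · exact (natDegree_lt_iff_degree_lt hp0).2 hp
  set P : ℂ[X] := ∑ j ∈ Finset.range (m + 1), C (p.coeff j) *
    ((C (g 1 1 : ℂ) * X + C (-(g 0 1) : ℂ)) ^ j * (C (-(g 1 0) : ℂ) * X + C (g 0 0 : ℂ)) ^ (m - j))
    with hP
  have hPd : P.degree < (m + 1 : ℕ) := by
    rw [hP]
    refine (degree_sum_le _ _).trans_lt ((Finset.sup_lt_iff (WithBot.bot_lt_coe _)).2 ?_)
    intro j hj
    have hj' := Finset.mem_range.1 hj
    refine lt_of_le_of_lt (degree_le_of_natDegree_le (n := m) ?_) (by exact_mod_cast m.lt_succ_self)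
    refine (natDegree_C_mul_le _ _).trans (natDegree_mul_le.trans ?_)
    have h1 := natDegree_pow_le_of_le j (natDegree_linear_le (a := (g 1 1 : ℂ)) (b := -(g 0 1 : ℂ)))
    have h2 := natDegree_pow_le_of_le (m - j)
      (natDegree_linear_le (a := -(g 1 0 : ℂ)) (b := (g 0 0 : ℂ)))
    omega
  have hr' := (isRegularPoint_translate_iff hz).1 hr
  have h1 := opAlong_comp (L := L) (analyticAt_moebius g hz) (deriv_moebius_ne_zero g hz) hr'
    ((analyticAt_comp_ofComplex hF (moebius_im_pos g z)).mul (analyticAt_eval P _))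
  have h2 : (fun y => slashAlong m F g y * p.eval y) =ᶠ[𝓝 z]
      ((F ∘ ofComplex) * fun y => P.eval y) ∘ moebius g := by
    filter_upwards [eventually_im_gt hz] with y hy
    have hj := autFactor_ne_zero g hy
    have hdet : (g 0 0 : ℂ) * g 1 1 - g 0 1 * g 1 0 = 1 := by
      have := g.det_coe
      rw [Matrix.det_fin_two] at this
      exact_mod_cast this
    have e1 : (g 1 1 : ℂ) * moebius g y + -(g 0 1) = y / autFactor g y := by
      rw [moebius_eq g hy]
      field_simp
      rw [autFactor]
      linear_combination y * hdet
    have e2 : -(g 1 0 : ℂ) * moebius g y + g 0 0 = 1 / autFactor g y := by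
      rw [moebius_eq g hy]
      field_simp
      rw [autFactor]
      linear_combination hdet
    have e3 : P.eval (moebius g y) = (autFactor g y ^ m)⁻¹ * p.eval y := by
      rw [eval_eq_sum_range' hp', hP, eval_finsetSum, Finset.mul_sum]
      refine Finset.sum_congr rfl fun j hj' => ?_
      have hjm : j + (m - j) = m := by have := Finset.mem_range.1 hj'; omega
      simp only [eval_mul, eval_C, eval_pow, eval_add, eval_X]
      rw [e1, e2, div_pow, div_pow, one_pow, ← hjm, pow_add]
      simp only [Nat.add_sub_cancel_left]
      field_simp
    simp only [Function.comp, Pi.mul_apply, e3]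
    simp only [slashAlong, moebius, ofComplex_apply]
    ring
  rw [opAlong_congr .rfl h2, translate_eq_comp, h1]
  exact h P hPd

/-! ### The mirror map near `i∞` -/

lemma eventually_nhds_of_comap_im {P : ℂ → Prop} (h : ∀ᶠ z in comap Complex.im atTop, P z) :
    ∀ᶠ z in comap Complex.im atTop, ∀ᶠ y in 𝓝 z, P y := by
  rw [eventually_comap] at h ⊢
  obtain ⟨A, hA⟩ := eventually_atTop.1 h
  filter_upwards [eventually_gt_atTop A] with b hb z hz
  filter_upwards [eventually_im_gt (hz ▸ hb : A < z.im)] with y hy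
  exact hA _ hy.le _ rfl

lemma eventually_im_pos : ∀ᶠ z : ℂ in comap Complex.im atTop, 0 < z.im :=
  tendsto_comap.eventually (eventually_gt_atTop 0)

lemma exists_of_comap_im {P : ℂ → Prop} (h : ∀ᶠ z in comap Complex.im atTop, P z) :
    ∃ A : ℝ, 0 < A ∧ ∀ z : ℂ, A < z.im → P z := by
  obtain ⟨A, hA⟩ := eventually_atTop.1 (eventually_comap.1 h)
  exact ⟨max A 1, by positivity, fun z hz => hA _ (le_max_left _ _ |>.trans hz.le) z rfl⟩

instance neBot_comap_im : (comap Complex.im atTop).NeBot :=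
  NeBot.comap_of_surj inferInstance fun y => ⟨⟨0, y⟩, rfl⟩

lemma eventually_comap_im_of_atImInfty {P : ℍ → Prop} (h : ∀ᶠ τ in atImInfty, P τ) :
    ∀ᶠ z in comap Complex.im atTop, P (ofComplex z) :=
  tendsto_comap_im_ofComplex.eventually h

lemma tendsto_exp_comap_im :
    Tendsto (fun z : ℂ => Complex.exp (2 * Real.pi * Complex.I * z)) (comap Complex.im atTop)
      (𝓝[≠] 0) := by
  have := Function.Periodic.qParam_tendsto (h := 1) one_pos
  refine this.congr fun z => ?_
  simp [Function.Periodic.qParam]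

/-- A local holomorphic inverse of the `q`-coordinate `q(t) = t exp(h₁/h₀)`. -/
lemma exists_mirror_map {h₀ h₁ : ℂ → ℂ} (a₀ : AnalyticAt ℂ h₀ 0) (a₁ : AnalyticAt ℂ h₁ 0)
    (e₀ : h₀ 0 = 1) (e₁ : h₁ 0 = 0) :
    ∃ ψ : ℂ → ℂ, AnalyticAt ℂ ψ 0 ∧ ψ 0 = 0 ∧ deriv ψ 0 = 1 ∧
      ∀ᶠ x in 𝓝 0, ψ (x * Complex.exp (h₁ x / h₀ x)) = x := by
  have ha : AnalyticAt ℂ (fun x => Complex.exp (h₁ x / h₀ x)) 0 :=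
    (a₁.div a₀ (by simp [e₀])).cexp
  have hq : AnalyticAt ℂ (fun x => x * Complex.exp (h₁ x / h₀ x)) 0 := analyticAt_id.mul ha
  have hd : deriv (fun x => x * Complex.exp (h₁ x / h₀ x)) 0 = 1 := by
    refine ((hasDerivAt_id (0 : ℂ)).mul ha.differentiableAt.hasDerivAt).deriv.trans ?_
    simp [e₁]
  have hs := hq.hasStrictDerivAt
  have hd0 : deriv (fun x => x * Complex.exp (h₁ x / h₀ x)) 0 ≠ 0 := by simp [hd]
  have hψ : AnalyticAt ℂ (hs.localInverse _ _ _ hd0) 0 := by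
    simpa using hq.analyticAt_localInverse hd0
  refine ⟨hs.localInverse _ _ _ hd0, hψ, ?_, ?_, ?_⟩
  · have : ∀ᶠ x in 𝓝 0, hs.localInverse _ _ _ hd0 (x * Complex.exp (h₁ x / h₀ x)) = x :=
      HasStrictFDerivAt.eventually_left_inverse _
    simpa using this.self_of_nhds
  · have := (hs.to_localInverse hd0).hasDerivAt.deriv
    simpa [hd] using this
  · exact HasStrictFDerivAt.eventually_left_inverse _

/-- The logarithm `σ = log t` along the mirror map, as a function of a complex variable. -/
def logAlong (h : ℕ → ℂ → ℂ) (t : ℍ → ℂ) (z : ℂ) : ℂ := logMirror h t (ofComplex z)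

/-- The mirror map is a holomorphic function of `q = exp(2πiz)` near `i∞`. -/
lemma eventually_eq_mirror_map {h : ℕ → ℂ → ℂ} {t : ℍ → ℂ} {ψ : ℂ → ℂ}
    (hψ : ∀ᶠ x in 𝓝 0, ψ (x * Complex.exp (h 1 x / h 0 x)) = x)
    (ht : Tendsto t atImInfty (𝓝 0))
    (hm : ∀ᶠ τ : ℍ in atImInfty,
      t τ * Complex.exp (h 1 (t τ) / h 0 (t τ)) = Complex.exp (2 * Real.pi * Complex.I * τ)) :
    ∀ᶠ z in comap Complex.im atTop,
      (t ∘ ofComplex) z = ψ (Complex.exp (2 * Real.pi * Complex.I * z)) := by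
  filter_upwards [eventually_comap_im_of_atImInfty hm, eventually_im_pos,
    eventually_comap_im_of_atImInfty (ht.eventually hψ)] with z h1 h2 h3
  rw [ofComplex_apply_of_im_pos h2] at h1 h3
  rw [Function.comp, ofComplex_apply_of_im_pos h2, ← h3, h1]

/-- Near `i∞` the mirror map is regular, and `T / T'` tends to its value `(2πi)⁻¹` for `T = q`. -/
lemma eventually_isRegularPoint {h : ℕ → ℂ → ℂ} {t : ℍ → ℂ} (a₀ : AnalyticAt ℂ (h 0) 0)
    (a₁ : AnalyticAt ℂ (h 1) 0) (e₀ : h 0 0 = 1) (e₁ : h 1 0 = 0)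
    (ht : Tendsto t atImInfty (𝓝 0))
    (hm : ∀ᶠ τ : ℍ in atImInfty,
      t τ * Complex.exp (h 1 (t τ) / h 0 (t τ)) = Complex.exp (2 * Real.pi * Complex.I * τ)) :
    (∀ᶠ z in comap Complex.im atTop, IsRegularPoint (t ∘ ofComplex) z) ∧
    Tendsto (fun z => (t ∘ ofComplex) z / deriv (t ∘ ofComplex) z) (comap Complex.im atTop)
      (𝓝 (2 * Real.pi * Complex.I : ℂ)⁻¹) := by
  obtain ⟨ψ, hψa, hψ0, hψ1, hψ⟩ := exists_mirror_map a₀ a₁ e₀ e₁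
  have hN : (2 * Real.pi * Complex.I : ℂ) ≠ 0 := Complex.two_pi_I_ne_zero
  set N : ℂ := 2 * Real.pi * Complex.I with hNdef
  have hq : Tendsto (fun z : ℂ => Complex.exp (N * z)) (comap Complex.im atTop) (𝓝[≠] 0) :=
    tendsto_exp_comap_im
  have hq0 := tendsto_nhdsWithin_iff.1 hq |>.1
  have hd : ∀ z, HasDerivAt (fun z : ℂ => Complex.exp (N * z)) (N * Complex.exp (N * z)) z := by
    intro z
    simpa [mul_comm] using ((hasDerivAt_id z).const_mul N).cexp
  have key : ∀ᶠ z in comap Complex.im atTop, AnalyticAt ℂ (t ∘ ofComplex) z ∧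
      deriv (t ∘ ofComplex) z = deriv ψ (Complex.exp (N * z)) * (N * Complex.exp (N * z)) := by
    filter_upwards [eventually_nhds_of_comap_im (eventually_eq_mirror_map hψ ht hm),
      hq0.eventually hψa.eventually_analyticAt] with z h1 h2
    have hc : HasDerivAt (fun y => ψ (Complex.exp (N * y)))
        (deriv ψ (Complex.exp (N * z)) * (N * Complex.exp (N * z))) z :=
      h2.differentiableAt.hasDerivAt.comp z (hd z)
    refine ⟨AnalyticAt.congr ?_ (EventuallyEq.symm h1), (EventuallyEq.deriv_eq h1).trans hc.deriv⟩
    exact h2.comp (f := fun y => Complex.exp (N * y)) (by fun_prop)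
  constructor
  · have hψ' : ∀ᶠ x in 𝓝 (0 : ℂ), deriv ψ x ≠ 0 :=
      hψa.deriv.continuousAt.eventually_ne (by simp [hψ1])
    filter_upwards [key, hq0.eventually hψ', eventually_comap_im_of_atImInfty hm]
      with z h1 h2 h3
    refine ⟨h1.1, ?_, ?_⟩
    · intro h0
      simp only [Function.comp] at h0
      rw [h0, zero_mul] at h3
      exact Complex.exp_ne_zero _ h3.symm
    · rw [h1.2]
      exact mul_ne_zero h2 (mul_ne_zero hN (Complex.exp_ne_zero _))
  · have hslope := hψa.differentiableAt.hasDerivAt.tendsto_slope_zero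
    rw [hψ1] at hslope
    have h1 := hslope.comp hq
    have h2 : Tendsto (fun z : ℂ => deriv ψ (Complex.exp (N * z))) (comap Complex.im atTop)
        (𝓝 1) := by
      have := hψa.deriv.continuousAt.tendsto.comp hq0
      rwa [hψ1] at this
    have h3 := (h1.div h2 one_ne_zero).const_mul N⁻¹
    simp only [div_one, mul_one] at h3
    refine h3.congr' ?_
    filter_upwards [key, eventually_eq_mirror_map hψ ht hm] with z k1 k2
    have hne := Complex.exp_ne_zero (N * z)
    rw [k1.2, k2, ← hNdef]
    simp only [Function.comp_apply, zero_add, hψ0, sub_zero, smul_eq_mul, Pi.div_apply]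
    field_simp

/-- Near `i∞` the function `logAlong h t` is a holomorphic logarithm of the mirror map, without
critical points. -/
lemma eventually_logAlong {h : ℕ → ℂ → ℂ} {t : ℍ → ℂ} (a₀ : AnalyticAt ℂ (h 0) 0)
    (a₁ : AnalyticAt ℂ (h 1) 0) (e₀ : h 0 0 = 1) (e₁ : h 1 0 = 0)
    (ht : Tendsto t atImInfty (𝓝 0))
    (hm : ∀ᶠ τ : ℍ in atImInfty,
      t τ * Complex.exp (h 1 (t τ) / h 0 (t τ)) = Complex.exp (2 * Real.pi * Complex.I * τ)) :
    (∀ᶠ z in comap Complex.im atTop, AnalyticAt ℂ (logAlong h t) z ∧ deriv (logAlong h t) z ≠ 0) ∧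
    (∀ᶠ z in comap Complex.im atTop, Complex.exp (logAlong h t z) = (t ∘ ofComplex) z) ∧
    Tendsto (logAlong h t) (comap Complex.im atTop) nearZero := by
  have hT0 : Tendsto (t ∘ ofComplex) (comap Complex.im atTop) (𝓝 0) :=
    ht.comp tendsto_comap_im_ofComplex
  have hexp : ∀ᶠ z in comap Complex.im atTop,
      Complex.exp (logAlong h t z) = (t ∘ ofComplex) z := by
    filter_upwards [eventually_comap_im_of_atImInfty hm] with z hz
    rw [logAlong, logMirror, Complex.exp_sub, ← hz, Function.comp,
      mul_div_cancel_right₀ _ (Complex.exp_ne_zero _)]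
  have hreg := (eventually_isRegularPoint a₀ a₁ e₀ e₁ ht hm).1
  refine ⟨?_, hexp, ?_⟩
  · filter_upwards [hreg, hT0.eventually a₀.eventually_analyticAt,
      hT0.eventually a₁.eventually_analyticAt,
      hT0.eventually (a₀.continuousAt.eventually_ne (e₀ ▸ one_ne_zero)),
      eventually_im_pos, eventually_nhds_of_comap_im hexp] with z h1 h2 h3 h4 h5 h6
    have hσ : AnalyticAt ℂ (logAlong h t) z := by
      have : AnalyticAt ℂ (fun y => 2 * Real.pi * Complex.I * y -
          h 1 ((t ∘ ofComplex) y) / h 0 ((t ∘ ofComplex) y)) z :=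
        AnalyticAt.sub (by fun_prop)
          ((h3.comp h1.analyticAt).div (h2.comp h1.analyticAt) h4)
      refine this.congr ?_
      filter_upwards [eventually_im_gt h5] with y hy
      simp [logAlong, logMirror, ofComplex_apply_of_im_pos hy]
    refine ⟨hσ, fun h0 => h1.deriv_ne_zero ?_⟩
    rw [← EventuallyEq.deriv_eq h6]
    have := hσ.differentiableAt.hasDerivAt.cexp.deriv
    rw [this, h0, mul_zero]
  · rw [nearZero, tendsto_comap_iff, ← Real.tendsto_exp_comp_nhds_zero]
    have h1 := hT0.norm
    rw [norm_zero] at h1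
    refine h1.congr' ?_
    filter_upwards [hexp] with z hz
    rw [← hz, Complex.norm_exp]
    rfl

lemma opAlong_comp_logAlong {h : ℕ → ℂ → ℂ} {t : ℍ → ℂ} {L : ThetaOp} {f : ℂ → ℂ} {z : ℂ}
    (hσ : AnalyticAt ℂ (logAlong h t) z) (hσ' : deriv (logAlong h t) z ≠ 0)
    (hexp : ∀ᶠ y in 𝓝 z, Complex.exp (logAlong h t y) = (t ∘ ofComplex) y)
    (hf : AnalyticAt ℂ f (logAlong h t z)) :
    opAlong L (t ∘ ofComplex) (f ∘ logAlong h t) z = applyOp L f (logAlong h t z) := by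
  rw [applyOp_eq_opAlong_exp, ← opAlong_comp hσ hσ' (isRegularPoint_exp _) hf]
  exact opAlong_congr (EventuallyEq.symm hexp) .rfl

/-! ### Expansions in exponentials -/

/-- Repeated differentiation of `exp(l z) B(u)`, where `u = exp(c z)`, multiplies the leading
coefficient by `l`. -/
lemma iteratedDeriv_exp_mul (c l : ℂ) {B : ℂ → ℂ} (hB : AnalyticAt ℂ B 0) (j : ℕ) :
    ∃ D : ℂ → ℂ, AnalyticAt ℂ D 0 ∧ D 0 = l ^ j * B 0 ∧
      ∀ᶠ u in 𝓝 (0 : ℂ), ∀ z : ℂ, Complex.exp (c * z) = u →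
        iteratedDeriv j (fun y => Complex.exp (l * y) * B (Complex.exp (c * y))) z =
          Complex.exp (l * z) * D u := by
  induction j with
  | zero => exact ⟨B, hB, by simp, by filter_upwards with u z hz; simp [hz]⟩
  | succ j ih =>
    obtain ⟨D, hD, hD0, h⟩ := ih
    refine ⟨fun u => l * D u + c * u * deriv D u, ?_, ?_, ?_⟩
    · have := hD.deriv
      fun_prop
    · simp only [mul_zero, zero_mul, add_zero, hD0]
      ring
    · filter_upwards [h.eventually_nhds, hD.eventually_analyticAt] with u h1 h2 z hz
      have hc : Tendsto (fun y : ℂ => Complex.exp (c * y)) (𝓝 z) (𝓝 u) := by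
        have : ContinuousAt (fun y : ℂ => Complex.exp (c * y)) z := by fun_prop
        exact hz ▸ this.tendsto
      rw [iteratedDeriv_succ, EventuallyEq.deriv_eq ((hc.eventually h1).mono fun y hy => hy y rfl)]
      have d1 : ∀ a : ℂ, HasDerivAt (fun y : ℂ => Complex.exp (a * y))
          (a * Complex.exp (a * z)) z := fun a => by
        simpa [mul_comm] using ((hasDerivAt_id z).const_mul a).cexp
      have d2 : HasDerivAt (fun y : ℂ => D (Complex.exp (c * y)))
          (deriv D u * (c * Complex.exp (c * z))) z := by
        have : HasDerivAt D (deriv D u) (Complex.exp (c * z)) :=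
          hz ▸ h2.differentiableAt.hasDerivAt
        exact this.comp z (d1 c)
      refine ((d1 l).mul d2).deriv.trans ?_
      rw [hz]
      ring

/-! ### Solutions near `t = 0` -/

instance neBot_nearZero : nearZero.NeBot :=
  NeBot.comap_of_surj inferInstance fun y => ⟨y, rfl⟩

lemma eventually_nhds_of_nearZero {P : ℂ → Prop} (h : ∀ᶠ s in nearZero, P s) :
    ∀ᶠ s in nearZero, ∀ᶠ y in 𝓝 s, P y := by
  rw [nearZero, eventually_comap] at h ⊢
  obtain ⟨A, hA⟩ := eventually_atBot.1 h
  filter_upwards [eventually_lt_atBot A] with b hb z hz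
  filter_upwards [(isOpen_lt Complex.continuous_re continuous_const).mem_nhds
    (hz ▸ hb : z.re < A)] with y hy
  exact hA _ (le_of_lt hy) _ rfl

lemma tendsto_exp_nearZero : Tendsto Complex.exp nearZero (𝓝[≠] 0) := by
  refine tendsto_nhdsWithin_iff.2 ⟨?_, Eventually.of_forall Complex.exp_ne_zero⟩
  rw [tendsto_zero_iff_norm_tendsto_zero]
  simp only [Complex.norm_exp]
  exact Real.tendsto_exp_atBot.comp tendsto_comap

lemma tendsto_exp_nearZero' : Tendsto Complex.exp nearZero (𝓝 0) :=
  (tendsto_nhdsWithin_iff.1 tendsto_exp_nearZero).1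

lemma tendsto_ofReal_nearZero : Tendsto (fun x : ℝ => (x : ℂ)) atBot nearZero :=
  tendsto_comap_iff.2 tendsto_id

lemma eventually_eq_const_nearZero {f : ℂ → ℂ} (hf : ∀ᶠ s in nearZero, AnalyticAt ℂ f s)
    (h : ∀ᶠ s in nearZero, deriv f s = 0) : ∃ c, ∀ᶠ s in nearZero, f s = c := by
  obtain ⟨A, hA⟩ := eventually_atBot.1 (eventually_comap.1 (hf.and h))
  have hop : IsOpen {s : ℂ | s.re < A} := isOpen_lt Complex.continuous_re continuous_const
  refine ⟨f ((A - 1 : ℝ) : ℂ), ?_⟩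
  have hlt : ∀ᶠ s in nearZero, s.re < A := tendsto_comap.eventually (eventually_lt_atBot A)
  filter_upwards [hlt] with s hs
  refine hop.is_const_of_deriv_eq_zero (convex_halfSpace_re_lt A).isPreconnected
    (fun y hy => (hA _ (le_of_lt hy) y rfl).1.differentiableAt.differentiableWithinAt)
    (fun y hy => (hA _ (le_of_lt hy) y rfl).2) hs ?_
  simp

lemma analyticAt_omega {h : ℕ → ℂ → ℂ} {k : ℕ} (ha : ∀ j ≤ k, AnalyticAt ℂ (h j) 0) :
    ∀ᶠ s in nearZero, AnalyticAt ℂ (omega h k) s := by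
  have : ∀ᶠ s in nearZero, ∀ j ∈ Finset.range (k + 1), AnalyticAt ℂ (h j) (Complex.exp s) := by
    rw [eventually_all_finset]
    intro j hj
    exact tendsto_exp_nearZero'.eventually
      (ha j (Nat.lt_succ_iff.1 (Finset.mem_range.1 hj))).eventually_analyticAt
  filter_upwards [this] with s hs
  refine AnalyticAt.mul analyticAt_const (Finset.analyticAt_fun_sum _ fun j hj => ?_)
  exact (analyticAt_const.mul ((hs j hj).comp (f := Complex.exp) (by fun_prop))).mul (by fun_prop)

lemma analyticAt_iteratedDeriv {f : ℂ → ℂ} {s : ℂ} (hf : AnalyticAt ℂ f s) (j : ℕ) :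
    AnalyticAt ℂ (iteratedDeriv j f) s := by
  have h := (isRegularPoint_exp s).analyticAt_iterate hf j
  rwa [thetaAlong_exp, ← iteratedDeriv_eq_iterate] at h

lemma sum_X_add_C_mul (P : ℂ[X]) (b : ℂ) (c : ℕ → ℂ) :
    (((X + C b) * P).sum fun j a => a * c j) =
      (P.sum fun j a => a * c (j + 1)) + b * P.sum fun j a => a * c j := by
  have h1 : ((X + C b) * P).natDegree < P.natDegree + 2 := by
    refine lt_of_le_of_lt natDegree_mul_le ?_
    rw [natDegree_X_add_C]
    omega
  rw [sum_over_range' _ (by simp) _ h1, sum_over_range' P (by simp) (P.natDegree + 1) (by omega),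
    sum_over_range' P (by simp) (P.natDegree + 2) (by omega), Finset.sum_range_succ',
    Finset.sum_range_succ' (fun j => P.coeff j * c j)]
  simp only [add_mul, coeff_add, coeff_X_mul, coeff_C_mul, coeff_X_mul_zero,
    Finset.sum_add_distrib, mul_add, Finset.mul_sum]
  simp only [mul_assoc]
  ring

lemma coeff_quantumOp (L : ThetaOp) (i : ℕ) :
    (quantumOp L).coeff i = (X + C (i : ℂ)) * L.coeff i := by
  have h := coeff_sum_monomial_add L 0 i (fun i P => (X + C (i : ℂ)) * P) (by simp)
  simp only [add_zero] at h
  rw [← h, quantumOp, thetaMul, theta, sum_C_index (by simp [Polynomial.sum])]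
  simp

/-- The operator `θ L` acts as `d/ds` applied to `L`. -/
lemma applyOp_quantumOp {L : ThetaOp} {f : ℂ → ℂ} {s : ℂ} (hf : AnalyticAt ℂ f s) :
    HasDerivAt (applyOp L f) (applyOp (quantumOp L) f s) s := by
  have hdeg : (quantumOp L).natDegree < L.natDegree + 1 := by
    refine Nat.lt_succ_of_le (natDegree_le_iff_coeff_eq_zero.2 fun N hN => ?_)
    rw [coeff_quantumOp, coeff_eq_zero_of_natDegree_lt hN, mul_zero]
  have e1 : applyOp L f = fun s => ∑ i ∈ Finset.range (L.natDegree + 1),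
      Complex.exp s ^ i * (L.coeff i).sum fun j a => a * iteratedDeriv j f s := by
    ext s
    exact sum_over_range' _ (by simp) _ (by omega)
  rw [e1, applyOp, sum_over_range' _ (by simp) _ hdeg]
  refine HasDerivAt.fun_sum fun i _ => ?_
  rw [coeff_quantumOp, sum_X_add_C_mul]
  have d1 : HasDerivAt (fun s => Complex.exp s ^ i) (i * Complex.exp s ^ i) s := by
    simp only [← Complex.exp_nat_mul]
    simpa [mul_comm] using ((hasDerivAt_id s).const_mul (i : ℂ)).cexp
  have d2 : HasDerivAt (fun s => (L.coeff i).sum fun j a => a * iteratedDeriv j f s)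
      ((L.coeff i).sum fun j a => a * iteratedDeriv (j + 1) f s) s := by
    refine HasDerivAt.fun_sum fun j _ => HasDerivAt.const_mul _ ?_
    rw [iteratedDeriv_succ]
    exact (analyticAt_iteratedDeriv hf j).differentiableAt.hasDerivAt
  refine (d1.mul d2).congr_deriv ?_
  ring

/-- Functions of `s = log t` which tend to zero at `t = 0` along the real axis with all their
derivatives. -/
structure IsNegligible (r : ℂ → ℂ) : Prop where
  analyticAt : ∀ᶠ s in nearZero, AnalyticAt ℂ r s
  tendsto : ∀ j, Tendsto (fun x : ℝ => iteratedDeriv j r x) atBot (𝓝 0)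

lemma tendsto_exp_mul_eval (p : ℂ[X]) :
    Tendsto (fun x : ℝ => Complex.exp x * p.eval (x : ℂ)) atBot (𝓝 0) := by
  induction p using Polynomial.induction_on' with
  | add p q hp hq =>
    simpa [mul_add] using hp.add hq
  | monomial m a =>
    have h := (Real.tendsto_pow_mul_exp_neg_atTop_nhds_zero m).comp tendsto_neg_atBot_atTop
    have h2 : Tendsto (fun x : ℝ => ‖a‖ * ((-x) ^ m * Real.exp (- -x))) atBot (𝓝 0) := by
      simpa using h.const_mul ‖a‖
    rw [tendsto_zero_iff_norm_tendsto_zero]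
    have h3 := h2.norm
    rw [norm_zero] at h3
    refine h3.congr fun x => ?_
    simp [Complex.norm_exp]
    ring

lemma isNegligible_exp_mul {G : ℂ → ℂ} (hG : AnalyticAt ℂ G 0) (m : ℕ) :
    IsNegligible fun s => Complex.exp s * G (Complex.exp s) * s ^ m := by
  have han : ∀ {G : ℂ → ℂ} (_ : AnalyticAt ℂ G 0) (m : ℕ), ∀ᶠ s in nearZero,
      AnalyticAt ℂ (fun s => Complex.exp s * G (Complex.exp s) * s ^ m) s := by
    intro G hG m
    filter_upwards [tendsto_exp_nearZero'.eventually hG.eventually_analyticAt] with s hs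
    have : AnalyticAt ℂ (fun s => G (Complex.exp s)) s := hs.comp (f := Complex.exp) (by fun_prop)
    fun_prop
  refine ⟨han hG m, fun j => ?_⟩
  induction j generalizing G m with
  | zero =>
    have h1 := hG.continuousAt.tendsto.comp (tendsto_exp_nearZero'.comp tendsto_ofReal_nearZero)
    have h2 := (tendsto_exp_mul_eval (X ^ m)).mul h1
    rw [zero_mul] at h2
    refine h2.congr fun x => ?_
    simp
    ring
  | succ j ih =>
    have hG' : AnalyticAt ℂ (fun u => G u + u * deriv G u) 0 := by
      have := hG.deriv
      fun_prop
    have h1 := (ih hG' m).add ((ih hG (m - 1)).const_mul (m : ℂ))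
    rw [mul_zero, add_zero] at h1
    refine h1.congr' ?_
    have hd : ∀ᶠ s in nearZero, deriv (fun s => Complex.exp s * G (Complex.exp s) * s ^ m) s =
        Complex.exp s * (G (Complex.exp s) + Complex.exp s * deriv G (Complex.exp s)) * s ^ m +
          m * (Complex.exp s * G (Complex.exp s) * s ^ (m - 1)) := by
      filter_upwards [tendsto_exp_nearZero'.eventually hG.eventually_analyticAt] with s hs
      have d1 : HasDerivAt (fun s => G (Complex.exp s))
          (deriv G (Complex.exp s) * Complex.exp s) s :=
        hs.differentiableAt.hasDerivAt.comp s (Complex.hasDerivAt_exp s)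
      refine (((Complex.hasDerivAt_exp s).mul d1).mul (hasDerivAt_pow m s)).deriv.trans ?_
      simp only [Pi.mul_apply]
      ring
    filter_upwards [tendsto_ofReal_nearZero.eventually (eventually_nhds_of_nearZero hd),
      tendsto_ofReal_nearZero.eventually (han hG' m),
      tendsto_ofReal_nearZero.eventually (han hG (m - 1))] with x k1 k2 k3
    rw [iteratedDeriv_succ', Filter.EventuallyEq.iteratedDeriv_eq j k1,
      iteratedDeriv_fun_add k2.contDiffAt (contDiffAt_const.mul k3.contDiffAt),
      iteratedDeriv_const_mul_field]

lemma IsNegligible.add {r q : ℂ → ℂ} (hr : IsNegligible r) (hq : IsNegligible q) :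
    IsNegligible fun s => r s + q s := by
  refine ⟨by filter_upwards [hr.analyticAt, hq.analyticAt] with s h1 h2 using h1.add h2,
    fun j => ?_⟩
  have h1 := (hr.tendsto j).add (hq.tendsto j)
  rw [add_zero] at h1
  refine h1.congr' ?_
  filter_upwards [tendsto_ofReal_nearZero.eventually hr.analyticAt,
      tendsto_ofReal_nearZero.eventually hq.analyticAt] with x k1 k2
  rw [iteratedDeriv_fun_add k1.contDiffAt k2.contDiffAt]

lemma IsNegligible.const_mul {r : ℂ → ℂ} (hr : IsNegligible r) (c : ℂ) :
    IsNegligible fun s => c * r s := by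
  refine ⟨by filter_upwards [hr.analyticAt] with s h1 using analyticAt_const.mul h1, fun j => ?_⟩
  simpa [iteratedDeriv_const_mul_field] using (hr.tendsto j).const_mul c

lemma IsNegligible.sum {ι : Type*} (s : Finset ι) {r : ι → ℂ → ℂ}
    (hr : ∀ i ∈ s, IsNegligible (r i)) : IsNegligible fun z => ∑ i ∈ s, r i z := by
  classical
  induction s using Finset.induction_on with
  | empty =>
    refine ⟨by simp [analyticAt_const], fun j => ?_⟩
    simp
  | insert i s hi ih =>
    simp only [Finset.sum_insert hi]
    exact (hr i (Finset.mem_insert_self i s)).add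
      (ih fun k hk => hr k (Finset.mem_insert_of_mem hk))

/-- At `t = 0` the operator `L` acts on polynomials in `log t` as its constant part `θⁿ`, up to
negligible terms. -/
lemma tendsto_applyOp {n : ℕ} {L : ThetaOp} (h0 : L.coeff 0 = X ^ n) {r : ℂ → ℂ}
    (hr : IsNegligible r) (p : ℂ[X]) :
    Tendsto (fun x : ℝ => applyOp L (fun s => p.eval s + r s) x -
      (derivative^[n] p).eval (x : ℂ)) atBot (𝓝 0) := by
  have hd : ∀ j, ∀ᶠ x : ℝ in atBot, iteratedDeriv j (fun s => p.eval s + r s) x =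
      (derivative^[j] p).eval (x : ℂ) + iteratedDeriv j r x := by
    intro j
    filter_upwards [tendsto_ofReal_nearZero.eventually hr.analyticAt] with x hx
    rw [iteratedDeriv_fun_add (analyticAt_eval p _).contDiffAt hx.contDiffAt,
      iteratedDeriv_eq_iterate (f := fun s => p.eval s), iterate_deriv_eval]
  have e1 : ∀ x : ℝ, applyOp L (fun s => p.eval s + r s) x -
      (derivative^[n] p).eval (x : ℂ) =
      (∑ i ∈ Finset.range L.natDegree, Complex.exp x ^ (i + 1) * (L.coeff (i + 1)).sum fun j a =>
        a * iteratedDeriv j (fun s => p.eval s + r s) x) +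
      (iteratedDeriv n (fun s => p.eval s + r s) x - (derivative^[n] p).eval (x : ℂ)) := by
    intro x
    rw [applyOp, sum_over_range' _ (by simp) (L.natDegree + 1) (by omega), Finset.sum_range_succ',
      h0]
    rw [← monomial_one_right_eq_X_pow, sum_monomial_index _ _ (by simp)]
    simp
    ring
  simp only [e1]
  rw [← add_zero (0 : ℂ)]
  refine Tendsto.add ?_ ?_
  · rw [← Finset.sum_const_zero (s := Finset.range L.natDegree)]
    refine tendsto_finsetSum _ fun i _ => ?_
    have h1 : Tendsto (fun x : ℝ => (L.coeff (i + 1)).sum fun j a =>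
        a * (Complex.exp x * iteratedDeriv j (fun s => p.eval s + r s) x)) atBot (𝓝 0) := by
      rw [← Finset.sum_const_zero (s := (L.coeff (i + 1)).support)]
      refine tendsto_finsetSum _ fun j _ => ?_
      have h2 := (tendsto_exp_mul_eval (derivative^[j] p)).add
        ((tendsto_exp_nearZero'.comp tendsto_ofReal_nearZero).mul (hr.tendsto j))
      have h3 := (h2.congr' (f₂ := fun x : ℝ => Complex.exp x *
        iteratedDeriv j (fun s => p.eval s + r s) x) (by
          filter_upwards [hd j] with x hx
          rw [hx, Function.comp]
          ring)).const_mul ((L.coeff (i + 1)).coeff j)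
      simpa using h3
    have h2 := (((tendsto_exp_nearZero'.comp tendsto_ofReal_nearZero).pow i).mul h1)
    rw [mul_zero] at h2
    refine h2.congr fun x => ?_
    simp only [Polynomial.sum, Finset.mul_sum, Function.comp, pow_succ]
    exact Finset.sum_congr rfl fun j _ => by ring
  · refine (hr.tendsto n).congr' ?_
    filter_upwards [hd n] with x hx
    rw [hx]
    ring

/-- The function `ω_k` is `(log t / 2πi)ᵏ` up to a negligible term. -/
lemma exists_negligible_omega {H : ℕ → ℂ → ℂ} {k : ℕ} (ha : ∀ j ≤ k, AnalyticAt ℂ (H j) 0)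
    (h0 : H 0 0 = 1) (hpos : ∀ j ≤ k, 0 < j → H j 0 = 0) :
    ∃ r, IsNegligible r ∧ omega H k =
      fun s => (C ((2 * Real.pi * Complex.I : ℂ)⁻¹ ^ k) * X ^ k : ℂ[X]).eval s + r s := by
  refine ⟨fun s => (2 * Real.pi * Complex.I : ℂ)⁻¹ ^ k * ∑ j ∈ Finset.range (k + 1),
    (k.choose j : ℂ) * (Complex.exp s * dslope (H j) 0 (Complex.exp s) * s ^ (k - j)), ?_, ?_⟩
  · refine (IsNegligible.sum _ fun j hj => (isNegligible_exp_mul ?_ _).const_mul _).const_mul _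
    obtain ⟨q, hq⟩ := ha j (Nat.lt_succ_iff.1 (Finset.mem_range.1 hj))
    exact ⟨_, hq.has_fpower_series_dslope_fslope⟩
  · ext s
    have e : ∀ j, H j (Complex.exp s) =
        H j 0 + Complex.exp s * dslope (H j) 0 (Complex.exp s) := by
      intro j
      have := sub_smul_dslope (H j) 0 (Complex.exp s)
      rw [sub_zero, smul_eq_mul] at this
      rw [this]
      ring
    simp only [omega, e, mul_add, add_mul, Finset.sum_add_distrib]
    rw [Finset.sum_range_succ' (fun j => (k.choose j : ℂ) * H j 0 * s ^ (k - j)),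
      Finset.sum_eq_zero]
    · simp [h0, mul_assoc]
    · intro j hj
      rw [hpos (j + 1) (by have := Finset.mem_range.1 hj; omega) (by omega)]
      simp

/-- `θ L ω = 0` says that `L ω` is constant; the constant is read off from the leading term of `ω`
at `t = 0`. -/
lemma IsFrobeniusBasis.applyOp_omega {n : ℕ} {L : ThetaOp} {H : ℕ → ℂ → ℂ}
    (h0 : L.coeff 0 = X ^ n) (hH : IsFrobeniusBasis (n + 1) (quantumOp L) H) {k : ℕ} (hk : k ≤ n) :
    ∀ᶠ s in nearZero, applyOp L (omega H k) s =
      if k = n then n.factorial / (2 * Real.pi * Complex.I) ^ n else 0 := by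
  have ha : ∀ j ≤ k, AnalyticAt ℂ (H j) 0 := fun j hj => hH.analytic j (by omega)
  have han := analyticAt_omega ha
  have hc : ∃ c, ∀ᶠ s in nearZero, applyOp L (omega H k) s = c := by
    refine eventually_eq_const_nearZero ?_ ?_
    · filter_upwards [han] with s hs
      refine Finset.analyticAt_fun_sum _ fun i _ => AnalyticAt.mul (by fun_prop) ?_
      exact Finset.analyticAt_fun_sum _ fun j _ =>
        analyticAt_const.mul (analyticAt_iteratedDeriv hs j)
    · filter_upwards [han, hH.solution k (by omega)] with s h1 h2
      rw [(applyOp_quantumOp h1).deriv, h2]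
  obtain ⟨c, hc⟩ := hc
  obtain ⟨r, hr, he⟩ := exists_negligible_omega ha hH.h_zero
    (fun j hj hj0 => hH.h_pos j (by omega) hj0)
  have hlim := tendsto_applyOp h0 hr (C ((2 * Real.pi * Complex.I : ℂ)⁻¹ ^ k) * X ^ k)
  rw [← he] at hlim
  have hp : ∀ x : ℂ, (derivative^[n] (C ((2 * Real.pi * Complex.I : ℂ)⁻¹ ^ k) * X ^ k)).eval x =
      if k = n then n.factorial / (2 * Real.pi * Complex.I) ^ n else 0 := by
    intro x
    rw [iterate_derivative_C_mul, iterate_derivative_X_pow_eq_smul]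
    split_ifs with hkn
    · subst hkn
      simp only [Nat.descFactorial_self, Nat.sub_self, pow_zero, eval_mul, eval_C, eval_smul,
        eval_one, inv_pow]
      simp [div_eq_mul_inv, mul_comm]
    · rw [Nat.descFactorial_of_lt (by omega)]
      simp
  simp only [hp] at hlim
  have hcl : Tendsto (fun _ : ℝ => c - if k = n then (n.factorial : ℂ) /
      (2 * Real.pi * Complex.I) ^ n else 0) atBot (𝓝 0) := by
    refine hlim.congr' ?_
    filter_upwards [tendsto_ofReal_nearZero.eventually hc] with x hx
    rw [hx]
  have := tendsto_nhds_unique hcl tendsto_const_nhds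
  rw [← sub_eq_zero.1 this.symm]
  exact hc

/-- A holomorphic solution at `t = 0` is determined by its value there. -/
lemma eventuallyEq_of_applyOp_eq_zero {n : ℕ} {L : ThetaOp} (h0 : L.coeff 0 = X ^ n)
    {f g : ℂ → ℂ} (hf : AnalyticAt ℂ f 0) (hg : AnalyticAt ℂ g 0) (hfg : f 0 = g 0)
    (hLf : ∀ᶠ s in nearZero, applyOp L (f ∘ Complex.exp) s = 0)
    (hLg : ∀ᶠ s in nearZero, applyOp L (g ∘ Complex.exp) s = 0) : f =ᶠ[𝓝 0] g := by
  have hd : AnalyticAt ℂ (fun u => f u - g u) 0 := hf.sub hg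
  have hL : ∀ᶠ s in nearZero, applyOp L (fun s => f (Complex.exp s) - g (Complex.exp s)) s = 0 := by
    filter_upwards [hLf, hLg, tendsto_exp_nearZero'.eventually hf.eventually_analyticAt,
      tendsto_exp_nearZero'.eventually hg.eventually_analyticAt] with s h1 h2 h3 h4
    rw [applyOp_eq_opAlong_exp] at h1 h2 ⊢
    have h3' : AnalyticAt ℂ (f ∘ Complex.exp) s := h3.comp (f := Complex.exp) (by fun_prop)
    have h4' : AnalyticAt ℂ (fun y => (-1) * (g ∘ Complex.exp) y) s :=
      analyticAt_const.mul (h4.comp (f := Complex.exp) (by fun_prop))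
    have h5 := opAlong_add (L := L) (isRegularPoint_exp s) h3' h4'
    rw [opAlong_const_mul, h1, h2] at h5
    rw [mul_zero, add_zero] at h5
    rw [← h5]
    congr 1
    ext y
    simp [sub_eq_add_neg]
  by_contra hne
  have hord : analyticOrderAt (fun u => f u - g u) 0 ≠ ⊤ := by
    rw [Ne, analyticOrderAt_eq_top]
    intro h
    exact hne (h.mono fun u hu => sub_eq_zero.1 hu)
  obtain ⟨k, hk⟩ := WithTop.ne_top_iff_exists.1 hord
  obtain ⟨B, hB, hB0, hB'⟩ := (hd.analyticOrderAt_eq_natCast (n := k)).1 hk.symm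
  have hk0 : k ≠ 0 := by
    rintro rfl
    have := hB'.self_of_nhds
    simp [hfg] at this
    exact hB0 this.symm
  -- the difference has leading term `B(0) tᵏ`, which `θⁿ` multiplies by `kⁿ ≠ 0`
  choose D hD hD0 hDe using fun j => iteratedDeriv_exp_mul 1 k hB j
  have hfe : ∀ᶠ s in nearZero, ∀ᶠ y in 𝓝 s, f (Complex.exp y) - g (Complex.exp y) =
      Complex.exp (k * y) * B (Complex.exp (1 * y)) := by
    refine eventually_nhds_of_nearZero ?_
    filter_upwards [tendsto_exp_nearZero'.eventually hB'] with s hs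
    rw [hs, one_mul, Complex.exp_nat_mul]
    simp
  have hsum : ∀ᶠ s in nearZero, ∑ i ∈ Finset.range (L.natDegree + 1), Complex.exp s ^ i *
      (L.coeff i).sum (fun j a => a * D j (Complex.exp s)) = 0 := by
    have hall : ∀ᶠ s in nearZero, ∀ i ∈ Finset.range (L.natDegree + 1), ∀ j ∈ (L.coeff i).support,
        iteratedDeriv j (fun y => Complex.exp (k * y) * B (Complex.exp (1 * y))) s =
          Complex.exp (k * s) * D j (Complex.exp s) := by
      simp only [eventually_all_finset]
      intro i _ j _
      filter_upwards [tendsto_exp_nearZero'.eventually (hDe j)] with s hs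
      exact hs s (by rw [one_mul])
    filter_upwards [hL, hall, hfe] with s h1 h2 h3
    rw [applyOp, sum_over_range' _ (by simp) (L.natDegree + 1) (by omega)] at h1
    have h4 : Complex.exp (k * s) * ∑ i ∈ Finset.range (L.natDegree + 1), Complex.exp s ^ i *
      (L.coeff i).sum (fun j a => a * D j (Complex.exp s)) = 0 := by
      rw [← h1, Finset.mul_sum]
      refine Finset.sum_congr rfl fun i hi => ?_
      simp only [Polynomial.sum, Finset.mul_sum]
      refine Finset.sum_congr rfl fun j hj => ?_
      rw [Filter.EventuallyEq.iteratedDeriv_eq j h3, h2 i hi j hj]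
      ring
    exact (mul_eq_zero.1 h4).resolve_left (Complex.exp_ne_zero _)
  have hlim : Tendsto (fun s => ∑ i ∈ Finset.range (L.natDegree + 1), Complex.exp s ^ i *
      (L.coeff i).sum (fun j a => a * D j (Complex.exp s))) nearZero
      (𝓝 (∑ i ∈ Finset.range (L.natDegree + 1), (0 : ℂ) ^ i *
      (L.coeff i).sum (fun j a => a * D j 0))) := by
    refine tendsto_finsetSum _ fun i _ => (tendsto_exp_nearZero'.pow i).mul ?_
    exact tendsto_finsetSum _ fun j _ =>
      ((hD j).continuousAt.tendsto.comp tendsto_exp_nearZero').const_mul _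
  have hz : Tendsto (fun _ : ℂ => (0 : ℂ)) nearZero (𝓝 (∑ i ∈ Finset.range (L.natDegree + 1),
      (0 : ℂ) ^ i * (L.coeff i).sum (fun j a => a * D j 0))) :=
    hlim.congr' hsum
  have h5 := tendsto_nhds_unique hz tendsto_const_nhds
  rw [Finset.sum_range_succ', h0, ← monomial_one_right_eq_X_pow,
    sum_monomial_index _ _ (by simp)] at h5
  simp [hD0, hB0, hk0] at h5

/-! ### Symmetric pairs -/

/-- A meromorphic parametrization `T` of the `t`-line by the upper half plane together with a
holomorphic `Φ` such that `L` annihilates `Φ, zΦ, …, zⁿ⁻¹Φ`, normalized by the Wronskian identity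
`Φ² c_n(T) (T / T')ⁿ⁻¹ = κ`. All translates of a modular parametrization are of this kind. -/
structure SymmetricPair (n : ℕ) (L : ThetaOp) (κ : ℂ) (T Φ : ℂ → ℂ) : Prop where
  mero : MeromorphicOn T {z | 0 < z.im}
  holo : ∀ z : ℂ, 0 < z.im → AnalyticAt ℂ Φ z
  regular : ∀ z : ℂ, 0 < z.im → ∀ᶠ y in 𝓝[≠] z, IsRegularPoint T y
  twists : ∀ z : ℂ, 0 < z.im → IsRegularPoint T z → AnnihilatesTwists n L T Φ z
  wronskian : ∀ z : ℂ, 0 < z.im → IsRegularPoint T z →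
    Φ z ^ 2 * (thetaCoeff L n).eval (T z) * (T z / deriv T z) ^ (n - 1) = κ

lemma opAlong_one {n : ℕ} {L : ThetaOp} (hL : ∀ i, (L.coeff i).natDegree ≤ n) (T : ℂ → ℂ) (z : ℂ) :
    opAlong L T (fun _ => 1) z = (thetaCoeff L 0).eval (T z) := by
  have h0 : thetaAlong T (fun _ => 1) = fun _ => 0 := by
    ext y
    simp [thetaAlong]
  have h1 : ∀ j, (thetaAlong T)^[j] (fun _ => 0) = fun _ => 0 := by
    intro j
    induction j with
    | zero => rfl
    | succ j ih =>
      have : thetaAlong T (fun _ => 0) = fun _ => 0 := by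
        ext y
        simp [thetaAlong]
      rw [Function.iterate_succ_apply, this, ih]
  rw [opAlong_eq_sum hL, Finset.sum_range_succ', Finset.sum_eq_zero]
  · simp
  · intro j _
    rw [Function.iterate_succ_apply, h0, h1, mul_zero]

lemma SymmetricPair.ne_zero {n : ℕ} {L : ThetaOp} {κ : ℂ} {T Φ : ℂ → ℂ} (hκ : κ ≠ 0)
    (h : SymmetricPair n L κ T Φ) {z : ℂ} (hz : 0 < z.im) (hr : IsRegularPoint T z) :
    Φ z ≠ 0 ∧ (thetaCoeff L n).eval (T z) ≠ 0 := by
  have := h.wronskian z hz hr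
  constructor <;>
  · intro h0
    rw [h0] at this
    simp at this
    exact hκ this.symm

/-- The equation `L 1 = c₀`, transported to the parameter: it expresses `c₀` through `1/Φ`. -/
lemma SymmetricPair.thetaCoeff_zero_eval {n : ℕ} {L : ThetaOp}
    (hL : ∀ i, (L.coeff i).natDegree ≤ n) {κ : ℂ} {T Φ : ℂ → ℂ} (hκ : κ ≠ 0)
    (h : SymmetricPair n L κ T Φ) {z : ℂ} (hz : 0 < z.im) (hr : IsRegularPoint T z) :
    (thetaCoeff L 0).eval (T z) = (thetaCoeff L n).eval (T z) * Φ z * (T z / deriv T z) ^ n *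
      iteratedDeriv n (fun y => (Φ y)⁻¹) z := by
  have hΦ := h.holo z hz
  have hΦ0 := (h.ne_zero hκ hz hr).1
  have hinv : AnalyticAt ℂ (fun y => (Φ y)⁻¹) z := hΦ.inv hΦ0
  rw [← (h.twists z hz hr).opAlong_mul hL hr hΦ hinv, ← opAlong_one hL T z]
  refine opAlong_congr .rfl ?_
  filter_upwards [hΦ.continuousAt.eventually_ne hΦ0] with y hy
  rw [mul_inv_cancel₀ hy]

/-! ### The exponents at a zero of the modular form -/

/-- The local computation showing that `Φ` cannot vanish at a place (a point of the upper half
plane or a cusp, given by the filter `l`): by the Wronskian identity, the pole of `1/Φ` would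
produce a pole of `c₀`, or prevent `c₀ / c_n` from vanishing at infinity. The function `u` is a
local coordinate at an interior point, and `1` at a cusp. -/
lemma false_of_tendsto_zero {n : ℕ} (hn : 1 ≤ n) {p a : ℂ[X]} {l : Filter ℂ} [l.NeBot]
    {T w Φ D u : ℂ → ℂ} {κ κ' ρ b : ℂ} (hκ : κ ≠ 0) (hκ' : κ' ≠ 0)
    (hw : ∀ᶠ z in l, w z ≠ 0)
    (hW : ∀ᶠ z in l, Φ z ^ 2 * a.eval (T z) * w z ^ (n - 1) = κ)
    (hI : ∀ᶠ z in l, p.eval (T z) = a.eval (T z) * Φ z * w z ^ n * D z)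
    (hΦ : Tendsto Φ l (𝓝 0)) (hu : Tendsto u l (𝓝 b))
    (hK : Tendsto (fun z => Φ z * D z * u z ^ n) l (𝓝 κ'))
    (hρ : Tendsto (fun z => u z / w z) l (𝓝 ρ))
    (hT : (∃ d, Tendsto T l (𝓝 d)) ∨ Tendsto T l (Bornology.cobounded ℂ))
    (hZ : Tendsto (fun x => p.eval x / a.eval x) (Bornology.cobounded ℂ) (𝓝 0)) : False := by
  obtain ⟨n, rfl⟩ : ∃ m, n = m + 1 := ⟨n - 1, by omega⟩
  -- at a finite value of `T` the product of the two identities shows `κ κ' = 0`; at infinity the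
  -- identity `hI` shows `κ' = 0`
  rcases hT with ⟨d, hd⟩ | hT
  · have h1 : Tendsto (fun z => p.eval (T z) * Φ z ^ 2 * u z ^ n * (u z / w z)) l
        (𝓝 (p.eval d * 0 ^ 2 * b ^ n * ρ)) :=
      ((((p.continuous.tendsto d).comp hd).mul (hΦ.pow 2)).mul (hu.pow n)).mul hρ
    have h2 := hK.const_mul κ
    have h3 := tendsto_nhds_unique (h1.congr' ?_) h2
    · simp [hκ, hκ'] at h3
    · filter_upwards [hw, hW, hI] with z k1 k2 k3
      rw [k3, ← k2]
      simp only [Nat.add_sub_cancel]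
      field_simp
      ring
  · have h1 := (hZ.comp hT).mul (hρ.pow (n + 1))
    have h3 := tendsto_nhds_unique (h1.congr' ?_) hK
    · simp at h3
      exact hκ' h3.symm
    · filter_upwards [hw, hW, hI] with z k1 k2 k3
      have ha : a.eval (T z) ≠ 0 := by
        intro h0
        rw [h0] at k2
        simp at k2
        exact hκ k2.symm
      have hwn : w z ^ (n + 1) ≠ 0 := pow_ne_zero _ k1
      simp only [Function.comp, k3]
      rw [div_pow]
      generalize w z ^ (n + 1) = W at hwn
      field_simp

/-- The `j`-th derivative of `(z - z₁) ^ k B(z)`: the leading coefficient is multiplied by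
`k (k - 1) ⋯ (k - j + 1)`. -/
lemma iteratedDeriv_zpow_mul {z₁ : ℂ} {B : ℂ → ℂ} (hB : AnalyticAt ℂ B z₁) (k : ℤ) (j : ℕ) :
    ∃ D : ℂ → ℂ, AnalyticAt ℂ D z₁ ∧ D z₁ = (∏ i ∈ Finset.range j, ((k : ℂ) - i)) * B z₁ ∧
      ∀ᶠ z in 𝓝[≠] z₁, iteratedDeriv j (fun y => (y - z₁) ^ k * B y) z =
        (z - z₁) ^ (k - j) * D z := by
  induction j with
  | zero => exact ⟨B, hB, by simp, by simp⟩
  | succ j ih =>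
    obtain ⟨D, hD, hD1, h⟩ := ih
    refine ⟨fun z => ((k : ℂ) - j) * D z + (z - z₁) * deriv D z, ?_, ?_, ?_⟩
    · have := hD.deriv
      fun_prop
    · simp only [hD1, Finset.prod_range_succ]
      ring
    · have h' : ∀ᶠ z in 𝓝[≠] z₁, ∀ᶠ y in 𝓝 z, iteratedDeriv j (fun y => (y - z₁) ^ k * B y) y =
          (y - z₁) ^ (k - j) * D y := by
        have := eventually_eventually_nhdsWithin.2 h
        filter_upwards [this, self_mem_nhdsWithin] with z hz hne
        rwa [IsOpen.nhdsWithin_eq isOpen_compl_singleton hne] at hz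
      filter_upwards [h', self_mem_nhdsWithin,
        hD.eventually_analyticAt.filter_mono nhdsWithin_le_nhds] with z h1 hne h2
      have hz0 : z - z₁ ≠ 0 := sub_ne_zero.2 hne
      rw [iteratedDeriv_succ, Filter.EventuallyEq.deriv_eq h1]
      have d1 : HasDerivAt (fun y => (y - z₁) ^ (k - j))
          (((k - j : ℤ) : ℂ) * (z - z₁) ^ (k - j - 1)) z := by
        have := (hasDerivAt_zpow (k - j) (z - z₁) (Or.inl hz0)).comp z
          ((hasDerivAt_id z).sub_const z₁)
        simpa [Function.comp_def] using this
      refine (d1.mul h2.differentiableAt.hasDerivAt).deriv.trans ?_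
      have e1 : k - ((j + 1 : ℕ) : ℤ) = k - j - 1 := by
        push_cast
        ring
      have e2 : (z - z₁) ^ (k - j) = (z - z₁) ^ (k - j - 1) * (z - z₁) := by
        rw [← zpow_add_one₀ hz0]
        ring_nf
      rw [e1, e2]
      push_cast
      ring

/-- A rational function of nonpositive degree has a limit at infinity. -/
lemma tendsto_eval_div_eval {p a : ℂ[X]} (hpa : p.natDegree ≤ a.natDegree) (ha : a ≠ 0) :
    Tendsto (fun x => p.eval x / a.eval x) (Bornology.cobounded ℂ)
      (𝓝 (p.coeff a.natDegree / a.leadingCoeff)) := by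
  have key : ∀ q : ℂ[X], q.natDegree ≤ a.natDegree →
      Tendsto (fun x => q.eval x * x⁻¹ ^ a.natDegree) (Bornology.cobounded ℂ)
        (𝓝 (q.coeff a.natDegree)) := by
    intro q hq
    have h1 : Tendsto (fun x : ℂ => ∑ i ∈ Finset.range (a.natDegree + 1),
        q.coeff i * x⁻¹ ^ (a.natDegree - i)) (Bornology.cobounded ℂ)
        (𝓝 (∑ i ∈ Finset.range (a.natDegree + 1), q.coeff i * 0 ^ (a.natDegree - i))) :=
      tendsto_finsetSum _ fun i _ => (tendsto_inv₀_cobounded.pow _).const_mul _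
    rw [Finset.sum_range_succ, Finset.sum_eq_zero] at h1
    · simp only [Nat.sub_self, pow_zero, mul_one, zero_add] at h1
      refine h1.congr' ?_
      filter_upwards [Bornology.eventually_ne_cobounded (0 : ℂ)] with x hx
      rw [eval_eq_sum_range' (Nat.lt_succ_of_le hq), Finset.sum_mul]
      refine Finset.sum_congr rfl fun i hi => ?_
      have : a.natDegree = i + (a.natDegree - i) := by
        have := Finset.mem_range.1 hi
        omega
      have hx1 : x ^ i * x⁻¹ ^ i = 1 := by rw [← mul_pow, mul_inv_cancel₀ hx, one_pow]
      conv_rhs => rw [this, pow_add]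
      linear_combination -q.coeff i * x⁻¹ ^ (a.natDegree - i) * hx1
    · intro i hi
      have := Finset.mem_range.1 hi
      rw [zero_pow (by omega), mul_zero]
  have h := (key p hpa).div (key a le_rfl) (leadingCoeff_ne_zero.2 ha)
  refine h.congr' ?_
  filter_upwards [Bornology.eventually_ne_cobounded (0 : ℂ)] with x hx
  simp only [Pi.div_apply]
  rw [mul_div_mul_right _ _ (pow_ne_zero _ (inv_ne_zero hx))]

section

variable {n : ℕ} {L : ThetaOp} {κ : ℂ} {T Φ : ℂ → ℂ}

lemma SymmetricPair.order_ne_top (h : SymmetricPair n L κ T Φ) {z : ℂ} (hz : 0 < z.im) :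
    meromorphicOrderAt T z ≠ ⊤ := by
  rw [meromorphicOrderAt_ne_top_iff_eventually_ne_zero (h.mero z hz)]
  filter_upwards [h.regular z hz] with y hy using hy.ne_zero

lemma tendsto_div_deriv_zero {z : ℂ} (hT : MeromorphicAt T z) (h0 : meromorphicOrderAt T z ≠ 0)
    (h1 : meromorphicOrderAt T z ≠ ⊤) :
    Tendsto (fun y => T y / deriv T y) (𝓝[≠] z) (𝓝 0) := by
  have h2 : meromorphicOrderAt (logDeriv T) z < 0 := by
    rw [meromorphicOrderAt_logDeriv_eq_neg_one hT h0 h1]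
    exact WithTop.coe_lt_coe.2 (by norm_num : (-1 : ℤ) < 0)
  refine (tendsto_inv₀_cobounded.comp (tendsto_cobounded_of_meromorphicOrderAt_neg h2)).congr
    fun y => ?_
  simp [logDeriv]

/-- `T` has no zeros in the upper half plane. -/
lemma SymmetricPair.order_nonpos (hn : 2 ≤ n) (hκ : κ ≠ 0) (h : SymmetricPair n L κ T Φ) {z : ℂ}
    (hz : 0 < z.im) : meromorphicOrderAt T z ≤ 0 := by
  by_contra hpos
  rw [not_le] at hpos
  have h1 := tendsto_div_deriv_zero (h.mero z hz) hpos.ne' (h.order_ne_top hz)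
  have h2 := tendsto_zero_of_meromorphicOrderAt_pos hpos
  have h3 := (((h.holo z hz).continuousAt.tendsto.mono_left nhdsWithin_le_nhds).pow 2).mul
    (((thetaCoeff L n).continuous.tendsto 0).comp h2) |>.mul (h1.pow (n - 1))
  rw [zero_pow (by omega), mul_zero] at h3
  have h4 : Tendsto (fun _ : ℂ => κ) (𝓝[≠] z) (𝓝 0) := by
    refine h3.congr' ?_
    filter_upwards [h.regular z hz, (eventually_im_gt hz).filter_mono nhdsWithin_le_nhds]
      with y k1 k2
    exact h.wronskian y k2 k1
  exact hκ (tendsto_nhds_unique tendsto_const_nhds h4)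

/-- If `Φ` does not vanish at some pole of `T`, then `c₀ / c_n` vanishes at infinity: `0` is a
local exponent of `L` there. -/
lemma SymmetricPair.tendsto_of_pole (hn : 2 ≤ n) (hL : ∀ i, (L.coeff i).natDegree ≤ n)
    (hdeg : (thetaCoeff L 0).natDegree ≤ (thetaCoeff L n).natDegree)
    (hκ : κ ≠ 0) (h : SymmetricPair n L κ T Φ) {z : ℂ} (hz : 0 < z.im)
    (hpole : meromorphicOrderAt T z < 0) (hΦ : Φ z ≠ 0) :
    Tendsto (fun x => (thetaCoeff L 0).eval x / (thetaCoeff L n).eval x) (Bornology.cobounded ℂ)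
      (𝓝 0) := by
  have h1 := tendsto_div_deriv_zero (h.mero z hz) hpole.ne (h.order_ne_top hz)
  have hev : ∀ᶠ y in 𝓝[≠] z, IsRegularPoint T y ∧ 0 < y.im :=
    (h.regular z hz).and ((eventually_im_gt hz).filter_mono nhdsWithin_le_nhds)
  have ha : thetaCoeff L n ≠ 0 := by
    intro h0
    obtain ⟨y, hy⟩ := hev.exists
    have := (h.ne_zero hκ hy.2 hy.1).2
    simp [h0] at this
  have h2 := tendsto_eval_div_eval hdeg ha
  have hT := tendsto_cobounded_of_meromorphicOrderAt_neg hpole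
  have hΦa := h.holo z hz
  have hD : ContinuousAt (iteratedDeriv n fun y => (Φ y)⁻¹) z :=
    (analyticAt_iteratedDeriv (hΦa.inv hΦ) n).continuousAt
  have h3 := ((hΦa.continuousAt.tendsto.mono_left nhdsWithin_le_nhds).mul (h1.pow n)).mul
    (hD.tendsto.mono_left nhdsWithin_le_nhds)
  rw [zero_pow (by omega), mul_zero, zero_mul] at h3
  have h4 := tendsto_nhds_unique (h3.congr' ?_) (h2.comp hT)
  · rwa [← h4] at h2
  · filter_upwards [hev] with y hy
    have hne := (h.ne_zero hκ hy.2 hy.1).2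
    rw [Function.comp, h.thetaCoeff_zero_eval hL hκ hy.2 hy.1]
    field_simp

/-- If `c₀ / c_n` vanishes at infinity, then `Φ` has no zeros in the upper half plane. -/
lemma SymmetricPair.ne_zero_of_tendsto (hn : 2 ≤ n) (hL : ∀ i, (L.coeff i).natDegree ≤ n)
    (hκ : κ ≠ 0) (h : SymmetricPair n L κ T Φ)
    (hZ : Tendsto (fun x => (thetaCoeff L 0).eval x / (thetaCoeff L n).eval x)
      (Bornology.cobounded ℂ) (𝓝 0)) {z : ℂ} (hz : 0 < z.im) : Φ z ≠ 0 := by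
  intro hΦ0
  have hΦa := h.holo z hz
  have hev : ∀ᶠ y in 𝓝[≠] z, IsRegularPoint T y ∧ 0 < y.im :=
    (h.regular z hz).and ((eventually_im_gt hz).filter_mono nhdsWithin_le_nhds)
  have hord : analyticOrderAt Φ z ≠ ⊤ := by
    rw [Ne, analyticOrderAt_eq_top]
    intro h0
    obtain ⟨y, hy, hy0⟩ := (hev.and (h0.filter_mono nhdsWithin_le_nhds)).exists
    exact (h.ne_zero hκ hy.2 hy.1).1 hy0
  obtain ⟨m, hm⟩ := WithTop.ne_top_iff_exists.1 hord
  obtain ⟨B, hB, hB0, hB'⟩ := (hΦa.analyticOrderAt_eq_natCast (n := m)).1 hm.symm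
  have hm0 : m ≠ 0 := by
    rintro rfl
    have := hB'.self_of_nhds
    simp [hΦ0] at this
    exact hB0 this.symm
  obtain ⟨D, hD, hD0, hDe⟩ := iteratedDeriv_zpow_mul (hB.inv hB0) (-(m : ℤ)) n
  have hDe' : ∀ᶠ y in 𝓝[≠] z, iteratedDeriv n (fun y => (Φ y)⁻¹) y =
      (y - z) ^ (-(m : ℤ) - n) * D y := by
    have h1 := eventually_eventually_nhds.2 hB'
    filter_upwards [hDe, h1.filter_mono nhdsWithin_le_nhds] with y k1 k2
    rw [← k1]
    refine Filter.EventuallyEq.iteratedDeriv_eq n ?_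
    filter_upwards [k2] with x hx
    rw [hx, smul_eq_mul, mul_inv, zpow_neg, zpow_natCast, Pi.inv_apply]
  have hid : Tendsto (fun y : ℂ => y - z) (𝓝[≠] z) (𝓝 0) := by
    have : ContinuousAt (fun y : ℂ => y - z) z := by fun_prop
    simpa using this.tendsto.mono_left nhdsWithin_le_nhds
  have hlog : 0 ≤ meromorphicOrderAt (fun y => (y - z) * logDeriv T y) z := by
    have hm1 : MeromorphicAt (fun y : ℂ => y - z) z := by fun_prop
    have hm2 : MeromorphicAt (logDeriv T) z := (h.mero z hz).logDeriv
    have e : meromorphicOrderAt (fun y : ℂ => y - z) z = 1 := by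
      simp
    have h1 := meromorphicOrderAt_mul hm1 hm2
    change meromorphicOrderAt (fun y => (y - z) * logDeriv T y) z = _ at h1
    rw [h1, e]
    by_cases h0 : meromorphicOrderAt T z = 0
    · exact add_nonneg zero_le_one (meromorphicOrderAt_logDeriv_nonneg (h.mero z hz) h0)
    · rw [meromorphicOrderAt_logDeriv_eq_neg_one (h.mero z hz) h0 (h.order_ne_top hz)]
      exact le_of_eq (by rfl)
  have hmlog : MeromorphicAt (fun y => (y - z) * logDeriv T y) z :=
    MeromorphicAt.mul (by fun_prop) (h.mero z hz).logDeriv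
  obtain ⟨ρ, hρ⟩ := tendsto_nhds_of_meromorphicOrderAt_nonneg hmlog hlog
  have hcont : Tendsto (fun y => B y * D y) (𝓝[≠] z) (𝓝 (B z * D z)) :=
    (hB.continuousAt.mul hD.continuousAt).tendsto.mono_left nhdsWithin_le_nhds
  refine false_of_tendsto_zero (l := 𝓝[≠] z) (n := n) (T := T) (Φ := Φ)
    (w := fun y => T y / deriv T y)
    (D := iteratedDeriv n fun y => (Φ y)⁻¹) (u := fun y => y - z) (by omega) hκ
    (κ' := B z * D z) ?_ ?_ ?_ ?_ ?_ hid ?_ (ρ := ρ) ?_ ?_ hZ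
  · rw [hD0, Pi.inv_apply]
    refine mul_ne_zero hB0 (mul_ne_zero (Finset.prod_ne_zero_iff.2 fun i _ => ?_)
      (inv_ne_zero hB0))
    have : ((m : ℂ) + i) ≠ 0 := by exact_mod_cast (by omega : m + i ≠ 0)
    intro h0
    apply this
    push_cast at h0
    linear_combination -h0
  · filter_upwards [hev] with y hy using hy.1.div_ne_zero
  · filter_upwards [hev] with y hy using h.wronskian y hy.2 hy.1
  · filter_upwards [hev] with y hy using h.thetaCoeff_zero_eval hL hκ hy.2 hy.1
  · have := hΦa.continuousAt.tendsto.mono_left (nhdsWithin_le_nhds (s := {z}ᶜ))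
    rwa [hΦ0] at this
  · refine hcont.congr' ?_
    filter_upwards [hDe', hB'.filter_mono nhdsWithin_le_nhds, self_mem_nhdsWithin] with y k1 k2 k3
    have hy : y - z ≠ 0 := sub_ne_zero.2 k3
    have e : (y - z) ^ m * (y - z) ^ (-(m : ℤ) - n) * (y - z) ^ n = 1 := by
      have e0 : (m : ℤ) + (-(m : ℤ) - n) + n = 0 := by ring
      rw [← zpow_natCast, ← zpow_natCast, ← zpow_add₀ hy, ← zpow_add₀ hy, e0, zpow_zero]
    rw [k1, k2, smul_eq_mul]
    linear_combination -B y * D y * e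
  · refine hρ.congr fun y => ?_
    simp only [logDeriv, Pi.div_apply]
    rw [div_div_eq_mul_div, mul_div_assoc]
  · rcases lt_or_ge (meromorphicOrderAt T z) 0 with hlt | hge
    · exact Or.inr (tendsto_cobounded_of_meromorphicOrderAt_neg hlt)
    · exact Or.inl (tendsto_nhds_of_meromorphicOrderAt_nonneg (h.mero z hz) hge)

end

/-! ### The symmetric pairs of a modular parametrization -/

lemma eventually_regular_of_meromorphicOn {T : ℂ → ℂ} (hT : MeromorphicOn T {z | 0 < z.im})
    (hr : ∀ᶠ z in comap Complex.im atTop, IsRegularPoint T z) {z : ℂ} (hz : 0 < z.im) :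
    ∀ᶠ y in 𝓝[≠] z, IsRegularPoint T y := by
  obtain ⟨z₁, hr₁, hz₁⟩ := ((eventually_nhds_of_comap_im hr).and eventually_im_pos).exists
  have h1 := eventually_ne_zero_of_meromorphicOn hT hz₁ (hr₁.mono fun y hy => hy.ne_zero) hz
  have h2 := eventually_ne_zero_of_meromorphicOn (f := deriv T) (fun y hy => (hT y hy).deriv) hz₁
    (hr₁.mono fun y hy => hy.deriv_ne_zero) hz
  filter_upwards [h1, h2, (hT z hz).eventually_analyticAt] with y k1 k2 k3
  exact ⟨k3, k1, k2⟩

lemma IsRegularPoint.analyticAt_opAlong {n : ℕ} {L : ThetaOp} {T f : ℂ → ℂ} {z : ℂ}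
    (hL : ∀ i, (L.coeff i).natDegree ≤ n) (h : IsRegularPoint T z) (hf : AnalyticAt ℂ f z) :
    AnalyticAt ℂ (opAlong L T f) z := by
  have e : opAlong L T f = fun y =>
      ∑ j ∈ Finset.range (n + 1), (thetaCoeff L j).eval (T y) * (thetaAlong T)^[j] f y := by
    ext y
    exact opAlong_eq_sum hL T f y
  rw [e]
  refine Finset.analyticAt_fun_sum _ fun j _ => AnalyticAt.mul ?_ (h.analyticAt_iterate hf j)
  exact (analyticAt_eval _ _).fun_comp h.analyticAt

/-- The identity theorem for meromorphic functions on the upper half plane, at a point where the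
function is analytic. -/
lemma eq_zero_of_meromorphicOn {f : ℂ → ℂ} (hf : MeromorphicOn f {z | 0 < z.im})
    (h : ∀ᶠ z in comap Complex.im atTop, f z = 0) {z : ℂ} (hz : 0 < z.im)
    (ha : AnalyticAt ℂ f z) : f z = 0 := by
  obtain ⟨z₁, h₁, hz₁⟩ := ((eventually_nhds_of_comap_im h).and eventually_im_pos).exists
  exact (ha.frequently_zero_iff_eventually_zero.1
    (eventually_eq_zero_of_meromorphicOn hf hz₁ h₁ hz).frequently).self_of_nhds

lemma eq_const_of_deriv_eq_zero {f : ℂ → ℂ} {κ : ℂ}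
    (hf : ∀ᶠ z in comap Complex.im atTop, AnalyticAt ℂ f z ∧ deriv f z = 0)
    (hκ : Tendsto f (comap Complex.im atTop) (𝓝 κ)) :
    ∀ᶠ z in comap Complex.im atTop, f z = κ := by
  obtain ⟨A, hA0, hA⟩ := exists_of_comap_im hf
  set z₁ : ℂ := ((A + 1 : ℝ) : ℂ) * Complex.I with hz₁
  have hlt : ∀ᶠ z : ℂ in comap Complex.im atTop, A < z.im :=
    tendsto_comap.eventually (eventually_gt_atTop A)
  have hc : ∀ᶠ z in comap Complex.im atTop, f z = f z₁ := by
    filter_upwards [hlt] with z hz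
    refine (isOpen_im_gt A).is_const_of_deriv_eq_zero (convex_halfSpace_im_gt A).isPreconnected
      (fun y hy => (hA y hy).1.differentiableAt.differentiableWithinAt)
      (fun y hy => (hA y hy).2) hz ?_
    simp [hz₁]
  have : κ = f z₁ :=
    tendsto_nhds_unique hκ (tendsto_const_nhds.congr' (hc.mono fun z hz => hz.symm))
  rwa [this]

lemma thetaCoeff_coeff (L : ThetaOp) (i j : ℕ) :
    (thetaCoeff L j).coeff i = (L.coeff i).coeff j := by
  rw [thetaCoeff, Polynomial.sum_def, finsetSum_coeff]
  simp only [coeff_monomial]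
  rw [Finset.sum_ite_eq']
  split_ifs with h
  · rfl
  · rw [notMem_support_iff.1 h, coeff_zero]

lemma thetaCoeff_eval_zero {n : ℕ} {L : ThetaOp} (h0 : L.coeff 0 = X ^ n) :
    (thetaCoeff L n).eval 0 = 1 := by
  rw [← coeff_zero_eq_eval_zero, thetaCoeff_coeff, h0, coeff_X_pow_self]

section

variable {n : ℕ} {Γ : Subgroup SL(2, ℝ)} {χ : Γ →* ℤˣ} {L : ThetaOp} {h : ℕ → ℂ → ℂ} {t F : ℍ → ℂ}

lemma IsModularParametrization.isModularForm (hn : 2 ≤ n)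
    (hmod : IsModularParametrization Γ χ n h t F) : IsModularForm Γ χ ((n - 1 : ℕ) : ℤ) F := by
  have : ((n - 1 : ℕ) : ℤ) = (n : ℤ) - 1 := by omega
  rw [this]
  exact hmod.modular

lemma IsModularParametrization.eventually_isRegularPoint (hn : 2 ≤ n) (hL : IsCalabiYauOp n L h)
    (hmod : IsModularParametrization Γ χ n h t F) :
    ∀ᶠ z in comap Complex.im atTop, IsRegularPoint (t ∘ ofComplex) z :=
  (VirtualYukawa.eventually_isRegularPoint (hL.frobenius.analytic 0 (by omega))
    (hL.frobenius.analytic 1 (by omega)) hL.frobenius.h_zero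
    (hL.frobenius.h_pos 1 (by omega) one_pos) hmod.tendsto hmod.mirror).1

lemma IsModularParametrization.tendsto_div_deriv (hn : 2 ≤ n) (hL : IsCalabiYauOp n L h)
    (hmod : IsModularParametrization Γ χ n h t F) :
    Tendsto (fun z => (t ∘ ofComplex) z / deriv (t ∘ ofComplex) z) (comap Complex.im atTop)
      (𝓝 (2 * Real.pi * Complex.I : ℂ)⁻¹) :=
  (VirtualYukawa.eventually_isRegularPoint (hL.frobenius.analytic 0 (by omega))
    (hL.frobenius.analytic 1 (by omega)) hL.frobenius.h_zero
    (hL.frobenius.h_pos 1 (by omega) one_pos) hmod.tendsto hmod.mirror).2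

/-- Along the mirror map near `i∞`, `L` acts on functions of `log t` as it does near `t = 0`. -/
lemma IsModularParametrization.opAlong_comp_logAlong (hn : 2 ≤ n) (hL : IsCalabiYauOp n L h)
    (hmod : IsModularParametrization Γ χ n h t F) {f : ℂ → ℂ}
    (hf : ∀ᶠ s in nearZero, AnalyticAt ℂ f s) :
    ∀ᶠ z in comap Complex.im atTop,
      opAlong L (t ∘ ofComplex) (f ∘ logAlong h t) z = applyOp L f (logAlong h t z) := by
  obtain ⟨h1, h2, h3⟩ := eventually_logAlong (hL.frobenius.analytic 0 (by omega))
    (hL.frobenius.analytic 1 (by omega)) hL.frobenius.h_zero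
    (hL.frobenius.h_pos 1 (by omega) one_pos) hmod.tendsto hmod.mirror
  filter_upwards [h1, eventually_nhds_of_comap_im h2, h3.eventually hf] with z k1 k2 k3
  exact VirtualYukawa.opAlong_comp_logAlong k1.1 k1.2 k2 k3

/-- The modular form is `ω₀(log t)` near `i∞`. -/
lemma IsModularParametrization.eventually_period (hn : 2 ≤ n) (hL : IsCalabiYauOp n L h)
    (hmod : IsModularParametrization Γ χ n h t F) :
    ∀ᶠ z in comap Complex.im atTop, (F ∘ ofComplex) z = (omega h 0 ∘ logAlong h t) z := by
  obtain ⟨h1, h2, h3⟩ := eventually_logAlong (hL.frobenius.analytic 0 (by omega))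
    (hL.frobenius.analytic 1 (by omega)) hL.frobenius.h_zero
    (hL.frobenius.h_pos 1 (by omega) one_pos) hmod.tendsto hmod.mirror
  filter_upwards [h2, eventually_comap_im_of_atImInfty hmod.period] with z k1 k2
  simp only [Function.comp] at k1 k2 ⊢
  rw [k2, omega]
  simp [k1]

/-- The equation `L ω₀ = 0`, continued to the upper half plane. -/
lemma IsModularParametrization.opAlong_eq_zero (hn : 2 ≤ n) (hL : IsCalabiYauOp n L h)
    (hmod : IsModularParametrization Γ χ n h t F) {z : ℂ} (hz : 0 < z.im)
    (hr : IsRegularPoint (t ∘ ofComplex) z) :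
    opAlong L (t ∘ ofComplex) (F ∘ ofComplex) z = 0 := by
  have hF := hmod.modular.holo
  refine eq_zero_of_meromorphicOn (fun y hy => ?_) ?_ hz
    (hr.analyticAt_opAlong hL.order_le (analyticAt_comp_ofComplex hF hz))
  · exact meromorphicAt_opAlong (hmod.hauptmodul.modular.mero y hy)
      (analyticAt_comp_ofComplex hF hy).meromorphicAt
  · obtain ⟨h1, h2, h3⟩ := eventually_logAlong (hL.frobenius.analytic 0 (by omega))
      (hL.frobenius.analytic 1 (by omega)) hL.frobenius.h_zero
      (hL.frobenius.h_pos 1 (by omega) one_pos) hmod.tendsto hmod.mirror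
    have ho : ∀ᶠ s in nearZero, AnalyticAt ℂ (omega h 0) s :=
      analyticAt_omega fun j hj => hL.frobenius.analytic j (by omega)
    filter_upwards [hmod.opAlong_comp_logAlong hn hL ho,
      eventually_nhds_of_comap_im (hmod.eventually_period hn hL),
      h3.eventually (hL.frobenius.solution 0 (by omega))] with z k1 k2 k3
    rw [opAlong_congr .rfl k2, k1, k3]

/-- The parametrization itself is a symmetric pair. -/
lemma IsModularParametrization.symmetricPair (hn : 2 ≤ n) (hΓ : (toGL Γ).IsArithmetic)
    (hL : IsCalabiYauOp n L h) (hmod : IsModularParametrization Γ χ n h t F) :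
    SymmetricPair n L ((2 * Real.pi * Complex.I : ℂ)⁻¹ ^ (n - 1)) (t ∘ ofComplex)
      (F ∘ ofComplex) := by
  have hF := hmod.isModularForm hn
  have hm := hmod.hauptmodul.modular
  have htw : ∀ z : ℂ, 0 < z.im → IsRegularPoint (t ∘ ofComplex) z →
      AnnihilatesTwists n L (t ∘ ofComplex) (F ∘ ofComplex) z := by
    intro z hz hr
    have := annihilatesTwists_of_modular hΓ hm.invariant hF
      (fun y hy hry => hmod.opAlong_eq_zero hn hL hy hry) hz hr
    rwa [Nat.sub_add_cancel (by omega)] at this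
  have hfa : ∀ z : ℂ, 0 < z.im → AnalyticAt ℂ (F ∘ ofComplex) z := fun z hz =>
    analyticAt_comp_ofComplex hF.holo hz
  refine ⟨hm.mero, hfa, fun z hz =>
    eventually_regular_of_meromorphicOn hm.mero (hmod.eventually_isRegularPoint hn hL) hz, htw,
    fun z hz hr => ?_⟩
  -- the Wronskian expression is constant near `i∞`, with the value of its limit, hence everywhere
  set W : ℂ → ℂ := fun z => (F ∘ ofComplex) z ^ 2 * (thetaCoeff L n).eval ((t ∘ ofComplex) z) *
    ((t ∘ ofComplex) z / deriv (t ∘ ofComplex) z) ^ (n - 1) with hW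
  have hWa : ∀ y : ℂ, 0 < y.im → IsRegularPoint (t ∘ ofComplex) y → AnalyticAt ℂ W y := by
    intro y hy hry
    exact (((hfa y hy).pow 2).mul ((analyticAt_eval _ _).fun_comp hry.analyticAt)).mul
      (hry.analyticAt_div.pow _)
  have hT0 : Tendsto (t ∘ ofComplex) (comap Complex.im atTop) (𝓝 0) := by
    intro s hs
    exact eventually_comap_im_of_atImInfty (hmod.tendsto hs)
  have hlim : Tendsto W (comap Complex.im atTop)
      (𝓝 ((2 * Real.pi * Complex.I : ℂ)⁻¹ ^ (n - 1))) := by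
    have h1 : Tendsto (F ∘ ofComplex) (comap Complex.im atTop) (𝓝 1) := by
      have a0 : ContinuousAt (h 0) 0 := (hL.frobenius.analytic 0 (by omega)).continuousAt
      have := a0.tendsto.comp hT0
      rw [hL.frobenius.h_zero] at this
      refine this.congr' ?_
      filter_upwards [eventually_comap_im_of_atImInfty hmod.period] with z hz
      exact hz.symm
    have h2 := ((h1.pow 2).mul (((thetaCoeff L n).continuous.tendsto 0).comp hT0)).mul
      ((hmod.tendsto_div_deriv hn hL).pow (n - 1))
    rw [thetaCoeff_eval_zero hL.mum, one_pow, one_mul, one_mul] at h2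
    exact h2
  have hconst := eq_const_of_deriv_eq_zero (f := W) ?_ hlim
  · have hme : MeromorphicOn (fun y => W y - (2 * Real.pi * Complex.I : ℂ)⁻¹ ^ (n - 1))
        {z | 0 < z.im} := by
      intro y hy
      have m1 := hm.mero y hy
      exact (((((hfa y hy).meromorphicAt.pow 2).mul (meromorphicAt_eval m1 _)).mul
        ((m1.div m1.deriv).pow _))).sub (MeromorphicAt.const _ _)
    exact sub_eq_zero.1 (eq_zero_of_meromorphicOn hme
      (hconst.mono fun y hy => sub_eq_zero.2 hy) hz ((hWa z hz hr).sub analyticAt_const))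
  · filter_upwards [hmod.eventually_isRegularPoint hn hL, eventually_im_pos] with y hy hy0
    exact ⟨hWa y hy0 hy,
      (htw y hy0 hy).deriv_eq_zero hn hL.order_le hL.selfAdjoint hy (hfa y hy0)⟩

lemma deriv_translate {g : SL(2, ℝ)} {z : ℂ} (hz : 0 < z.im)
    (hr : IsRegularPoint (t ∘ ofComplex) (moebius g z)) :
    deriv (translate t g) z = deriv (t ∘ ofComplex) (moebius g z) / autFactor g z ^ 2 := by
  rw [translate_eq_comp, deriv_comp _ hr.analyticAt.differentiableAt
    (analyticAt_moebius g hz).differentiableAt, deriv_moebius g hz, mul_one_div]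

/-- All translates of the parametrization are symmetric pairs, with the same constant. -/
lemma SymmetricPair.translate (hn : 2 ≤ n) {κ : ℂ} (hF : MDiff F)
    (hp : SymmetricPair n L κ (t ∘ ofComplex) (F ∘ ofComplex)) (g : SL(2, ℝ)) :
    SymmetricPair n L κ (translate t g) (slashAlong (n - 1) F g) where
  mero z hz := meromorphicAt_translate hp.mero g hz
  holo z hz := analyticAt_slashAlong hF _ g hz
  regular z hz := by
    have hM := analyticAt_moebius g hz
    have h1 : Tendsto (moebius g) (𝓝[≠] z) (𝓝[≠] (moebius g z)) := by
      refine tendsto_nhdsWithin_iff.2 ⟨hM.continuousAt.tendsto.mono_left nhdsWithin_le_nhds, ?_⟩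
      filter_upwards [self_mem_nhdsWithin, (eventually_im_gt hz).filter_mono nhdsWithin_le_nhds]
        with y hy hy0 h0
      have h0' : moebius g y = moebius g z := h0
      apply hy
      have := congrArg (moebius g⁻¹) h0'
      rwa [moebius_inv_moebius g hy0, moebius_inv_moebius g hz] at this
    filter_upwards [h1.eventually (hp.regular _ (moebius_im_pos g z)),
      (eventually_im_gt hz).filter_mono nhdsWithin_le_nhds] with y hy hy0
    exact (isRegularPoint_translate_iff hy0).2 hy
  twists z hz hr := by
    have := annihilatesTwists_translate (m := n - 1) (L := L) hF hz hr (by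
      rw [Nat.sub_add_cancel (by omega)]
      exact hp.twists _ (moebius_im_pos g z) ((isRegularPoint_translate_iff hz).1 hr))
    rwa [Nat.sub_add_cancel (by omega)] at this
  wronskian z hz hr := by
    have hr' := (isRegularPoint_translate_iff hz).1 hr
    have ha := autFactor_ne_zero g hz
    rw [← hp.wronskian _ (moebius_im_pos g z) hr', deriv_translate hz hr']
    have e1 : VirtualYukawa.translate t g z = (t ∘ ofComplex) (moebius g z) := by
      rw [translate_eq_comp, Function.comp]
    have e2 : slashAlong (n - 1) F g z =
        (autFactor g z ^ (n - 1))⁻¹ * (F ∘ ofComplex) (moebius g z) := by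
      simp [slashAlong, moebius]
    rw [e1, e2, div_div_eq_mul_div, mul_div_right_comm, mul_pow, mul_pow, ← pow_mul (autFactor g z),
      mul_comm 2 (n - 1), pow_mul]
    have ha' := pow_ne_zero (n - 1) ha
    field_simp

end

/-! ### Expansions at the cusps -/

/-- Removal of singularities, for a meromorphic function: the limits of `f` at the points form a
holomorphic function where `f` has no pole. -/
lemma analyticAt_limUnder {f : ℂ → ℂ} {z : ℂ} (hf : MeromorphicAt f z)
    (h0 : 0 ≤ meromorphicOrderAt f z) :
    AnalyticAt ℂ (fun y => limUnder (𝓝[≠] y) f) z ∧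
      ∀ᶠ y in 𝓝[≠] z, limUnder (𝓝[≠] y) f = f y := by
  obtain ⟨d, hd⟩ := tendsto_nhds_of_meromorphicOrderAt_nonneg hf h0
  have heq : ∀ᶠ y in 𝓝[≠] z, limUnder (𝓝[≠] y) f = f y := by
    filter_upwards [hf.eventually_analyticAt] with y hy
    exact (hy.continuousAt.tendsto.mono_left nhdsWithin_le_nhds).limUnder_eq
  refine ⟨Complex.analyticAt_of_differentiable_on_punctured_nhds_of_continuousAt ?_ ?_, heq⟩
  · filter_upwards [hf.eventually_analyticAt, eventually_eventually_nhdsWithin.2 heq,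
      self_mem_nhdsWithin] with y hy hy2 hy3
    rw [IsOpen.nhdsWithin_eq isOpen_compl_singleton hy3] at hy2
    exact hy.differentiableAt.congr_of_eventuallyEq hy2
  · rw [continuousAt_iff_punctured_nhds, hd.limUnder_eq]
    exact hd.congr' (heq.mono fun y hy => hy.symm)

/-- The function `f` has the expansion `q ^ k * G(q)`, `q = exp(c z)`, towards `i∞`, where
`G(0) ≠ 0`. The values of `f` at isolated points are immaterial. -/
structure HasQExpansion (f : ℂ → ℂ) (c : ℂ) (k : ℤ) (G : ℂ → ℂ) : Prop where
  analyticAt : AnalyticAt ℂ G 0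
  ne_zero : G 0 ≠ 0
  tendsto_exp : Tendsto (fun z => Complex.exp (c * z)) (comap Complex.im atTop) (𝓝[≠] 0)
  eventually_eq : ∀ᶠ z in comap Complex.im atTop, ∀ᶠ y in 𝓝[≠] z,
    f y = Complex.exp (k * c * y) * G (Complex.exp (c * y))

/-- A periodic meromorphic function of at most exponential growth towards `i∞` has a convergent
`q`-expansion with finite principal part. -/
lemma exists_qExpansion {f : ℂ → ℂ} {b r : ℝ} (hr : 0 < r) (hf : MeromorphicOn f {z | 0 < z.im})
    (hper : ∀ z : ℂ, 0 < z.im → f (z + r) = f z)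
    (hO : f =O[comap Complex.im atTop] fun z => Real.exp (b * z.im))
    (hne : ∀ z : ℂ, 0 < z.im → ∀ᶠ y in 𝓝[≠] z, f y ≠ 0) :
    ∃ (k : ℤ) (G : ℂ → ℂ), HasQExpansion f (2 * Real.pi * Complex.I / r) k G := by
  obtain ⟨C, hC⟩ := hO.bound
  obtain ⟨A, hA0, hA⟩ := exists_of_comap_im hC
  have hrC : (r : ℂ) ≠ 0 := by exact_mod_cast hr.ne'
  -- `q ^ m f` is bounded
  obtain ⟨m, hm⟩ := exists_nat_ge (b * r / (2 * Real.pi))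
  have hm' : b ≤ m * (2 * Real.pi / r) := by
    rw [div_le_iff₀ Real.two_pi_pos] at hm
    rw [← mul_div_assoc, le_div_iff₀ hr]
    exact hm
  set e : ℂ → ℂ := fun z => Complex.exp (m * (2 * Real.pi * Complex.I / r) * z) with he
  have hea : ∀ z, AnalyticAt ℂ e z := fun z => by
    rw [he]
    fun_prop
  have hnorm : ∀ z, ‖e z‖ = Real.exp (-(m * (2 * Real.pi / r) * z.im)) := by
    intro z
    have : (m * (2 * Real.pi * Complex.I / r) * z : ℂ) =
        ((m * (2 * Real.pi / r) : ℝ) : ℂ) * (Complex.I * z) := by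
      push_cast
      ring
    rw [he]
    simp only
    rw [this, Complex.norm_exp, Complex.re_ofReal_mul]
    simp
  have hbd : ∀ z : ℂ, A < z.im → ‖e z * f z‖ ≤ C := by
    intro z hz
    have hC0 : 0 ≤ C := by
      by_contra hneg
      have h1 := hA z hz
      have h2 : C * ‖Real.exp (b * z.im)‖ < 0 :=
        mul_neg_of_neg_of_pos (not_le.1 hneg) (norm_pos_iff.2 (Real.exp_pos _).ne')
      linarith [norm_nonneg (f z)]
    have h1 := hA z hz
    rw [Real.norm_of_nonneg (Real.exp_pos _).le] at h1
    rw [norm_mul, hnorm]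
    calc _ ≤ Real.exp (-(m * (2 * Real.pi / r) * z.im)) * (C * Real.exp (b * z.im)) := by gcongr
      _ = C * Real.exp ((b - m * (2 * Real.pi / r)) * z.im) := by
        rw [mul_left_comm, ← Real.exp_add]
        ring_nf
      _ ≤ C * 1 := by
        gcongr
        rw [Real.exp_le_one_iff]
        exact mul_nonpos_of_nonpos_of_nonneg (by linarith) (by linarith)
      _ = C := mul_one C
  have heper : ∀ z, e (z + r) = e z := by
    intro z
    have : (m * (2 * Real.pi * Complex.I / r) * (z + r) : ℂ) =
        m * (2 * Real.pi * Complex.I / r) * z + m * (2 * Real.pi * Complex.I) := by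
      field_simp
    rw [he]
    simp only
    rw [this, Complex.exp_periodic.nat_mul m]
  have hmero : ∀ z : ℂ, A < z.im → MeromorphicAt (fun y => e y * f y) z := fun z hz =>
    (hea z).meromorphicAt.mul (hf z (hA0.trans hz))
  classical
  -- the holomorphic function obtained from `e f` by removing the singularities
  set g : ℂ → ℂ := fun z => if A < z.im then limUnder (𝓝[≠] z) (fun y => e y * f y) else 0 with hg
  have h0 : ∀ z : ℂ, A < z.im → 0 ≤ meromorphicOrderAt (fun y => e y * f y) z := by
    intro z hz
    by_contra hlt
    have h1 := tendsto_cobounded_of_meromorphicOrderAt_neg (not_le.1 hlt)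
    have h2 : ∀ᶠ y in 𝓝[≠] z, ‖e y * f y‖ ≤ C := by
      filter_upwards [(eventually_im_gt hz).filter_mono nhdsWithin_le_nhds] with y hy
        using hbd y hy
    have h3 := (tendsto_norm_cobounded_atTop.comp h1).eventually_gt_atTop C
    obtain ⟨y, hy2, hy3⟩ := (h2.and h3).exists
    exact absurd hy2 (not_le.2 hy3)
  have hglim : ∀ z : ℂ, A < z.im → g z = limUnder (𝓝[≠] z) (fun y => e y * f y) := fun z hz =>
    if_pos hz
  have hgt : ∀ z : ℂ, A < z.im → Tendsto (fun y => e y * f y) (𝓝[≠] z) (𝓝 (g z)) := by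
    intro z hz
    obtain ⟨d, hd⟩ := tendsto_nhds_of_meromorphicOrderAt_nonneg (hmero z hz) (h0 z hz)
    rwa [hglim z hz, hd.limUnder_eq]
  have hgeq : ∀ z : ℂ, A < z.im → ∀ᶠ y in 𝓝[≠] z, g y = e y * f y := by
    intro z hz
    filter_upwards [(analyticAt_limUnder (hmero z hz) (h0 z hz)).2,
      (eventually_im_gt hz).filter_mono nhdsWithin_le_nhds] with y hy hyA
    rw [hglim y hyA, hy]
  have hga : ∀ z : ℂ, A < z.im → AnalyticAt ℂ g z := by
    intro z hz
    refine (analyticAt_limUnder (hmero z hz) (h0 z hz)).1.congr ?_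
    filter_upwards [eventually_im_gt hz] with y hy using (hglim y hy).symm
  have hgper : Function.Periodic g r := by
    intro z
    by_cases hz : A < z.im
    · have hz' : A < (z + r).im := by simpa using hz
      have hsh : Tendsto (fun y : ℂ => y + r) (𝓝[≠] z) (𝓝[≠] (z + r)) := by
        refine tendsto_nhdsWithin_iff.2 ⟨?_, ?_⟩
        · have : ContinuousAt (fun y : ℂ => y + r) z := by fun_prop
          exact this.tendsto.mono_left nhdsWithin_le_nhds
        · filter_upwards [self_mem_nhdsWithin] with y hy h0
          exact hy (add_right_cancel (h0 : y + r = z + r))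
      refine tendsto_nhds_unique (((hgt _ hz').comp hsh).congr' ?_) (hgt z hz)
      filter_upwards [(eventually_im_gt hz).filter_mono nhdsWithin_le_nhds] with y hy
      simp only [Function.comp]
      rw [heper, hper y (hA0.trans hy)]
    · have hz' : ¬ A < (z + r).im := by simpa using hz
      rw [hg]
      simp only [if_neg hz, if_neg hz']
  have hlt : ∀ᶠ z : ℂ in comap Complex.im atTop, A < z.im :=
    tendsto_comap.eventually (eventually_gt_atTop A)
  have hgd : ∀ᶠ z in comap Complex.im atTop, DifferentiableAt ℂ g z :=
    hlt.mono fun z hz => (hga z hz).differentiableAt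
  have hgb : BoundedAtFilter (comap Complex.im atTop) g := by
    refine Asymptotics.IsBigO.of_bound C ?_
    filter_upwards [hlt] with z hz
    simp only [Pi.one_apply, norm_one, mul_one]
    refine le_of_tendsto (hgt z hz).norm ?_
    filter_upwards [(eventually_im_gt hz).filter_mono nhdsWithin_le_nhds] with y hy using hbd y hy
  set Q : ℂ → ℂ := Function.Periodic.cuspFunction r g with hQ
  have hQa : AnalyticAt ℂ Q 0 := by
    rw [Complex.analyticAt_iff_eventually_differentiableAt]
    have h1 := Function.Periodic.eventually_differentiableAt_cuspFunction_nhds_ne_zero hr hgper hgd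
    have h2 := Function.Periodic.differentiableAt_cuspFunction_zero hr hgper hgd hgb
    rw [eventually_nhdsWithin_iff] at h1
    filter_upwards [h1] with y hy
    by_cases h0 : y = 0
    · rw [h0]
      exact h2
    · exact hy h0
  have hq : ∀ z : ℂ, Function.Periodic.qParam r z =
      Complex.exp (2 * Real.pi * Complex.I / r * z) := by
    intro z
    rw [Function.Periodic.qParam]
    congr 1
    ring
  have hQg : ∀ z : ℂ, Q (Complex.exp (2 * Real.pi * Complex.I / r * z)) = g z := by
    intro z
    rw [← hq]
    exact Function.Periodic.eq_cuspFunction hr.ne' hgper z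
  have hqt : Tendsto (fun z : ℂ => Complex.exp (2 * Real.pi * Complex.I / r * z))
      (comap Complex.im atTop) (𝓝[≠] 0) := by
    refine (Function.Periodic.qParam_tendsto hr).congr hq
  have hQ0 : ¬ ∀ᶠ q in 𝓝 0, Q q = 0 := by
    intro h0
    have h1 := hqt.eventually (h0.filter_mono nhdsWithin_le_nhds)
    obtain ⟨z, hz, hzA⟩ := ((eventually_nhds_of_comap_im h1).and hlt).exists
    obtain ⟨y, h2, h3, h4⟩ := ((hz.filter_mono nhdsWithin_le_nhds).and
      ((hgeq z hzA).and (hne z (hA0.trans hzA)))).exists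
    rw [hQg, h3] at h2
    exact mul_ne_zero (Complex.exp_ne_zero _) h4 h2
  obtain ⟨v, G, hG, hG0, hGe⟩ := hQa.exists_eventuallyEq_pow_smul_nonzero_iff.2 hQ0
  refine ⟨v - m, G, hG, hG0, hqt, ?_⟩
  filter_upwards [eventually_nhds_of_comap_im (hqt.eventually (hGe.filter_mono nhdsWithin_le_nhds)),
    hlt] with z hz hzA
  filter_upwards [hz.filter_mono nhdsWithin_le_nhds, hgeq z hzA] with y h1 h2
  rw [hQg, h2, sub_zero, smul_eq_mul, ← Complex.exp_nat_mul] at h1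
  have h3 : Complex.exp (((v - m : ℤ) : ℂ) * (2 * Real.pi * Complex.I / r) * y) * e y =
      Complex.exp (v * (2 * Real.pi * Complex.I / r * y)) := by
    rw [he]
    simp only
    rw [← Complex.exp_add]
    congr 1
    push_cast
    ring
  have h4 : e y ≠ 0 := Complex.exp_ne_zero _
  apply mul_left_cancel₀ h4
  rw [h1, ← h3]
  ring

/-- A cusp has a width: the translates by an element of `SL(2, ℤ)` are periodic. The width is
doubled to be insensitive to the character. -/
lemma exists_period {k : ℕ} {Γ : Subgroup SL(2, ℝ)} (hΓ : (toGL Γ).IsArithmetic) {χ : Γ →* ℤˣ}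
    {t F : ℍ → ℂ} (ht : ∀ γ ∈ Γ, ∀ τ : ℍ, t (γ • τ) = t τ) (hF : IsModularForm Γ χ k F)
    (g : SL(2, ℤ)) : ∃ r : ℝ, 0 < r ∧ ∀ z : ℂ, 0 < z.im →
      translate t (g.map (Int.castRingHom ℝ)) (z + r) =
        translate t (g.map (Int.castRingHom ℝ)) z ∧
      slashAlong k F (g.map (Int.castRingHom ℝ)) (z + r) =
        slashAlong k F (g.map (Int.castRingHom ℝ)) z := by
  obtain ⟨N, hN, hmem⟩ := exists_pow_mem_of_isArithmetic hΓ (g * ModularGroup.T * g⁻¹)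
  set G : SL(2, ℝ) := g.map (Int.castRingHom ℝ) with hG
  set U : SL(2, ℝ) := ModularGroup.T.map (Int.castRingHom ℝ) with hU
  set γ : Γ := ⟨_, hmem⟩ with hγ
  have hγG : ((γ ^ 2 : Γ) : SL(2, ℝ)) * G = G * U ^ (N * 2) := by
    have h1 : (γ : SL(2, ℝ)) = G * U ^ N * G⁻¹ := by
      rw [hγ]
      simp only [map_mul, map_inv]
      rw [← hG, ← hU, conj_pow]
    rw [Subgroup.coe_pow, h1, conj_pow, ← pow_mul]
    group
  have hU' : ∀ j : ℕ, ((U ^ j : SL(2, ℝ)) : Matrix (Fin 2) (Fin 2) ℝ) = !![1, (j : ℝ); 0, 1] := by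
    intro j
    have h1 : (U ^ j : SL(2, ℝ)) = (ModularGroup.T ^ (j : ℤ)).map (Int.castRingHom ℝ) := by
      rw [hU, zpow_natCast, map_pow]
    rw [h1]
    ext a b
    have := ModularGroup.coe_T_zpow (j : ℤ)
    rw [Matrix.SpecialLinearGroup.map_apply_coe, this]
    fin_cases a <;> fin_cases b <;> simp
  have hχ : χ (γ ^ 2) = 1 := by
    rw [map_pow]
    exact Int.units_sq _
  refine ⟨((N * 2 : ℕ) : ℝ), by positivity, fun z hz => ?_⟩
  have hz' : 0 < (z + ((N * 2 : ℕ) : ℝ)).im := by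
    rw [Complex.add_im, Complex.ofReal_im, add_zero]
    exact hz
  have hM : U ^ (N * 2) • ofComplex z = ofComplex (z + ((N * 2 : ℕ) : ℝ)) := by
    apply UpperHalfPlane.ext
    have h1 : ((U ^ (N * 2) • ofComplex z : ℍ) : ℂ) = moebius (U ^ (N * 2)) z := rfl
    rw [h1, moebius_eq _ hz, autFactor, hU', ofComplex_apply_of_im_pos hz']
    simp
  have ha : autFactor (U ^ (N * 2)) z = 1 := by
    rw [autFactor, hU']
    simp
  constructor
  · rw [translate, translate, ← hM, ← mul_smul, ← hγG, mul_smul]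
    exact ht _ (γ ^ 2).2 _
  · have h1 := hF.slash (γ ^ 2)
    rw [hχ, Units.val_one, Int.cast_one, one_smul] at h1
    have h2 : F ∣[(k : ℤ)] (Matrix.SpecialLinearGroup.mapGL ℝ (((γ ^ 2 : Γ) : SL(2, ℝ)) * G)) =
        F ∣[(k : ℤ)] (Matrix.SpecialLinearGroup.mapGL ℝ G) := by
      rw [map_mul, SlashAction.slash_mul, h1]
    have h3 := congrFun h2 (ofComplex z)
    rw [hγG, slash_apply_eq, slash_apply_eq, ofComplex_apply_of_im_pos hz] at h3
    simp only at h3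
    rw [← h3]
    have e1 : autFactor (G * U ^ (N * 2)) z =
        autFactor G (z + ((N * 2 : ℕ) : ℝ)) := by
      rw [autFactor_mul _ _ hz, ha, mul_one]
      congr 1
      change ((U ^ (N * 2) • ofComplex z : ℍ) : ℂ) = _
      rw [hM, ofComplex_apply_of_im_pos hz']
    rw [slashAlong, slashAlong, e1, mul_smul, hM]

lemma HasQExpansion.eventuallyEq {f : ℂ → ℂ} {c : ℂ} {k : ℤ} {G : ℂ → ℂ}
    (h : HasQExpansion f c k G) : ∀ᶠ z in comap Complex.im atTop, AnalyticAt ℂ f z →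
      f =ᶠ[𝓝 z] fun y => Complex.exp (k * c * y) * G (Complex.exp (c * y)) := by
  filter_upwards [h.eventually_eq, h.tendsto_exp.eventually
    (h.analyticAt.eventually_analyticAt.filter_mono nhdsWithin_le_nhds)] with z h1 h2 hf
  refine (ContinuousAt.eventuallyEq_nhds_iff_eventuallyEq_nhdsNE hf.continuousAt ?_).1 h1
  have h3 : AnalyticAt ℂ (fun y => G (Complex.exp (c * y))) z :=
    AnalyticAt.fun_comp (g := G) (f := fun y => Complex.exp (c * y)) h2 (by fun_prop)
  have h4 := h3.continuousAt
  fun_prop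

/-- The order of vanishing in terms of `q` is read off from the logarithmic derivative. -/
lemma HasQExpansion.tendsto_logDeriv {f : ℂ → ℂ} {c : ℂ} {k : ℤ} {G : ℂ → ℂ}
    (h : HasQExpansion f c k G) : Tendsto (fun z => deriv f z / f z)
      (comap Complex.im atTop ⊓ 𝓟 {z | AnalyticAt ℂ f z}) (𝓝 (k * c)) := by
  have hcont : Tendsto (fun q : ℂ => k * c + c * q * (deriv G q / G q)) (𝓝[≠] 0)
      (𝓝 (k * c + c * 0 * (deriv G 0 / G 0))) := by
    have h1 := h.analyticAt.continuousAt
    have h2 := h.analyticAt.deriv.continuousAt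
    have h3 := h.ne_zero
    have : ContinuousAt (fun q : ℂ => k * c + c * q * (deriv G q / G q)) 0 := by
      fun_prop (disch := assumption)
    exact this.tendsto.mono_left nhdsWithin_le_nhds
  rw [mul_zero, zero_mul, add_zero] at hcont
  refine ((hcont.comp h.tendsto_exp).mono_left inf_le_left).congr' ?_
  filter_upwards [h.eventuallyEq.filter_mono inf_le_left, mem_inf_of_right (mem_principal_self _),
    (h.tendsto_exp.eventually ((h.analyticAt.eventually_analyticAt.and
      (h.analyticAt.continuousAt.eventually_ne h.ne_zero)).filter_mono
        nhdsWithin_le_nhds)).filter_mono inf_le_left] with z h1 h2 h3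
  have d1 : HasDerivAt (fun y => Complex.exp (k * c * y))
      (Complex.exp (k * c * z) * (k * c)) z := by
    simpa using ((hasDerivAt_id z).const_mul (k * c : ℂ)).cexp
  have d2 : HasDerivAt (fun y => Complex.exp (c * y)) (Complex.exp (c * z) * c) z := by
    simpa using ((hasDerivAt_id z).const_mul c).cexp
  have d3 : HasDerivAt (fun y => G (Complex.exp (c * y)))
      (deriv G (Complex.exp (c * z)) * (Complex.exp (c * z) * c)) z :=
    HasDerivAt.comp (h₂ := G) (h := fun y => Complex.exp (c * y)) z
      h3.1.differentiableAt.hasDerivAt d2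
  rw [(h1 h2).deriv_eq, (h1 h2).eq_of_nhds, (d1.fun_mul d3).deriv]
  have h4 := h3.2
  have h5 := Complex.exp_ne_zero (k * c * z)
  simp only [Function.comp]
  field_simp

lemma HasQExpansion.tendsto {f : ℂ → ℂ} {c : ℂ} {k : ℤ} {G : ℂ → ℂ}
    (h : HasQExpansion f c k G) :
    (∃ d, Tendsto f (comap Complex.im atTop ⊓ 𝓟 {z | AnalyticAt ℂ f z}) (𝓝 d)) ∨
      Tendsto f (comap Complex.im atTop ⊓ 𝓟 {z | AnalyticAt ℂ f z}) (Bornology.cobounded ℂ) := by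
  have hm : MeromorphicAt (fun q => q ^ k * G q) 0 :=
    MeromorphicAt.mul (by fun_prop) h.analyticAt.meromorphicAt
  have he : ∀ᶠ z in comap Complex.im atTop ⊓ 𝓟 {z | AnalyticAt ℂ f z},
      ((fun q => q ^ k * G q) ∘ fun z => Complex.exp (c * z)) z = f z := by
    filter_upwards [h.eventuallyEq.filter_mono inf_le_left,
      mem_inf_of_right (mem_principal_self _)] with z h1 h2
    rw [(h1 h2).eq_of_nhds, Function.comp, ← Complex.exp_int_mul, mul_assoc]
  have ht : Tendsto (fun z => Complex.exp (c * z))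
    (comap Complex.im atTop ⊓ 𝓟 {z | AnalyticAt ℂ f z}) (𝓝[≠] 0) :=
    h.tendsto_exp.mono_left inf_le_left
  rcases lt_or_ge (meromorphicOrderAt (fun q => q ^ k * G q) 0) 0 with hlt | hge
  · exact Or.inr (((tendsto_cobounded_of_meromorphicOrderAt_neg hlt).comp ht).congr' he)
  · obtain ⟨d, hd⟩ := tendsto_nhds_of_meromorphicOrderAt_nonneg hm hge
    exact Or.inl ⟨d, (hd.comp ht).congr' he⟩

/-- A bounded holomorphic function has no principal part. -/
lemma HasQExpansion.nonneg {f : ℂ → ℂ} {c : ℂ} {k : ℤ} {G : ℂ → ℂ} (h : HasQExpansion f c k G)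
    (hf : ∀ᶠ z in comap Complex.im atTop, AnalyticAt ℂ f z)
    (hb : f =O[comap Complex.im atTop] fun _ => (1 : ℝ)) : 0 ≤ k := by
  by_contra hneg
  obtain ⟨m, rfl⟩ : ∃ m : ℕ, k = -((m + 1 : ℕ) : ℤ) := ⟨(-k - 1).toNat, by omega⟩
  -- here `G(q) = q ^ (m + 1) * f` tends to zero
  have hq := h.tendsto_exp.mono_right nhdsWithin_le_nhds
  have h1 : Tendsto (fun z => Complex.exp (c * z) ^ (m + 1)) (comap Complex.im atTop) (𝓝 0) := by
    simpa using hq.pow (m + 1)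
  have h2 : Tendsto (fun z => Complex.exp (c * z) ^ (m + 1) * f z) (comap Complex.im atTop)
      (𝓝 0) := by
    have := ((Asymptotics.isLittleO_one_iff ℝ).2 h1).mul_isBigO hb
    rw [← Asymptotics.isLittleO_one_iff ℝ]
    simpa using this
  have h3 := h.analyticAt.continuousAt.tendsto.comp hq
  refine h.ne_zero (tendsto_nhds_unique (h3.congr' ?_) h2)
  filter_upwards [h.eventuallyEq, hf] with z k1 k2
  rw [(k1 k2).eq_of_nhds, ← Complex.exp_nat_mul, ← mul_assoc, ← Complex.exp_add]
  have : ((m + 1 : ℕ) : ℂ) * (c * z) + ((-((m + 1 : ℕ) : ℤ) : ℤ) : ℂ) * c * z = 0 := by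
    push_cast
    ring
  rw [this, Complex.exp_zero, one_mul, Function.comp]

/-! ### Symmetric pairs at a cusp -/

/-- The growth conditions on a symmetric pair coming from a cusp of width `r`. -/
structure IsCuspidalPair (r b : ℝ) (T Φ : ℂ → ℂ) : Prop where
  pos : 0 < r
  periodic : ∀ z : ℂ, 0 < z.im → T (z + r) = T z
  periodic' : ∀ z : ℂ, 0 < z.im → Φ (z + r) = Φ z
  isBigO : T =O[comap Complex.im atTop] fun z => Real.exp (b * z.im)
  isBigO' : Φ =O[comap Complex.im atTop] fun _ => (1 : ℝ)

section

variable {n : ℕ} {L : ThetaOp} {κ : ℂ} {T Φ : ℂ → ℂ} {r b : ℝ}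

lemma SymmetricPair.exists_qExpansion (h : SymmetricPair n L κ T Φ) (hc : IsCuspidalPair r b T Φ) :
    ∃ (k : ℤ) (G : ℂ → ℂ), HasQExpansion T (2 * Real.pi * Complex.I / r) k G :=
  VirtualYukawa.exists_qExpansion hc.pos h.mero hc.periodic hc.isBigO
    fun z hz => (h.regular z hz).mono fun _ hy => hy.ne_zero

lemma SymmetricPair.exists_qExpansion' (hκ : κ ≠ 0) (h : SymmetricPair n L κ T Φ)
    (hc : IsCuspidalPair r b T Φ) :
    ∃ (m : ℕ) (G : ℂ → ℂ), HasQExpansion Φ (2 * Real.pi * Complex.I / r) m G := by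
  obtain ⟨k, G, hG⟩ := VirtualYukawa.exists_qExpansion (b := 0) hc.pos
    (fun z hz => (h.holo z hz).meromorphicAt) hc.periodic'
    (by simpa using hc.isBigO') fun z hz => by
      filter_upwards [h.regular z hz, (eventually_im_gt hz).filter_mono nhdsWithin_le_nhds]
        with y hy hy0
      exact (h.ne_zero hκ hy0 hy).1
  obtain ⟨m, rfl⟩ := Int.eq_ofNat_of_zero_le
    (hG.nonneg (eventually_im_pos.mono h.holo) hc.isBigO')
  exact ⟨m, G, hG⟩

/-- The regular points accumulate at `i∞`. (The function `T` may take arbitrary values at isolated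
points, so limits towards a cusp are taken along the regular points.) -/
lemma SymmetricPair.neBot_regular (h : SymmetricPair n L κ T Φ) :
    (comap Complex.im atTop ⊓ 𝓟 {z | IsRegularPoint T z}).NeBot := by
  rw [inf_principal_neBot_iff]
  intro s hs
  obtain ⟨z, hz, hz0⟩ := ((eventually_nhds_of_comap_im hs).and eventually_im_pos).exists
  obtain ⟨y, hy⟩ := ((hz.filter_mono nhdsWithin_le_nhds).and (h.regular z hz0)).exists
  exact ⟨y, hy⟩

/-- If `c₀ / c_n` vanishes at infinity, then `Φ` does not vanish at the cusps. -/
lemma SymmetricPair.exists_tendsto_ne_zero (hn : 2 ≤ n) (hL : ∀ i, (L.coeff i).natDegree ≤ n)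
    (hκ : κ ≠ 0) (h : SymmetricPair n L κ T Φ) (hc : IsCuspidalPair r b T Φ)
    (hZ : Tendsto (fun x => (thetaCoeff L 0).eval x / (thetaCoeff L n).eval x)
      (Bornology.cobounded ℂ) (𝓝 0)) :
    ∃ d : ℂ, d ≠ 0 ∧ Tendsto Φ (comap Complex.im atTop) (𝓝 d) := by
  obtain ⟨kT, GT, hT⟩ := h.exists_qExpansion hc
  obtain ⟨m, G, hG⟩ := h.exists_qExpansion' hκ hc
  set c : ℂ := 2 * Real.pi * Complex.I / r with hcdef
  have hc0 : c ≠ 0 := by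
    have : (r : ℂ) ≠ 0 := by exact_mod_cast hc.pos.ne'
    exact div_ne_zero Complex.two_pi_I_ne_zero this
  have hΦe : ∀ᶠ z in comap Complex.im atTop,
      Φ =ᶠ[𝓝 z] fun y => Complex.exp (((m : ℤ) : ℂ) * c * y) * G (Complex.exp (c * y)) := by
    filter_upwards [hG.eventuallyEq, eventually_im_pos] with z h1 h2 using h1 (h.holo z h2)
  have hGlim := hG.analyticAt.continuousAt.tendsto.comp
    (hG.tendsto_exp.mono_right nhdsWithin_le_nhds)
  have hΦlim : Tendsto (fun z => Complex.exp (c * z) ^ m * G (Complex.exp (c * z)))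
      (comap Complex.im atTop) (𝓝 (0 ^ m * G 0)) :=
    ((hG.tendsto_exp.mono_right nhdsWithin_le_nhds).pow m).mul hGlim
  have hΦlim' : Tendsto Φ (comap Complex.im atTop) (𝓝 (0 ^ m * G 0)) := by
    refine hΦlim.congr' ?_
    filter_upwards [hΦe] with z hz
    rw [hz.eq_of_nhds, ← Complex.exp_nat_mul, Int.cast_natCast, mul_assoc]
  rcases Nat.eq_zero_or_pos m with rfl | hm
  · rw [pow_zero, one_mul] at hΦlim'
    exact ⟨_, hG.ne_zero, hΦlim'⟩
  -- otherwise `Φ` has the leading term `q ^ m` with `m > 0`, and `1 / Φ` behaves as `q ^ (-m)`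
  exfalso
  rw [zero_pow hm.ne', zero_mul] at hΦlim'
  obtain ⟨D, hD, hD0, hDe⟩ := iteratedDeriv_exp_mul c (-(m * c)) (hG.analyticAt.inv hG.ne_zero) n
  have hDe' : ∀ᶠ z in comap Complex.im atTop, iteratedDeriv n (fun y => (Φ y)⁻¹) z =
      Complex.exp (-(m * c) * z) * D (Complex.exp (c * z)) := by
    filter_upwards [hΦe, hG.tendsto_exp.eventually (hDe.filter_mono nhdsWithin_le_nhds)]
      with z h1 h2
    rw [← h2 z rfl]
    refine Filter.EventuallyEq.iteratedDeriv_eq n ?_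
    filter_upwards [h1] with y hy
    rw [hy, mul_inv, ← Complex.exp_neg, Int.cast_natCast, neg_mul, Pi.inv_apply]
  have := h.neBot_regular
  have hle : comap Complex.im atTop ⊓ 𝓟 {z | IsRegularPoint T z} ≤
      comap Complex.im atTop ⊓ 𝓟 {z | AnalyticAt ℂ T z} :=
    inf_le_inf_left _ (principal_mono.2 fun z hz => hz.analyticAt)
  have hev : ∀ᶠ z in comap Complex.im atTop ⊓ 𝓟 {z | IsRegularPoint T z},
      IsRegularPoint T z ∧ 0 < z.im :=
    Filter.Eventually.and (mem_inf_of_right (mem_principal_self _))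
      (eventually_im_pos.filter_mono inf_le_left)
  refine false_of_tendsto_zero (l := comap Complex.im atTop ⊓ 𝓟 {z | IsRegularPoint T z}) (n := n)
    (T := T) (Φ := Φ) (w := fun y => T y / deriv T y)
    (D := iteratedDeriv n fun y => (Φ y)⁻¹) (u := fun _ => 1) (by omega) hκ
    (κ' := G 0 * D 0) ?_ ?_ ?_ ?_ (hΦlim'.mono_left inf_le_left) tendsto_const_nhds ?_
    (ρ := kT * c) ?_ ?_ hZ
  · rw [hD0, Pi.inv_apply]
    have hm0 : (m : ℂ) ≠ 0 := by exact_mod_cast hm.ne'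
    exact mul_ne_zero hG.ne_zero (mul_ne_zero (pow_ne_zero _ (neg_ne_zero.2 (mul_ne_zero hm0 hc0)))
      (inv_ne_zero hG.ne_zero))
  · filter_upwards [hev] with y hy using hy.1.div_ne_zero
  · filter_upwards [hev] with y hy using h.wronskian y hy.2 hy.1
  · filter_upwards [hev] with y hy using h.thetaCoeff_zero_eval hL hκ hy.2 hy.1
  · have hDlim := hD.continuousAt.tendsto.comp (hG.tendsto_exp.mono_right nhdsWithin_le_nhds)
    refine ((hGlim.mul hDlim).congr' ?_).mono_left inf_le_left
    filter_upwards [hΦe, hDe'] with z h1 h2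
    rw [h2, h1.eq_of_nhds, one_pow, mul_one, mul_mul_mul_comm, ← Complex.exp_add]
    have : ((m : ℤ) : ℂ) * c * z + -(m * c) * z = 0 := by
      push_cast
      ring
    rw [this, Complex.exp_zero, one_mul, Function.comp, Function.comp]
  · refine (hT.tendsto_logDeriv.mono_left hle).congr fun z => ?_
    rw [one_div_div]
  · rcases hT.tendsto with ⟨d, hd⟩ | hd
    · exact Or.inl ⟨d, hd.mono_left hle⟩
    · exact Or.inr (hd.mono_left hle)

/-- The coupling is bounded towards a cusp: `T'/T` has a limit there. -/
lemma SymmetricPair.exists_bound (h : SymmetricPair n L κ T Φ) (hc : IsCuspidalPair r b T Φ) :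
    ∃ C : ℝ, ∀ᶠ z in comap Complex.im atTop, IsRegularPoint T z →
      ‖Φ z * (deriv T z / T z)‖ ≤ C := by
  obtain ⟨kT, GT, hT⟩ := h.exists_qExpansion hc
  have h1 : (fun z => deriv T z / T z) =O[comap Complex.im atTop ⊓ 𝓟 {z | AnalyticAt ℂ T z}]
      fun _ => (1 : ℝ) := hT.tendsto_logDeriv.isBigO_one ℝ
  obtain ⟨C, hC⟩ := ((hc.isBigO'.mono inf_le_left).mul h1).bound
  rw [eventually_inf_principal] at hC
  refine ⟨C, hC.mono fun z hz hr => ?_⟩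
  simpa using hz hr.analyticAt

end

/-! ### The modular form vanishes at the poles of the Hauptmodul -/

lemma slash_apply_eq_zpow (k : ℤ) (F : ℍ → ℂ) (g : SL(2, ℝ)) (τ : ℍ) :
    (F ∣[k] (Matrix.SpecialLinearGroup.mapGL ℝ g)) τ = autFactor g τ ^ (-k) * F (g • τ) := by
  rw [ModularForm.slash_apply]
  simp [σ, denom, autFactor, mul_comm]
  exact mul_comm _ _

lemma mapGL_map_intCast (g : SL(2, ℤ)) :
    (Matrix.SpecialLinearGroup.mapGL ℝ (g.map (Int.castRingHom ℝ)) : GL (Fin 2) ℝ) =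
      Matrix.SpecialLinearGroup.mapGL ℝ g := by
  ext i j
  simp

lemma exists_eq_smul_infty {Γ : Subgroup SL(2, ℝ)} (hΓ : (toGL Γ).IsArithmetic) {c : OnePoint ℝ}
    (hc : IsCusp c (toGL Γ)) : ∃ g : SL(2, ℤ),
      (Matrix.SpecialLinearGroup.mapGL ℝ (g.map (Int.castRingHom ℝ)) : GL (Fin 2) ℝ) •
        (OnePoint.infty : OnePoint ℝ) = c := by
  rw [Subgroup.IsArithmetic.isCusp_iff_isCusp_SL2Z, isCusp_SL2Z_iff'] at hc
  obtain ⟨g, rfl⟩ := hc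
  exact ⟨g, by rw [mapGL_map_intCast]⟩

section

variable {n : ℕ} {Γ : Subgroup SL(2, ℝ)} {χ : Γ →* ℤˣ} {L : ThetaOp} {h : ℕ → ℂ → ℂ} {t F : ℍ → ℂ}

/-- The translates of the parametrization to a cusp are periodic and of moderate growth. -/
lemma IsModularParametrization.isCuspidalPair (hn : 2 ≤ n) (hΓ : (toGL Γ).IsArithmetic)
    (hmod : IsModularParametrization Γ χ n h t F) {g : SL(2, ℤ)}
    (hg : IsCusp ((Matrix.SpecialLinearGroup.mapGL ℝ (g.map (Int.castRingHom ℝ)) :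
      GL (Fin 2) ℝ) • (OnePoint.infty : OnePoint ℝ)) (toGL Γ)) :
    ∃ r b : ℝ, IsCuspidalPair r b (translate t (g.map (Int.castRingHom ℝ)))
      (slashAlong (n - 1) F (g.map (Int.castRingHom ℝ))) := by
  have hF := hmod.isModularForm hn
  have ht := hmod.hauptmodul.modular
  obtain ⟨r, hr, hper⟩ := exists_period hΓ ht.invariant hF g
  obtain ⟨b, hb⟩ := ht.mero_at_cusps _ hg
  refine ⟨r, b, hr, fun z hz => (hper z hz).1, fun z hz => (hper z hz).2, ?_, ?_⟩
  · obtain ⟨C, hC⟩ := hb.bound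
    refine Asymptotics.IsBigO.of_bound C ?_
    filter_upwards [eventually_comap_im_of_atImInfty hC, eventually_im_pos] with z h1 h2
    rw [ofComplex_apply_of_im_pos h2] at h1
    rw [translate, ofComplex_apply_of_im_pos h2]
    exact h1
  · have h1 := (OnePoint.isBoundedAt_iff rfl).1 (hF.bdd_at_cusps _ hg)
    obtain ⟨C, hC⟩ := Asymptotics.IsBigO.bound h1
    refine Asymptotics.IsBigO.of_bound C ?_
    filter_upwards [eventually_comap_im_of_atImInfty hC, eventually_im_pos] with z h1 h2
    rw [slash_apply_eq, ofComplex_apply_of_im_pos h2] at h1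
    simpa using h1

lemma two_pi_I_inv_pow_ne_zero (m : ℕ) : (2 * Real.pi * Complex.I : ℂ)⁻¹ ^ m ≠ 0 :=
  pow_ne_zero _ (inv_ne_zero Complex.two_pi_I_ne_zero)

/-- At a pole of the Hauptmodul the modular form has to vanish. Otherwise `0` is an exponent of `L`
at `t = ∞`, so `F` has no zeros at all, cusps included, and `1 / F²` is a modular form of negative
weight. -/
lemma IsModularParametrization.eq_zero_of_pole (hn : 2 ≤ n) (hΓ : (toGL Γ).IsArithmetic)
    (hL : IsCalabiYauOp n L h) (hmod : IsModularParametrization Γ χ n h t F) {z : ℂ}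
    (hz : 0 < z.im) (hpole : meromorphicOrderAt (t ∘ ofComplex) z < 0) :
    (F ∘ ofComplex) z = 0 := by
  by_contra hne
  have hp := hmod.symmetricPair hn hΓ hL
  have hF := hmod.isModularForm hn
  have hκ := two_pi_I_inv_pow_ne_zero (n - 1)
  have hZ := hp.tendsto_of_pole hn hL.order_le (hL.fuchsian.infinity 0 (by omega)) hκ hz hpole hne
  have hnz : ∀ τ : ℍ, F τ ≠ 0 := by
    intro τ
    have := hp.ne_zero_of_tendsto hn hL.order_le hκ hZ τ.im_pos
    rwa [Function.comp, ofComplex_apply] at this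
  let f : ModularForm (toGL Γ) (-(2 * (n - 1 : ℕ) : ℤ)) :=
    { toFun := fun τ => (F τ ^ 2)⁻¹
      slash_action_eq' := by
        rintro _ ⟨γ, hγ, rfl⟩
        ext τ
        have h1 := congrFun (hF.slash ⟨γ, hγ⟩) τ
        rw [slash_apply_eq_zpow, Pi.smul_apply, smul_eq_mul] at h1
        have ha := autFactor_ne_zero γ τ.im_pos
        have hχ : (((χ ⟨γ, hγ⟩ : ℤˣ) : ℤ) : ℂ) ^ 2 = 1 := by
          rcases Int.units_eq_one_or (χ ⟨γ, hγ⟩) with h | h <;> simp [h]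
        have h2 : (autFactor γ τ ^ (-((n - 1 : ℕ) : ℤ)) * F (γ • τ)) ^ 2 = F τ ^ 2 := by
          rw [h1, mul_pow, hχ, one_mul]
        rw [slash_apply_eq_zpow, ← h2, mul_pow, mul_inv, ← zpow_natCast (_ ^ _) 2,
          ← zpow_mul, ← zpow_neg]
        congr 2
        push_cast
        ring
      holo' := by
        rw [UpperHalfPlane.mdifferentiable_iff]
        intro y hy
        have h1 := (analyticAt_comp_ofComplex hF.holo hy).pow 2
        exact (h1.inv (pow_ne_zero 2 (hnz _))).differentiableAt.differentiableWithinAt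
      bdd_at_cusps' := by
        intro c hc
        obtain ⟨g, rfl⟩ := exists_eq_smul_infty hΓ hc
        rw [OnePoint.isBoundedAt_iff rfl]
        obtain ⟨r, b, hcp⟩ := hmod.isCuspidalPair hn hΓ hc
        obtain ⟨d, hd, hlim⟩ := (hp.translate hn hF.holo _).exists_tendsto_ne_zero hn hL.order_le
          hκ hcp hZ
        have h1 := ((hlim.pow 2).inv₀ (pow_ne_zero 2 hd)).comp tendsto_coe_atImInfty
        refine (h1.congr fun τ => ?_).isBigO_one ℝ |>.trans
          (Asymptotics.isBigO_of_le _ fun τ => by simp)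
        rw [slash_apply_eq_zpow, Function.comp, slashAlong, ofComplex_apply, mul_pow, mul_inv,
          inv_pow, inv_inv, neg_neg, ← pow_mul, mul_comm (n - 1) 2]
        norm_cast }
  have hf : f = 0 := ModularForm.isZero_of_neg_weight (by omega) f
  have h1 : f UpperHalfPlane.I = 0 := by rw [hf]; rfl
  exact inv_ne_zero (pow_ne_zero 2 (hnz UpperHalfPlane.I)) h1

/-! ### The virtual Yukawa coupling -/

/-- The meromorphic function `(2πi)⁻ⁿ Φ T'/T`, where `T' = (2πi)⁻¹ dT/dz`. -/
def coupling (n : ℕ) (T Φ : ℂ → ℂ) (z : ℂ) : ℂ :=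
  1 / (2 * Real.pi * Complex.I) ^ n *
    (Φ z * (1 / (2 * Real.pi * Complex.I) * deriv T z / T z))

/-- The virtual Yukawa coupling: the holomorphic function obtained from `(2πi)⁻ⁿ F t'/t` by removing
singularities. -/
def virtualYukawa (n : ℕ) (t F : ℍ → ℂ) (τ : ℍ) : ℂ :=
  limUnder (𝓝[≠] (τ : ℂ)) (coupling n (t ∘ ofComplex) (F ∘ ofComplex))

lemma IsModularParametrization.meromorphicAt_coupling
    (hmod : IsModularParametrization Γ χ n h t F) {z : ℂ} (hz : 0 < z.im) :
    MeromorphicAt (coupling n (t ∘ ofComplex) (F ∘ ofComplex)) z := by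
  have hm := hmod.hauptmodul.modular.mero z hz
  have hFm := (analyticAt_comp_ofComplex hmod.modular.holo hz).meromorphicAt
  exact (MeromorphicAt.const _ _).mul (hFm.mul (((MeromorphicAt.const _ _).mul hm.deriv).div hm))

/-- The simple poles of `T' / T` at the poles of `T` are cancelled by the zeros of `F`. -/
lemma IsModularParametrization.order_coupling_nonneg (hn : 2 ≤ n) (hΓ : (toGL Γ).IsArithmetic)
    (hL : IsCalabiYauOp n L h) (hmod : IsModularParametrization Γ χ n h t F) {z : ℂ}
    (hz : 0 < z.im) :
    0 ≤ meromorphicOrderAt (coupling n (t ∘ ofComplex) (F ∘ ofComplex)) z := by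
  have hp := hmod.symmetricPair hn hΓ hL
  have hm := hp.mero z hz
  have hFa := hp.holo z hz
  set c : ℂ := 1 / (2 * Real.pi * Complex.I) ^ n * (1 / (2 * Real.pi * Complex.I)) with hc
  have hc0 : AnalyticAt ℂ (fun _ : ℂ => c) z := analyticAt_const
  have e : coupling n (t ∘ ofComplex) (F ∘ ofComplex) =
      (fun _ => c) * ((F ∘ ofComplex) * logDeriv (t ∘ ofComplex)) := by
    ext y
    simp only [coupling, Pi.mul_apply, logDeriv, Pi.div_apply, hc]
    ring
  rw [e, meromorphicOrderAt_mul hc0.meromorphicAt (hFa.meromorphicAt.mul hm.logDeriv),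
    meromorphicOrderAt_mul hFa.meromorphicAt hm.logDeriv]
  refine add_nonneg hc0.meromorphicOrderAt_nonneg ?_
  rcases (hp.order_nonpos hn (two_pi_I_inv_pow_ne_zero _) hz).lt_or_eq with hlt | heq
  · rw [meromorphicOrderAt_logDeriv_eq_neg_one hm hlt.ne (hp.order_ne_top hz)]
    have h0 := hFa.analyticOrderAt_ne_zero.2 (hmod.eq_zero_of_pole hn hΓ hL hz hlt)
    rw [hFa.meromorphicOrderAt_eq]
    cases hord : analyticOrderAt (F ∘ ofComplex) z with
    | top => simp
    | coe m =>
      have hm0 : m ≠ 0 := by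
        rintro rfl
        exact h0 hord
      have h1 : (0 : ℤ) ≤ (m : ℤ) + -1 := by omega
      exact WithTop.coe_le_coe.2 h1
  · exact add_nonneg hFa.meromorphicOrderAt_nonneg (meromorphicOrderAt_logDeriv_nonneg hm heq)

lemma virtualYukawa_comp_ofComplex {z : ℂ} (hz : 0 < z.im) :
    (virtualYukawa n t F ∘ ofComplex) z =
      limUnder (𝓝[≠] z) (coupling n (t ∘ ofComplex) (F ∘ ofComplex)) := by
  rw [Function.comp, virtualYukawa, ofComplex_apply_of_im_pos hz]

lemma IsModularParametrization.analyticAt_virtualYukawa (hn : 2 ≤ n) (hΓ : (toGL Γ).IsArithmetic)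
    (hL : IsCalabiYauOp n L h) (hmod : IsModularParametrization Γ χ n h t F) {z : ℂ}
    (hz : 0 < z.im) : AnalyticAt ℂ (virtualYukawa n t F ∘ ofComplex) z := by
  refine (analyticAt_limUnder (hmod.meromorphicAt_coupling hz)
    (hmod.order_coupling_nonneg hn hΓ hL hz)).1.congr ?_
  filter_upwards [eventually_im_gt hz] with y hy using (virtualYukawa_comp_ofComplex hy).symm

/-- The formula for the coupling holds wherever its right hand side makes sense. -/
lemma IsModularParametrization.virtualYukawa_eq (hmod : IsModularParametrization Γ χ n h t F)
    {τ : ℍ} (ht : AnalyticAt ℂ (t ∘ ofComplex) τ) (h0 : t τ ≠ 0) :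
    virtualYukawa n t F τ = coupling n (t ∘ ofComplex) (F ∘ ofComplex) τ := by
  have hFa := analyticAt_comp_ofComplex hmod.modular.holo τ.im_pos
  have h0' : (t ∘ ofComplex) τ ≠ 0 := by rwa [Function.comp, ofComplex_apply]
  have : AnalyticAt ℂ (coupling n (t ∘ ofComplex) (F ∘ ofComplex)) τ :=
    analyticAt_const.mul (hFa.mul ((analyticAt_const.mul ht.deriv).div ht h0'))
  exact (this.continuousAt.tendsto.mono_left nhdsWithin_le_nhds).limUnder_eq

/-- The coupling of a translate is the translate of the coupling. -/
lemma IsModularParametrization.slash_virtualYukawa (hn : 2 ≤ n)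
    (hmod : IsModularParametrization Γ χ n h t F) (g : SL(2, ℝ)) {τ : ℍ}
    (hr : IsRegularPoint (translate t g) τ) :
    (virtualYukawa n t F ∣[(n : ℤ) + 1] (Matrix.SpecialLinearGroup.mapGL ℝ g)) τ =
      coupling n (translate t g) (slashAlong (n - 1) F g) τ := by
  have hz := τ.im_pos
  have hr' := (isRegularPoint_translate_iff hz).1 hr
  have hM : moebius g τ = ((g • τ : ℍ) : ℂ) := by rw [moebius, ofComplex_apply]
  rw [slash_apply_eq_zpow]
  rw [hM] at hr'
  have h0 : t (g • τ) ≠ 0 := by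
    have := hr'.ne_zero
    rwa [Function.comp, ofComplex_apply] at this
  rw [hmod.virtualYukawa_eq hr'.analyticAt h0, coupling, coupling,
    deriv_translate hz (by rw [hM]; exact hr'), hM, slashAlong, translate, ofComplex_apply]
  simp only [Function.comp, ofComplex_apply]
  have ha := autFactor_ne_zero g hz
  have e : autFactor g τ ^ (-((n : ℤ) + 1)) =
      (autFactor g τ ^ (n - 1))⁻¹ * (autFactor g τ ^ 2)⁻¹ := by
    rw [zpow_neg, ← mul_inv, ← pow_add]
    congr 1
    rw [show n - 1 + 2 = n + 1 by omega]
    norm_cast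
  rw [e]
  have hpi := Complex.two_pi_I_ne_zero
  field_simp

/-- The virtual Yukawa coupling is a modular form. -/
lemma IsModularParametrization.isModularForm_virtualYukawa (hn : 2 ≤ n)
    (hΓ : (toGL Γ).IsArithmetic) (hL : IsCalabiYauOp n L h)
    (hmod : IsModularParametrization Γ χ n h t F) :
    IsModularForm Γ χ ((n : ℤ) + 1) (virtualYukawa n t F) := by
  have hp := hmod.symmetricPair hn hΓ hL
  have hF := hmod.isModularForm hn
  have hholo : MDiff (virtualYukawa n t F) := by
    rw [UpperHalfPlane.mdifferentiable_iff]
    intro z hz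
    exact (hmod.analyticAt_virtualYukawa hn hΓ hL hz).differentiableAt.differentiableWithinAt
  have hslash : ∀ g : SL(2, ℝ), ∀ z : ℂ, 0 < z.im → ContinuousAt
      ((virtualYukawa n t F ∣[(n : ℤ) + 1] (Matrix.SpecialLinearGroup.mapGL ℝ g)) ∘ ofComplex)
        z := by
    intro g z hz
    have h1 : ((virtualYukawa n t F ∣[((n + 1 : ℕ) : ℤ)] (Matrix.SpecialLinearGroup.mapGL ℝ g)) ∘
        ofComplex) =ᶠ[𝓝 z] slashAlong (n + 1) (virtualYukawa n t F) g := by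
      filter_upwards [eventually_im_gt hz] with y hy
      rw [Function.comp, slash_apply_eq, ofComplex_apply_of_im_pos hy]
    exact (analyticAt_slashAlong hholo (n + 1) g hz).continuousAt.congr h1.symm
  refine ⟨fun γ => ?_, hholo, fun c hc => ?_⟩
  · ext τ
    -- both sides are continuous, and equal at the regular points
    have hz := τ.im_pos
    have hTγ : translate t γ = t ∘ ofComplex := by
      ext y
      exact hmod.hauptmodul.modular.invariant γ γ.2 _
    have h1 : ((virtualYukawa n t F ∣[(n : ℤ) + 1]
        (Matrix.SpecialLinearGroup.mapGL ℝ (γ : SL(2, ℝ)))) ∘ ofComplex) =ᶠ[𝓝[≠] (τ : ℂ)]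
        fun z => (((χ γ : ℤˣ) : ℤ) : ℂ) * (virtualYukawa n t F ∘ ofComplex) z := by
      filter_upwards [hp.regular _ hz, (eventually_im_gt hz).filter_mono nhdsWithin_le_nhds]
        with y hr hy
      have h2 := hmod.slash_virtualYukawa hn γ (τ := ⟨y, hy⟩) (by rw [hTγ]; exact hr)
      have h3 := congrFun (hF.slash γ) ⟨y, hy⟩
      rw [slash_apply_eq, Pi.smul_apply, smul_eq_mul] at h3
      have h0 : t ⟨y, hy⟩ ≠ 0 := by
        have := hr.ne_zero
        rwa [Function.comp, ofComplex_apply_of_im_pos hy] at this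
      simp only [Function.comp, ofComplex_apply_of_im_pos hy]
      rw [h2, hmod.virtualYukawa_eq (τ := ⟨y, hy⟩) hr.analyticAt h0, coupling, coupling, hTγ, h3]
      simp only [Function.comp, ofComplex_apply_of_im_pos hy]
      ring
    have h2 := (ContinuousAt.eventuallyEq_nhds_iff_eventuallyEq_nhdsNE (hslash γ τ hz)
      ((hmod.analyticAt_virtualYukawa hn hΓ hL hz).continuousAt.const_mul _)).1 h1
    have h3 := h2.eq_of_nhds
    rw [Pi.smul_apply, smul_eq_mul]
    simpa only [Function.comp, ofComplex_apply] using h3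
  · obtain ⟨g, rfl⟩ := exists_eq_smul_infty hΓ hc
    rw [OnePoint.isBoundedAt_iff rfl]
    obtain ⟨r, b, hcp⟩ := hmod.isCuspidalPair hn hΓ hc
    have hpg := hp.translate hn hF.holo (g.map (Int.castRingHom ℝ))
    obtain ⟨C, hC⟩ := hpg.exists_bound hcp
    set c : ℂ := 1 / (2 * Real.pi * Complex.I) ^ n * (1 / (2 * Real.pi * Complex.I)) with hcdef
    have hev : ∀ᶠ z in comap Complex.im atTop, ‖((virtualYukawa n t F ∣[(n : ℤ) + 1]
        (Matrix.SpecialLinearGroup.mapGL ℝ (g.map (Int.castRingHom ℝ)))) ∘ ofComplex) z‖ ≤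
          ‖c‖ * C := by
      filter_upwards [eventually_nhds_of_comap_im hC, eventually_im_pos] with z h1 hz
      refine le_of_tendsto ((hslash _ z hz).tendsto.mono_left
        (nhdsWithin_le_nhds (s := {z}ᶜ))).norm ?_
      filter_upwards [h1.filter_mono nhdsWithin_le_nhds, hpg.regular z hz,
        (eventually_im_gt hz).filter_mono nhdsWithin_le_nhds] with y h2 h3 hy
      have h4 := hmod.slash_virtualYukawa hn _ (τ := ⟨y, hy⟩) h3
      rw [Function.comp, ofComplex_apply_of_im_pos hy, h4]
      have h5 : coupling n (translate t (g.map (Int.castRingHom ℝ)))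
          (slashAlong (n - 1) F (g.map (Int.castRingHom ℝ))) y =
          c * (slashAlong (n - 1) F (g.map (Int.castRingHom ℝ)) y *
            (deriv (translate t (g.map (Int.castRingHom ℝ))) y /
              translate t (g.map (Int.castRingHom ℝ)) y)) := by
        rw [coupling, hcdef]
        ring
      change ‖coupling n _ _ y‖ ≤ _
      rw [h5, norm_mul]
      exact mul_le_mul_of_nonneg_left (h2 h3) (norm_nonneg _)
    refine Asymptotics.IsBigO.of_bound (‖c‖ * C) ?_
    filter_upwards [tendsto_coe_atImInfty.eventually hev] with τ hτ
    simpa only [Function.comp, ofComplex_apply, Pi.one_apply, norm_one, mul_one] using hτ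

end

/-! ### Eichler integrals -/

/-- Iterated primitives on the upper half plane can be chosen to extend a given iterated primitive
on a smaller half plane. -/
lemma exists_iteratedDeriv_eq (n : ℕ) {f : ℂ → ℂ} (hf : DifferentiableOn ℂ f {z | 0 < z.im}) {A : ℝ}
    (hA : 0 < A) {P : ℂ → ℂ} (hP : DifferentiableOn ℂ P {z | A < z.im})
    (h : ∀ z : ℂ, A < z.im → iteratedDeriv n P z = f z) :
    ∃ E : ℂ → ℂ, DifferentiableOn ℂ E {z | 0 < z.im} ∧
      (∀ z : ℂ, 0 < z.im → iteratedDeriv n E z = f z) ∧ ∀ z : ℂ, A < z.im → E z = P z := by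
  induction n generalizing P with
  | zero => exact ⟨f, hf, fun z _ => by simp, fun z hz => by rw [← h z hz, iteratedDeriv_zero]⟩
  | succ n ih =>
    obtain ⟨E₁, hE₁, hE₁f, hE₁P⟩ := ih (hP.deriv (isOpen_im_gt A))
      fun z hz => by rw [← h z hz, iteratedDeriv_succ']
    -- `E` differs from `P` by a constant on the smaller half plane
    obtain ⟨E, hE⟩ := (convex_halfSpace_im_gt 0).exists_forall_hasDerivWithinAt hE₁
    have hE' : ∀ z : ℂ, 0 < z.im → HasDerivAt E (E₁ z) z := fun z hz =>
      (hE z hz).hasDerivAt ((isOpen_im_gt 0).mem_nhds hz)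
    have hP' : ∀ z : ℂ, A < z.im → HasDerivAt P (deriv P z) z := fun z hz =>
      (hP.differentiableAt ((isOpen_im_gt A).mem_nhds hz)).hasDerivAt
    set z₁ : ℂ := ((A + 1 : ℝ) : ℂ) * Complex.I with hz₁
    refine ⟨fun z => E z - (E z₁ - P z₁), fun z hz =>
      ((hE' z hz).sub_const _).differentiableAt.differentiableWithinAt, fun z hz => ?_,
      fun z hz => ?_⟩
    · rw [iteratedDeriv_succ', ← hE₁f z hz]
      refine Filter.EventuallyEq.iteratedDeriv_eq n ?_
      filter_upwards [eventually_im_gt hz] with y hy using ((hE' y hy).sub_const _).deriv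
    · have hd : ∀ y : ℂ, A < y.im → HasDerivAt (fun y => E y - P y) 0 y := by
        intro y hy
        have := (hE' y (hA.trans hy)).fun_sub (hP' y hy)
        rwa [hE₁P y hy, sub_self] at this
      have := (isOpen_im_gt A).is_const_of_deriv_eq_zero
        (convex_halfSpace_im_gt A).isPreconnected (f := fun y => E y - P y)
        (fun y hy => (hd y hy).differentiableAt.differentiableWithinAt)
        (fun y hy => (hd y hy).deriv) hz (y := z₁) (by simp [hz₁])
      linear_combination this

section

variable {n : ℕ} {Γ : Subgroup SL(2, ℝ)} {χ : Γ →* ℤˣ} {L : ThetaOp} {h H : ℕ → ℂ → ℂ} {t F : ℍ → ℂ}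

lemma omega_zero (h : ℕ → ℂ → ℂ) (s : ℂ) : omega h 0 s = h 0 (Complex.exp s) := by
  simp [omega]

/-- The holomorphic solutions of `L` and of `θ L` with constant term `1` coincide. -/
lemma IsFrobeniusBasis.eventuallyEq_zero (hn : 2 ≤ n) (hL : IsCalabiYauOp n L h)
    (hH : IsFrobeniusBasis (n + 1) (quantumOp L) H) : H 0 =ᶠ[𝓝 0] h 0 := by
  have e : ∀ h : ℕ → ℂ → ℂ, omega h 0 = h 0 ∘ Complex.exp := fun h => funext (omega_zero h)
  refine eventuallyEq_of_applyOp_eq_zero hL.mum (hH.analytic 0 (by omega))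
    (hL.frobenius.analytic 0 (by omega)) (by rw [hH.h_zero, hL.frobenius.h_zero]) ?_ ?_
  · have := hH.applyOp_omega hL.mum (k := 0) (by omega)
    rw [if_neg (by omega), e] at this
    exact this
  · have := hL.frobenius.solution 0 (by omega)
    rwa [e] at this

/-- The `n`-th derivative of the prepotential near `i∞`, computed from `L ω_n = n! / (2πi)ⁿ`. -/
lemma IsModularParametrization.eventually_iteratedDeriv_prepotential (hn : 2 ≤ n)
    (hΓ : (toGL Γ).IsArithmetic) (hL : IsCalabiYauOp n L h)
    (hmod : IsModularParametrization Γ χ n h t F)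
    (hH : IsFrobeniusBasis (n + 1) (quantumOp L) H) :
    ∀ᶠ z in comap Complex.im atTop,
      AnalyticAt ℂ (fun y => prepotential n H (logAlong h t y)) z ∧
      iteratedDeriv n (fun y => prepotential n H (logAlong h t y)) z =
        (virtualYukawa n t F ∘ ofComplex) z := by
  have hp := hmod.symmetricPair hn hΓ hL
  obtain ⟨h1, h2, h3⟩ := eventually_logAlong (hL.frobenius.analytic 0 (by omega))
    (hL.frobenius.analytic 1 (by omega)) hL.frobenius.h_zero
    (hL.frobenius.h_pos 1 (by omega) one_pos) hmod.tendsto hmod.mirror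
  have ho : ∀ᶠ s in nearZero, AnalyticAt ℂ (omega H n) s :=
    analyticAt_omega fun j hj => hH.analytic j (by omega)
  have hω0 : ∀ᶠ s in nearZero, omega H 0 s = omega h 0 s := by
    filter_upwards [tendsto_exp_nearZero'.eventually (hH.eventuallyEq_zero hn hL)] with s hs
    rw [omega_zero, omega_zero, hs]
  have hperiod : ∀ᶠ z in comap Complex.im atTop,
      (F ∘ ofComplex) z = omega H 0 (logAlong h t z) := by
    filter_upwards [hmod.eventually_period hn hL, h3.eventually hω0] with z k1 k2
    rw [k1, Function.comp, k2]
  have hκ := two_pi_I_inv_pow_ne_zero (n - 1)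
  filter_upwards [h1, h3.eventually ho, eventually_nhds_of_comap_im hperiod, eventually_im_pos,
    hmod.eventually_isRegularPoint hn hL, hmod.opAlong_comp_logAlong hn hL ho,
    h3.eventually (hH.applyOp_omega hL.mum le_rfl)] with z k1 k2 k3 hz hr k4 k5
  have hΦ := hp.holo z hz
  have hne := hp.ne_zero hκ hz hr
  have hN := Complex.two_pi_I_ne_zero
  have hfac : (n.factorial : ℂ) ≠ 0 := by exact_mod_cast n.factorial_ne_zero
  have hcomp : AnalyticAt ℂ (omega H n ∘ logAlong h t) z := k2.comp k1.1
  have heq : (fun y => prepotential n H (logAlong h t y)) =ᶠ[𝓝 z]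
      fun y => 1 / ((2 * Real.pi * Complex.I) ^ n * n.factorial) *
        ((omega H n ∘ logAlong h t) y / (F ∘ ofComplex) y) := by
    filter_upwards [k3] with y hy
    rw [prepotential, hy, Function.comp]
  have han : AnalyticAt ℂ (fun y => prepotential n H (logAlong h t y)) z :=
    (analyticAt_const.mul (hcomp.div hΦ hne.1)).congr heq.symm
  refine ⟨han, ?_⟩
  have k6 := (hp.twists z hz hr).opAlong_mul hL.order_le hr hΦ han
  have k7 : (fun y => (F ∘ ofComplex) y * prepotential n H (logAlong h t y)) =ᶠ[𝓝 z]
      fun y => 1 / ((2 * Real.pi * Complex.I) ^ n * n.factorial) *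
        (omega H n ∘ logAlong h t) y := by
    filter_upwards [heq, hΦ.continuousAt.eventually_ne hne.1] with y e1 e2
    rw [e1]
    field_simp
  rw [opAlong_congr .rfl k7, opAlong_const_mul, k4, k5, if_pos rfl] at k6
  have h0 : t (ofComplex z) ≠ 0 := hr.ne_zero
  have hr' : AnalyticAt ℂ (t ∘ ofComplex) (ofComplex z : ℂ) := by
    rw [ofComplex_apply_of_im_pos hz]
    exact hr.analyticAt
  rw [Function.comp, hmod.virtualYukawa_eq hr' h0, ofComplex_apply_of_im_pos hz]
  change _ = coupling n _ _ z
  -- solve `L (Φ f) = c_n(T) Φ wⁿ f⁽ⁿ⁾` for `f⁽ⁿ⁾` by the Wronskian identity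
  have k8 := hp.wronskian z hz hr
  have hw := hr.div_ne_zero
  have hT0 := hr.ne_zero
  have hT1 := hr.deriv_ne_zero
  rw [coupling]
  have e1 : 1 / (2 * Real.pi * Complex.I : ℂ) * deriv (t ∘ ofComplex) z / (t ∘ ofComplex) z =
      1 / (2 * Real.pi * Complex.I) * ((t ∘ ofComplex) z / deriv (t ∘ ofComplex) z)⁻¹ := by
    rw [inv_div]
    ring
  rw [e1]
  obtain ⟨m, rfl⟩ : ∃ m, n = m + 1 := ⟨n - 1, by omega⟩
  rw [Nat.add_sub_cancel] at k8
  generalize (t ∘ ofComplex) z / deriv (t ∘ ofComplex) z = w at *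
  generalize iteratedDeriv (m + 1) (fun y => prepotential (m + 1) H (logAlong h t y)) z = I at *
  generalize (F ∘ ofComplex) z = Φ at *
  generalize (thetaCoeff L (m + 1)).eval ((t ∘ ofComplex) z) = a at *
  generalize (2 * Real.pi * Complex.I : ℂ) = N at *
  have hwm : w ^ m ≠ 0 := pow_ne_zero _ hw
  have k9 : Φ * (N⁻¹ ^ (m + 1) * N⁻¹ ^ (m + 1)) = N⁻¹ ^ m * w * I := by
    rw [← k8]
    have : N⁻¹ ^ (m + 1) * N⁻¹ ^ (m + 1) = 1 / (N ^ (m + 1) * (m + 1).factorial) *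
        ((m + 1).factorial / N ^ (m + 1)) := by
      rw [inv_pow]
      field_simp
    rw [this, k6]
    ring
  have hNm : N⁻¹ ^ m ≠ 0 := pow_ne_zero _ (inv_ne_zero hN)
  apply mul_left_cancel₀ (mul_ne_zero hNm hw)
  rw [← k9, one_div, one_div, ← inv_pow, pow_succ]
  field_simp

end

end VirtualYukawa

end

theorem proposition4p3 (n : ℕ) (hn : 2 ≤ n)
    (Γ : Subgroup SL(2, ℝ)) (hΓ : (VirtualYukawa.toGL Γ).IsArithmetic) (χ : Γ →* ℤˣ)
    (L : VirtualYukawa.ThetaOp) (h : ℕ → ℂ → ℂ) (hL : VirtualYukawa.IsCalabiYauOp n L h)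
    (t F : ℍ → ℂ) (hmod : VirtualYukawa.IsModularParametrization Γ χ n h t F)
    (H : ℕ → ℂ → ℂ)
    (hH : VirtualYukawa.IsFrobeniusBasis (n + 1) (VirtualYukawa.quantumOp L) H) :
    ∃ (𝔉 : ℂ → ℂ) (Y : ℍ → ℂ),
      -- `𝔉` is the holomorphic prepotential (continued from a neighbourhood of `i∞`)
      (∀ᶠ τ : ℍ in atImInfty,
        𝔉 τ = VirtualYukawa.prepotential n H (VirtualYukawa.logMirror h t τ)) ∧
      -- the virtual Yukawa coupling `Y` is modular, and `𝔉` is its Eichler integral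
      VirtualYukawa.IsModularForm Γ χ ((n : ℤ) + 1) Y ∧
      VirtualYukawa.IsEichlerIntegral n 𝔉 Y ∧
      -- formula for the canonical `ω_n`
      (∀ τ : ℍ, AnalyticAt ℂ (t ∘ ofComplex) τ → t τ ≠ 0 →
        Y τ = 1 / (2 * Real.pi * Complex.I) ^ n * (F τ * VirtualYukawa.logDerivative t τ)) ∧
      -- `L ω_n` is a nonzero constant
      (∀ᶠ s in VirtualYukawa.nearZero, VirtualYukawa.applyOp L (VirtualYukawa.omega H n) s =
        n.factorial / (2 * Real.pi * Complex.I) ^ n) ∧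
      -- formula after rescaling `ω_n` to `c ω_n` with `L (c ω_n) = 1`
      (∀ c : ℂ,
        (∀ᶠ s in VirtualYukawa.nearZero,
          VirtualYukawa.applyOp L (fun z => c * VirtualYukawa.omega H n z) s = 1) →
        ∀ τ : ℍ, AnalyticAt ℂ (t ∘ ofComplex) τ → t τ ≠ 0 →
          iteratedDeriv n (fun z => c * 𝔉 z) (τ : ℂ) =
            1 / n.factorial * (F τ * VirtualYukawa.logDerivative t τ)) := by
  open VirtualYukawa in
  obtain ⟨A, hA, hP⟩ := exists_of_comap_im
    (hmod.eventually_iteratedDeriv_prepotential hn hΓ hL hH)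
  obtain ⟨𝔉, h𝔉, h𝔉Y, h𝔉P⟩ := exists_iteratedDeriv_eq n
    (fun z hz =>
      (hmod.analyticAt_virtualYukawa hn hΓ hL hz).differentiableAt.differentiableWithinAt) hA
    (fun z hz => (hP z hz).1.differentiableAt.differentiableWithinAt) (fun z hz => (hP z hz).2)
  have hE : ∀ τ : ℍ, iteratedDeriv n 𝔉 (τ : ℂ) = virtualYukawa n t F τ := by
    intro τ
    rw [h𝔉Y τ τ.im_pos, Function.comp, ofComplex_apply]
  have hY : ∀ τ : ℍ, AnalyticAt ℂ (t ∘ ofComplex) τ → t τ ≠ 0 → virtualYukawa n t F τ =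
      1 / (2 * Real.pi * Complex.I) ^ n * (F τ * logDerivative t τ) := by
    intro τ ht h0
    rw [hmod.virtualYukawa_eq ht h0, coupling, logDerivative, Function.comp, Function.comp,
      ofComplex_apply]
  have hω : ∀ᶠ s in nearZero, applyOp L (omega H n) s =
      n.factorial / (2 * Real.pi * Complex.I) ^ n := by
    simpa using hH.applyOp_omega hL.mum le_rfl
  refine ⟨𝔉, virtualYukawa n t F, ?_, hmod.isModularForm_virtualYukawa hn hΓ hL, ⟨h𝔉, hE⟩, hY, hω,
    fun c hc τ ht h0 => ?_⟩
  · have hlt : ∀ᶠ z : ℂ in comap Complex.im atTop, A < z.im :=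
      tendsto_comap.eventually (eventually_gt_atTop A)
    filter_upwards [tendsto_coe_atImInfty.eventually hlt] with τ hτ
    rw [h𝔉P τ hτ, logAlong, ofComplex_apply]
  · obtain ⟨s, hs1, hs2⟩ := (hc.and hω).exists
    rw [applyOp_eq_opAlong_exp, opAlong_const_mul, ← applyOp_eq_opAlong_exp, hs2] at hs1
    have hfac : (n.factorial : ℂ) ≠ 0 := by exact_mod_cast n.factorial_ne_zero
    rw [iteratedDeriv_const_mul_field, hE, hY τ ht h0, ← mul_assoc]
    congr 1
    rw [eq_div_iff hfac]
    linear_combination hs1
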